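/- **Model.** Let $Y_i=\mu_i+\xi_i\varepsilon_i$, $i\in\mathbb Z$, where $\mu_i$ and $\xi_i>0$ are measurable functions of a sub-collection $\boldsymbol S_i$ of the past observations $(Y_{i-1},Y_{i-2},\dots)$, and the innovations $\varepsilon_i$ are iid with distribution function $F$, with $\varepsilon_i$ independent of $(Y_j)_{j<i}$. Let $Q(p)=\inf\{x:F(x)\ge p\}$ and, at time $n+1$, $Q_{n+1}(\tau)=\mu_{n+1}+\xi_{n+1}Q(\tau)$. Conditional probabilities of $Y_{n+1}$ below are given the past observations $\boldsymbol S_{n+1}$ on which $Y_{n+1}$ depends. At $\gamma=0$ (or $\widehat\gamma_n=0$), expressions $(x^{\gamma}-1)/\gamma$ are read as $\log x$, and the other formulas as their limits. **Levels.** Let $k=k_n\in\mathbb N$ with $k\to\infty$, $k/n\to0$, let $0<\nu_n\le k$, $\tau_I=1-k/n$, $\tau_E=1-\nu_n/n$, $\tau^\star=(1-\tau_E)/(1-\tau_I)\to\tau_0\in[0,1]$, $t_I=Q(\tau_I)$, $t_E=Q(\tau_E)$. **Tail of $F$.** Let $\gamma>-1/2$ and $\rho\le0$. $F$ is twice differentiable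 in its upper tail, $Q$ is twice differentiable near $1$, and $$A(t)=\frac{Q''(1-1/t)/t-2Q'(1-1/t)}{Q'(1-1/t)}+1-\gamma$$ satisfies: $A(t)\to0$, $|A|$ is regularly varying at infinity with index $\rho$, and for a function $a>0$ and all $x>0$, as $u\downarrow0$, $$\frac1{A(1/u)}\Big(\frac{Q(1-ux)-Q(1-u)}{a(1/u)}-\frac{x^{-\gamma}-1}{\gamma}\Big)\to\int_1^{1/x}v^{\gamma-1}\int_1^vr^{\rho-1}\,dr\,dv .$$ If $\rho=\tau_0=0$, $|A|$ is nonincreasing near infinity. Let $w_\gamma(x)=\log x,\ \log^2x,\ x^{-\gamma}$ for $\gamma>0$, $\gamma=0$, $\gamma<0$ respectively, and $\bar w_n=\max\{1,w_\gamma(1/\tau^\star)\}$ (which is of the same order as $w_\gamma(1/\tau^\star)$ unless $\gamma\ge0$ and $\tau_0=1$). Assume $A(n/k)\,\bar w_n\to0$ and $\sqrt k\,|A(n/k)|\to\lambda\in(0,\infty)$. **Estimators.** For $i\le n+1$ let $\widehat\mu_i^{(n)},\widehat\xi_i^{(n)}$ be measurable functions of $\boldsymbol Y_n=(Y_1,\dots,Y_n)$;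 let $\widehat\varepsilon_i^{(n)}=(Y_i-\widehat\mu_i^{(n)})/\widehat\xi_i^{(n)}$, $i\le n$, with order statistics $\widehat\varepsilon^{(n)}_{1,n}\le\dots\le\widehat\varepsilon^{(n)}_{n,n}$, and let $\widehat\gamma_n,\widehat\sigma_n$ be measurable functions of $(\widehat\varepsilon^{(n)}_{n-k,n},\dots,\widehat\varepsilon^{(n)}_{n,n})$. Let $H_{(\gamma,\sigma)}$ and $h_{(\gamma,\sigma)}$ be the distribution function and the density of the generalized Pareto law on $(0,\infty)$, resp. $(0,-\sigma/\gamma)$ if $\gamma<0$, i.e. $H_{(\gamma,\sigma)}(x)=1-(1+\gamma x/\sigma)^{-1/\gamma}$ there. With $\widehat\theta_n=(\widehat\gamma_n,\widehat\sigma_n)$ put $$\widehat h_{\tau_E}(z)=h_{\widehat\theta_n}\Big((z-\widehat\varepsilon^{(n)}_{n-k,n}){\tau^\star}^{\widehat\gamma_n}-\widehat\sigma_n\frac{1-{\tau^\star}^{\widehat\gamma_n}}{\widehat\gamma_n}\Big){\tau^\star}^{\widehat\gamma_n},\qquad \widehat H_{\tau_I}(z)=H_{\widehat\theta_n}(z-\widehat\varepsilon^{(n)}_{n-k,n}),$$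 $$\widehat f_{\tau_E}(y\mid\boldsymbol Y_n)=\frac1{\widehat\xi^{(n)}_{n+1}}\widehat h_{\tau_E}\Big(\frac{y-\widehat\mu^{(n)}_{n+1}}{\widehat\xi^{(n)}_{n+1}}\Big),\quad \widehat F_{\tau_I}(y\mid\boldsymbol Y_n)=\widehat H_{\tau_I}\Big(\frac{y-\widehat\mu^{(n)}_{n+1}}{\widehat\xi^{(n)}_{n+1}}\Big),\quad \widehat F_{n+1}(y)=\tau_I+(1-\tau_I)\widehat F_{\tau_I}(y\mid\boldsymbol Y_n).$$ **Rates of the estimators.** There are sequences $m_n,l_n\ge0$, $m_n\to0$, $l_n\to0$, with $(\mu_{n+1}-\widehat\mu^{(n)}_{n+1})/\widehat\xi^{(n)}_{n+1}=O_{\mathbb P}(m_n)$, $\xi_{n+1}/\widehat\xi^{(n)}_{n+1}-1=O_{\mathbb P}(l_n)$ and $$\delta_n:=l_n\frac{|t_I+a(n/k)((1/\tau^\star)^\gamma-1)/\gamma|}{a(n/k)(1/\tau^\star)^\gamma}+\frac{m_n}{a(n/k)(1/\tau^\star)^\gamma}\to0 .$$ For every $C_n\to\infty$ with $C_n=o(\sqrt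 k)$, $|\widehat\gamma_n-\gamma|=O_{\mathbb P}(C_n/\sqrt k)$ and $|\widehat\sigma_n/a(n/k)-1|=O_{\mathbb P}(C_n/\sqrt k)$. Finally $\sqrt k(\widehat\varepsilon^{(n)}_{n-k,n}-t_I)=O_{\mathbb P}(a(n/k))$. **Conclusion.** Let $\epsilon_n\to0$ with $\sqrt k\,\epsilon_n\to\infty$ and $\epsilon_n\bar w_n\to0$. Let $\mathscr H(f,g)=(\int(\sqrt f-\sqrt g)^2)^{1/2}$. (i) Let $f^\star_{t_{n+1}}$ be the conditional density of $Y_{n+1}$ given $Y_{n+1}>t_{n+1}$ and $\boldsymbol S_{n+1}$, with $t_{n+1}=Q_{n+1}(\tau_E)$. Then $$\mathscr H\big(f^\star_{t_{n+1}},\widehat f_{\tau_E}(\cdot\mid\boldsymbol Y_n)\big)=O_{\mathbb P}\big(\sqrt{\epsilon_n\bar w_n+\delta_n}+l_n\big).$$ (ii) For every $\alpha\in(0,1)$ and all measurable regions $\mathcal P_{\tau_E}\subset\mathbb R$ depending on $\boldsymbol Y_n$ that satisfy $\int_{\mathcal P_{\tau_E}}\widehat h_{\tau_E}(z)\,dz=1-\alpha$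 with probability tending to one, with $\mathcal R_{\tau_E}=\widehat\mu^{(n)}_{n+1}+\widehat\xi^{(n)}_{n+1}\mathcal P_{\tau_E}$, $$\mathbb P\big(Y_{n+1}\in\mathcal R_{\tau_E}\mid Y_{n+1}>Q_{n+1}(\tau_E),\boldsymbol S_{n+1}\big)=1-\alpha+O_{\mathbb P}\big(\sqrt{\epsilon_n\bar w_n+\delta_n}+l_n\big),$$ where the left side is the conditional law of $Y_{n+1}$ evaluated at the realized region. (iii) If $\sqrt k\,m_n=O(a(n/k)(1/\tau^\star)^\gamma\bar w_n)$ and $\sqrt k\,l_nt_E=O(a(n/k)(1/\tau^\star)^\gamma\bar w_n)$, then, with $t_{n+1}=Q_{n+1}(\tau_I)$ and $Q^\star_{t_{n+1}}(p)=\inf\{y\ge t_{n+1}:\mathbb P(Y_{n+1}\le y\mid Y_{n+1}>t_{n+1},\boldsymbol S_{n+1})\ge p\}$, $$\frac{1-\widehat F_{\tau_I}(Q^\star_{t_{n+1}}(1-\tau^\star)\mid\boldsymbol Y_n)}{\tau^\star}=1+O_{\mathbb P}(\epsilon_n\bar w_n),\qquad \frac{1-\widehat F_{n+1}(Q_{n+1}(\tau_E))}{1-\tau_E}=1+O_{\mathbb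 P}(\epsilon_n\bar w_n).$$ -/

import Mathlib

open Filter Topology MeasureTheory ProbabilityTheory Set Asymptotics

noncomputable section

/-- Stochastic boundedness `X n = O_P(r n)`. -/
def IsBigOP {Ω : Type*} [MeasurableSpace Ω] (P : Measure Ω) (X : ℕ → Ω → ℝ) (r : ℕ → ℝ) : Prop :=
  ∀ η : ℝ, 0 < η → ∃ M : ℝ, 0 < M ∧
    ∀ᶠ n in atTop, P {ω | M * r n < |X n ω|} ≤ ENNReal.ofReal η

/-- Hellinger distance between two densities on the real line. -/
def hellinger (f g : ℝ → ℝ) : ℝ :=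
  Real.sqrt (∫ y, (Real.sqrt (f y) - Real.sqrt (g y)) ^ 2)

/-- `(x ^ γ - 1) / γ`, read as `log x` when `γ = 0`. -/
def boxCox (γ x : ℝ) : ℝ := if γ = 0 then Real.log x else (x ^ γ - 1) / γ

/-- Distribution function of the generalized Pareto law with shape `γ` and scale `σ > 0`
(equal to `1` at and beyond the right end-point `-σ / γ` when `γ < 0`). -/
def gpCdf (γ σ x : ℝ) : ℝ :=
  if x ≤ 0 then 0
  else if γ = 0 then 1 - Real.exp (-(x / σ))
  else 1 - (max 0 (1 + γ * (x / σ))) ^ (-1 / γ)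

/-- Density of the generalized Pareto law with shape `γ` and scale `σ > 0`; its support is
`(0, ∞)` when `γ ≥ 0` and `(0, -σ / γ)` when `γ < 0`. -/
def gpDensity (γ σ x : ℝ) : ℝ :=
  if 0 < x ∧ 0 < 1 + γ * (x / σ) then
    (if γ = 0 then Real.exp (-(x / σ)) else (1 + γ * (x / σ)) ^ (-(1 / γ + 1))) / σ
  else 0

/-- Generalized Pareto predictive distribution function: intermediate threshold `u`, level
ratio `s`; the argument is `(y - u) s ^ γ - σ (1 - s ^ γ) / γ`. -/
def gpPredCdf (γ σ u s y : ℝ) : ℝ := gpCdf γ σ ((y - u) * s ^ γ + σ * boxCox γ s)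

/-- The density that corresponds to `gpPredCdf`. -/
def gpPredDensity (γ σ u s y : ℝ) : ℝ :=
  gpDensity γ σ ((y - u) * s ^ γ + σ * boxCox γ s) * s ^ γ

/-- The weight function `w_γ`. -/
def wFun (γ x : ℝ) : ℝ :=
  if 0 < γ then Real.log x else if γ = 0 then Real.log x ^ 2 else x ^ (-γ)

/-- `max 1 w_γ`. -/
def wBar (γ x : ℝ) : ℝ := max 1 (wFun γ x)

/-- Left-continuous inverse of a distribution function. -/
def quantile (F : ℝ → ℝ) (p : ℝ) : ℝ := sInf {x | p ≤ F x}

/-- The second-order von Mises rate function. -/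
def rateA (F : ℝ → ℝ) (γ t : ℝ) : ℝ :=
  (deriv (deriv (quantile F)) (1 - 1 / t) / t - 2 * deriv (quantile F) (1 - 1 / t))
    / deriv (quantile F) (1 - 1 / t) + 1 - γ

/-- Second-order von Mises type condition with extreme value index `γ`, second-order parameter
`ρ` and scaling function `a`. Differentiability is only needed in the upper tail. -/
structure SecondOrderCondition (F : ℝ → ℝ) (γ ρ : ℝ) (a : ℝ → ℝ) : Prop where
  diff_F : ∃ x₀, F x₀ < 1 ∧ ∀ x, x₀ < x → F x < 1 →
    DifferentiableAt ℝ F x ∧ DifferentiableAt ℝ (deriv F) x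
  diff_Q : ∀ᶠ p in 𝓝[<] (1 : ℝ),
    DifferentiableAt ℝ (quantile F) p ∧ DifferentiableAt ℝ (deriv (quantile F)) p
  a_pos : ∀ᶠ t in atTop, 0 < a t
  rho_nonpos : ρ ≤ 0
  rate_zero : Tendsto (rateA F γ) atTop (𝓝 0)
  regularly_varying : ∀ x : ℝ, 0 < x →
    Tendsto (fun t => |rateA F γ (t * x)| / |rateA F γ t|) atTop (𝓝 (x ^ ρ))
  second_order : ∀ x : ℝ, 0 < x →
    Tendsto
      (fun u : ℝ => 1 / rateA F γ (1 / u) *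
        ((quantile F (1 - u * x) - quantile F (1 - u)) / a (1 / u) - boxCox γ (1 / x)))
      (𝓝[>] 0)
      (𝓝 (∫ v in (1 : ℝ)..(1 / x), v ^ (γ - 1) * ∫ r in (1 : ℝ)..v, r ^ (ρ - 1)))

/-- A location-scale time series `Y_i = μ_i + ξ_i ε_i`, where `μ_i` and `ξ_i > 0` are measurable
functions of a sub-collection `(Y_j)`, `j ∈ pastIdx i`, of the past observations, and the iid
innovations are such that `ε_i` is independent of the past `(Y_j)`, `j < i`. -/
structure LocationScaleSeries {Ω : Type*} [MeasurableSpace Ω] (P : Measure Ω) where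
  innov : ℤ → Ω → ℝ
  Y : ℤ → Ω → ℝ
  pastIdx : ℤ → Set ℤ
  locFun : (i : ℤ) → (pastIdx i → ℝ) → ℝ
  scaleFun : (i : ℤ) → (pastIdx i → ℝ) → ℝ
  pastIdx_lt : ∀ i, ∀ j ∈ pastIdx i, j < i
  measurable_innov : ∀ i, Measurable (innov i)
  measurable_Y : ∀ i, Measurable (Y i)
  measurable_locFun : ∀ i, Measurable (locFun i)
  measurable_scaleFun : ∀ i, Measurable (scaleFun i)
  scale_pos : ∀ i s, 0 < scaleFun i s
  iIndep_innov : iIndepFun innov P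
  ident_innov : ∀ i, IdentDistrib (innov i) (innov 0) P P
  indep_past : ∀ i, IndepFun (innov i) (fun ω (j : Set.Iio i) => Y j ω) P
  model_eq : ∀ i, ∀ᵐ ω ∂P, Y i ω =
    locFun i (fun j => Y j ω) + scaleFun i (fun j => Y j ω) * innov i ω

namespace LocationScaleSeries

variable {Ω : Type*} [MeasurableSpace Ω] {P : Measure Ω} (S : LocationScaleSeries P)

/-- The observations `S_i` on which time `i` depends. -/
def past (i : ℤ) (ω : Ω) : S.pastIdx i → ℝ := fun j => S.Y j ω

def loc (i : ℤ) (ω : Ω) : ℝ := S.locFun i (S.past i ω)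

def scale (i : ℤ) (ω : Ω) : ℝ := S.scaleFun i (S.past i ω)

/-- Distribution function of the innovations. -/
def F : ℝ → ℝ := fun x => cdf (P.map (S.innov 0)) x

/-- Quantile function of the innovations. -/
def Q : ℝ → ℝ := quantile S.F

/-- The sample `(Y_1, …, Y_n)`. -/
def sample (n : ℕ) (ω : Ω) : Fin n → ℝ := fun i => S.Y ((i : ℤ) + 1) ω

/-- The conditional quantile `Q_{n+1}(τ) = μ_{n+1} + ξ_{n+1} Q(τ)`. -/
def condQuantile (n : ℕ) (τ : ℝ) (ω : Ω) : ℝ :=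
  S.loc (n + 1) ω + S.scale (n + 1) ω * S.Q τ

/-- The law of `Y_{n+1}` given `Y_{n+1} > t` and given the past observations on which `Y_{n+1}`
depends: the regular conditional distribution of `Y_{n+1}`, conditioned on `(t, ∞)`. -/
def peakLaw [IsFiniteMeasure P] (n : ℕ) (t : Ω → ℝ) (ω : Ω) : Measure ℝ :=
  ProbabilityTheory.cond
    (condDistrib (S.Y (n + 1)) (S.past (n + 1)) P (S.past (n + 1) ω)) (Set.Ioi (t ω))

/-- Lebesgue density of `peakLaw`. -/
def peakDensity [IsFiniteMeasure P] (n : ℕ) (t : Ω → ℝ) (ω : Ω) (y : ℝ) : ℝ :=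
  ((S.peakLaw n t ω).rnDeriv volume y).toReal

/-- Quantile function of `peakLaw`. The infimum is taken over `[t, ∞)`, where the law lives; this
matters only for `p = 0`, and then the value is `t`. -/
def peakQuantile [IsFiniteMeasure P] (n : ℕ) (t : Ω → ℝ) (p : ℝ) (ω : Ω) : ℝ :=
  sInf {y | t ω ≤ y ∧ p ≤ (S.peakLaw n t ω).real (Set.Iic y)}

end LocationScaleSeries

/-- The `j`-th smallest (`1 ≤ j ≤ n`) of the numbers `x 0, …, x (n - 1)`. -/
def orderStat {n : ℕ} (x : Fin n → ℝ) (j : ℕ) : ℝ :=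
  if h : 0 < j ∧ j ≤ n then x (Tuple.sort x ⟨j - 1, by omega⟩) else 0

/-- The ingredients of the forecasting method: the effective sample size `k`, the sequence `ν`
that defines the extreme level, the estimators of `μ_i` and `ξ_i`, `i ≤ n + 1` (functions of the
sample of size `n`), and the statistics that estimate the generalized Pareto shape and scale from
the `k + 1` largest residuals. -/
structure Forecaster where
  k : ℕ → ℕ
  ν : ℕ → ℝ
  locEst : (n : ℕ) → ℕ → (Fin n → ℝ) → ℝ
  scaleEst : (n : ℕ) → ℕ → (Fin n → ℝ) → ℝ
  shapeStat : (n : ℕ) → (Fin (k n + 1) → ℝ) → ℝ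
  sizeStat : (n : ℕ) → (Fin (k n + 1) → ℝ) → ℝ
  measurable_locEst : ∀ n i, Measurable (locEst n i)
  measurable_scaleEst : ∀ n i, Measurable (scaleEst n i)
  measurable_shapeStat : ∀ n, Measurable (shapeStat n)
  measurable_sizeStat : ∀ n, Measurable (sizeStat n)

namespace Forecaster

variable (M : Forecaster)

/-- Intermediate level `τ_I`. -/
def tauI (n : ℕ) : ℝ := 1 - (M.k n : ℝ) / n

/-- Extreme level `τ_E`. -/
def tauE (n : ℕ) : ℝ := 1 - M.ν n / n

/-- Level ratio `τ*`. -/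
def tauStar (n : ℕ) : ℝ := (1 - M.tauE n) / (1 - M.tauI n)

/-- Residuals `(Y_i - μ̂_i) / ξ̂_i`, `i = 1, …, n`, computed from the sample `y`. -/
def residuals (n : ℕ) (y : Fin n → ℝ) : Fin n → ℝ :=
  fun i => (y i - M.locEst n (i + 1) y) / M.scaleEst n (i + 1) y

/-- The order statistics of the residuals of ranks `n - k, …, n`. -/
def topResiduals (n : ℕ) (y : Fin n → ℝ) : Fin (M.k n + 1) → ℝ :=
  fun i => orderStat (M.residuals n y) (n - M.k n + i)

/-- The residual order statistic of rank `n - k`. -/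
def threshold (n : ℕ) (y : Fin n → ℝ) : ℝ := orderStat (M.residuals n y) (n - M.k n)

def gammaHat (n : ℕ) (y : Fin n → ℝ) : ℝ := M.shapeStat n (M.topResiduals n y)

def sigmaHat (n : ℕ) (y : Fin n → ℝ) : ℝ := M.sizeStat n (M.topResiduals n y)

/-- Estimated `μ_{n+1}`. -/
def muNext (n : ℕ) (y : Fin n → ℝ) : ℝ := M.locEst n (n + 1) y

/-- Estimated `ξ_{n+1}`. -/
def xiNext (n : ℕ) (y : Fin n → ℝ) : ℝ := M.scaleEst n (n + 1) y

/-- Frequentist predictive density at level ratio `s` on the innovation scale. -/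
def innovDensity (n : ℕ) (s : ℝ) (y : Fin n → ℝ) (z : ℝ) : ℝ :=
  gpPredDensity (M.gammaHat n y) (M.sigmaHat n y) (M.threshold n y) s z

/-- Frequentist predictive distribution function at level ratio `s` on the innovation scale. -/
def innovCdf (n : ℕ) (s : ℝ) (y : Fin n → ℝ) (z : ℝ) : ℝ :=
  gpPredCdf (M.gammaHat n y) (M.sigmaHat n y) (M.threshold n y) s z

/-- Frequentist predictive density for the next observation, at the extreme level. -/
def nextDensity (n : ℕ) (y : Fin n → ℝ) (v : ℝ) : ℝ :=
  M.innovDensity n (M.tauStar n) y ((v - M.muNext n y) / M.xiNext n y) / M.xiNext n y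

/-- Frequentist predictive distribution function for the next observation, at the intermediate
level (level ratio `1`). -/
def nextCdfI (n : ℕ) (y : Fin n → ℝ) (v : ℝ) : ℝ :=
  M.innovCdf n 1 y ((v - M.muNext n y) / M.xiNext n y)

/-- Tail forecaster `τ_I + (1 - τ_I) F̂_{τ_I}` of the one-step-ahead conditional distribution. -/
def tailForecaster (n : ℕ) (y : Fin n → ℝ) (v : ℝ) : ℝ :=
  M.tauI n + (1 - M.tauI n) * M.nextCdfI n y v

/-- The image `μ̂_{n+1} + ξ̂_{n+1} B` of a region on the innovation scale. -/
def nextRegion (n : ℕ) (y : Fin n → ℝ) (B : Set ℝ) : Set ℝ :=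
  (fun z => M.muNext n y + M.xiNext n y * z) '' B

/-- The scale `a(n/k) (1/τ*) ^ γ` of the peaks above the extreme threshold. -/
def peakScale (γ : ℝ) (a : ℝ → ℝ) (n : ℕ) : ℝ :=
  a ((n : ℝ) / M.k n) * (1 / M.tauStar n) ^ γ

/-- The sequence `δ_n`, where `Q` is the innovation quantile function. -/
def delta (Q : ℝ → ℝ) (γ : ℝ) (a : ℝ → ℝ) (m l : ℕ → ℝ) (n : ℕ) : ℝ :=
  l n * (|Q (M.tauI n) + a ((n : ℝ) / M.k n) * boxCox γ (1 / M.tauStar n)| / M.peakScale γ a n)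
    + m n / M.peakScale γ a n

/-- The value `max 1 (w_γ (1/τ*))`. -/
def wSeq (γ : ℝ) (n : ℕ) : ℝ := wBar γ (1 / M.tauStar n)

end Forecaster

end

/-! The statements reduce to deterministic perturbation bounds on events of probability close to
one. Write U(t) = Q(1 - 1/t) and b(t) = t U'(t). The rate A is the error in the logarithmic
derivative of b: t b'(t) / b(t) = γ + A(t). Hence b(tv) = b(t) v^γ exp(∫_1^v A(tu)/u du), and the
excess (U(tv) - U(t)) / b(t) has derivative v^(γ-1) times the same exponential: it is a small
perturbation of the Box-Cox function (v^γ - 1)/γ.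

Let R be unit Pareto, with density r^(-2) on r > 1. An innovation conditioned to exceed U(t) has the
law of U(tR), and a generalized Pareto variable has the law of σ (R^γ - 1)/γ. Given the past, the
next observation is an affine image of an innovation, so the true and the predictive density are
those of two nearby increasing functions of the same R (`IsParetoImage`).

With T = n/k and X = 1/τ*, the extreme quantile is U(TX). Extrapolation from T to TX turns errors of
size η in shape, relative scale and threshold into errors of size η w̄ relative to a(T) X^γ: the
weight w_γ is what integrating v^(γ-1) log v up to X produces (`exists_abs_le_wBar`). This governs
the bias of order A(T) (`exists_extreme_bounds`) and the estimation error
(`exists_estimated_extreme_bounds`).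

For total variation, ∫|f - g| = 2 ∫(f - g)⁺, so it suffices to bound g from below along the
parametrization of f. Matching each r with the r' that gives the same point costs a relative error
of order η r^(3/4); the exponent is available because γ > -1/2, and r^(3/4 - 2) is integrable. Total
variation is thus O(ε w̄ + δ). It bounds the squared Hellinger distance and the coverage error. For
the tail probabilities, the Box-Cox cocycle identity puts the true quantile at the generalized
Pareto point with tail 1/(Xr), with r close to 1.

The estimator hypothesis is applied with C_n = √k ε_n, which gives the rate ε_n; as √k |A(n/k)|
stays bounded, ε_n eventually dominates |A(n/k)| too. -/

noncomputable section

/-! ### Regular variation: uniform convergence and Potter bounds. -/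

/-- Uniform convergence theorem for measurable functions with asymptotically vanishing
increments. -/
theorem exists_forall_abs_increment_le {g : ℝ → ℝ} (hg : Measurable g)
    (h : ∀ u : ℝ, Tendsto (fun x => g (x + u) - g x) atTop (𝓝 0)) {e : ℝ} (he : 0 < e) :
    ∃ X : ℝ, ∀ x, X ≤ x → ∀ u ∈ Icc (0 : ℝ) 1, |g (x + u) - g x| ≤ e := by
  by_contra! hcon
  choose x hx u hu hbad using fun N : ℕ => hcon (N : ℝ)
  have hxt : Tendsto x atTop atTop := tendsto_atTop_mono hx tendsto_natCast_atTop_atTop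
  have hxut : Tendsto (fun N => x N + u N) atTop atTop :=
    tendsto_atTop_mono (fun N => by have := (hu N).1; linarith [hx N]) tendsto_natCast_atTop_atTop
  have key : ∀ y : ℕ → ℝ, Tendsto y atTop atTop → ∀ᶠ N in atTop,
      (volume.restrict (Icc (0 : ℝ) 2)) {v | ENNReal.ofReal (e / 2) ≤
        edist (g (y N + v) - g (y N)) 0} < ENNReal.ofReal (1 / 4) := by
    intro y hy
    have hm : TendstoInMeasure (volume.restrict (Icc (0 : ℝ) 2))
        (fun N v => g (y N + v) - g (y N)) atTop (fun _ => 0) := by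
      apply tendstoInMeasure_of_tendsto_ae
      · intro N
        exact ((hg.comp (measurable_const_add _)).sub_const _).aestronglyMeasurable
      · exact Eventually.of_forall fun v => (h v).comp hy
    exact (hm (ENNReal.ofReal (e / 2)) (by simpa using he)).eventually_lt_const (by simp)
  obtain ⟨N, h1, h2⟩ := ((key x hxt).and (key _ hxut)).exists
  set B1 := {v | ENNReal.ofReal (e / 2) ≤ edist (g (x N + v) - g (x N)) 0}
  set B2 := {v | ENNReal.ofReal (e / 2) ≤ edist (g (x N + u N + v) - g (x N + u N)) 0}
  obtain ⟨hu0, hu1⟩ := hu N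
  -- The exceptional sets around x and around x + u have measure below 1/4 each, so they cannot
  -- cover [1, 2]. A point v outside both makes g(x + v) close to g(x) and to g(x + u) at once.
  -- Starting at 1 keeps v - u inside [0, 2].
  have hsub : ¬ Icc (1 : ℝ) 2 ⊆ (B1 ∩ Icc 0 2) ∪ ((fun v => v - u N) ⁻¹' (B2 ∩ Icc 0 2)) := by
    intro hs
    have hle := (measure_mono (μ := (volume : Measure ℝ)) hs).trans (measure_union_le _ _)
    rw [Measure.restrict_apply' measurableSet_Icc] at h1 h2
    have h3 : volume ((fun v => v - u N) ⁻¹' (B2 ∩ Icc 0 2)) = volume (B2 ∩ Icc (0 : ℝ) 2) := by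
      simpa only [sub_eq_add_neg] using measure_preimage_add_right volume (-u N) (B2 ∩ Icc 0 2)
    rw [h3, Real.volume_Icc] at hle
    have := hle.trans_lt (ENNReal.add_lt_add h1 h2)
    rw [← ENNReal.ofReal_add (by norm_num) (by norm_num),
      ENNReal.ofReal_lt_ofReal_iff (by norm_num)] at this
    norm_num at this
  obtain ⟨v, hv, hvn⟩ := Set.not_subset.1 hsub
  simp only [mem_union, mem_inter_iff, mem_preimage, not_or, not_and_or] at hvn
  have hv1 : v ∉ B1 := hvn.1.resolve_right (fun hc => hc ⟨by linarith [hv.1], hv.2⟩)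
  have hv2 : v - u N ∉ B2 :=
    hvn.2.resolve_right (fun hc => hc ⟨by linarith [hv.1], by linarith [hv.2]⟩)
  simp only [B1, B2, mem_ofPred_eq, not_le, edist_dist, Real.dist_eq, sub_zero] at hv1 hv2
  rw [ENNReal.ofReal_lt_ofReal_iff (by positivity)] at hv1 hv2
  rw [show x N + u N + (v - u N) = x N + v by ring] at hv2
  have := hbad N
  rw [abs_lt] at hv1 hv2
  rcases lt_abs.1 this with h | h <;> linarith

/-- Potter bound for a measurable regularly varying function. -/
theorem potter_bound {A : ℝ → ℝ} (hA : Measurable A) {ρ : ℝ}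
    (hrv : ∀ x : ℝ, 0 < x → Tendsto (fun t => |A (t * x)| / |A t|) atTop (𝓝 (x ^ ρ)))
    {d : ℝ} (hd : 0 < d) :
    ∃ C : ℝ, 0 < C ∧ ∀ᶠ t in atTop, ∀ x : ℝ, 1 ≤ x → |A (t * x)| ≤ C * |A t| * x ^ (ρ + d) := by
  have hne : ∀ᶠ t in atTop, A t ≠ 0 := by
    have h1 := hrv 1 one_pos
    rw [Real.one_rpow] at h1
    filter_upwards [h1.eventually_ne one_ne_zero] with t ht h0
    simp [h0] at ht
  -- In logarithmic coordinates and with the power t^ρ removed, regular variation says that the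
  -- increments of g vanish at infinity.
  set g : ℝ → ℝ := fun x => Real.log |A (Real.exp x)| - ρ * x
  have hg : Measurable g := by
    have : Measurable fun x => |A (Real.exp x)| := (hA.comp Real.measurable_exp).abs
    exact (Real.measurable_log.comp this).sub (measurable_const.mul measurable_id)
  have hinc : ∀ u : ℝ, Tendsto (fun x => g (x + u) - g x) atTop (𝓝 0) := by
    intro u
    have h1 := (hrv (Real.exp u) (Real.exp_pos u)).comp Real.tendsto_exp_atTop
    have h2 := h1.log (Real.rpow_pos_of_pos (Real.exp_pos u) ρ).ne'
    have h3 := h2.sub_const (ρ * u)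
    rw [Real.log_rpow (Real.exp_pos u), Real.log_exp, sub_self] at h3
    refine h3.congr' ?_
    have hne' := Real.tendsto_exp_atTop.eventually hne
    have hne'' := (Real.tendsto_exp_atTop.comp (tendsto_atTop_add_const_right atTop u
      tendsto_id)).eventually hne
    filter_upwards [hne', hne''] with x hx hx2
    simp only [Function.comp, id] at hx2
    simp only [Function.comp, g, ← Real.exp_add]
    rw [Real.log_div (abs_ne_zero.2 hx2) (abs_ne_zero.2 hx)]
    ring
  obtain ⟨X, hX⟩ := exists_forall_abs_increment_le hg hinc hd
  -- Chaining unit steps, each costing at most d, gives growth at most linear with slope d. The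
  -- extra step for the fractional part becomes the constant exp d.
  have hiter : ∀ N : ℕ, ∀ x, X ≤ x → ∀ u ∈ Icc (0 : ℝ) 1, g (x + (N + u)) - g x ≤ d * (N + 1) := by
    intro N
    induction N with
    | zero =>
      intro x hx u hu
      have := (abs_le.1 (hX x hx u hu)).2
      simpa using this
    | succ N ih =>
      intro x hx u hu
      have h1 := ih x hx 1 ⟨zero_le_one, le_rfl⟩
      have h2 := (abs_le.1 (hX (x + (N + 1)) (by have : (0 : ℝ) ≤ N := N.cast_nonneg
                                                 linarith) u hu)).2
      have e1 : x + ((N : ℝ) + 1) + u = x + (((N + 1 : ℕ) : ℝ) + u) := by push_cast; ring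
      rw [e1] at h2
      push_cast at h2 ⊢
      linarith
  refine ⟨Real.exp d, Real.exp_pos d, ?_⟩
  have hne2 : ∃ t₁, ∀ t, t₁ ≤ t → A t ≠ 0 := eventually_atTop.1 hne
  obtain ⟨t₁, ht₁⟩ := hne2
  filter_upwards [eventually_ge_atTop (Real.exp X), eventually_ge_atTop t₁] with t ht htt x hx
  have ht0 : 0 < t := (Real.exp_pos X).trans_le ht
  have hx0 : 0 < x := one_pos.trans_le hx
  have hl : X ≤ Real.log t := (Real.le_log_iff_exp_le ht0).2 ht
  have hlx : 0 ≤ Real.log x := Real.log_nonneg hx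
  have h1 := hiter ⌊Real.log x⌋₊ (Real.log t) hl (Real.log x - ⌊Real.log x⌋₊)
    ⟨by linarith [Nat.floor_le hlx], by linarith [Nat.lt_floor_add_one (Real.log x)]⟩
  have h2 : g (Real.log t + Real.log x) - g (Real.log t) ≤ d * (Real.log x + 1) := by
    rw [show (⌊Real.log x⌋₊ : ℝ) + (Real.log x - ⌊Real.log x⌋₊) = Real.log x by ring] at h1
    exact h1.trans (mul_le_mul_of_nonneg_left (by linarith [Nat.floor_le hlx]) hd.le)
  have htx : t ≤ t * x := le_mul_of_one_le_right ht0.le hx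
  have ha1 : 0 < |A t| := abs_pos.2 (ht₁ t htt)
  have ha2 : 0 < |A (t * x)| := abs_pos.2 (ht₁ _ (htt.trans htx))
  simp only [g, ← Real.log_mul ht0.ne' hx0.ne', Real.exp_log ht0,
    Real.exp_log (mul_pos ht0 hx0)] at h2
  rw [Real.log_mul ht0.ne' hx0.ne'] at h2
  rw [← Real.log_le_log_iff ha2 (by positivity), Real.log_mul (by positivity) (by positivity),
    Real.log_mul (by positivity) ha1.ne', Real.log_exp, Real.log_rpow hx0]
  linarith

theorem measurable_rateA (F : ℝ → ℝ) (γ : ℝ) : Measurable (rateA F γ) := by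
  have h1 : Measurable fun t : ℝ => 1 - 1 / t := by fun_prop
  have h2 := (measurable_deriv (quantile F)).comp h1
  have h3 := (measurable_deriv (deriv (quantile F))).comp h1
  exact ((((h3.div measurable_id).sub (h2.const_mul 2)).div h2).add_const 1).sub_const γ

/-! ### Derivative comparison and calculus of the Box-Cox function. -/

/-- Comparison of a function with a majorant of its derivative. -/
theorem abs_le_of_abs_deriv_le {f f' B B' : ℝ → ℝ} {X : ℝ} (hX : 1 ≤ X)
    (hf : ∀ v ∈ Icc 1 X, HasDerivAt f (f' v) v) (hB : ∀ v ∈ Icc 1 X, HasDerivAt B (B' v) v)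
    (hf1 : f 1 = 0) (hB1 : 0 ≤ B 1) (h : ∀ v ∈ Icc 1 X, |f' v| ≤ B' v) : |f X| ≤ B X := by
  have := image_norm_le_of_norm_deriv_right_le_deriv_boundary' (f := f) (f' := f') (a := 1) (b := X)
    (fun v hv => (hf v hv).continuousAt.continuousWithinAt)
    (fun v hv => (hf v (Ico_subset_Icc_self hv)).hasDerivWithinAt) (B := B) (B' := B')
    (by simpa [hf1] using hB1) (fun v hv => (hB v hv).continuousAt.continuousWithinAt)
    (fun v hv => (hB v (Ico_subset_Icc_self hv)).hasDerivWithinAt)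
    (fun v hv => h v (Ico_subset_Icc_self hv))
  exact this (right_mem_Icc.2 hX)

/-- Monotone comparison of two functions with ordered derivatives. -/
theorem sub_le_sub_of_deriv_le {f f' B B' : ℝ → ℝ} {a X : ℝ} (hX : a ≤ X)
    (hf : ∀ v ∈ Icc a X, HasDerivAt f (f' v) v) (hB : ∀ v ∈ Icc a X, HasDerivAt B (B' v) v)
    (h : ∀ v ∈ Icc a X, f' v ≤ B' v) : f X - f a ≤ B X - B a := by
  have hd : ∀ v ∈ Icc a X, HasDerivAt (fun v => B v - f v) (B' v - f' v) v :=
    fun v hv => (hB v hv).sub (hf v hv)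
  have := monotoneOn_of_deriv_nonneg (convex_Icc a X) (f := fun v => B v - f v)
    (fun v hv => (hd v hv).continuousAt.continuousWithinAt)
    (fun v hv => (hd v (interior_subset hv)).differentiableAt.differentiableWithinAt)
    (fun v hv => by
      rw [(hd v (interior_subset hv)).deriv]; linarith [h v (interior_subset hv)])
    (left_mem_Icc.2 hX) (right_mem_Icc.2 hX) hX
  simp only at this
  linarith

theorem hasDerivAt_boxCox (γ : ℝ) {x : ℝ} (hx : 0 < x) :
    HasDerivAt (boxCox γ) (x ^ (γ - 1)) x := by
  rcases eq_or_ne γ 0 with rfl | h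
  · have : boxCox 0 = Real.log := by funext y; simp [boxCox]
    rw [this, zero_sub, Real.rpow_neg_one]
    exact Real.hasDerivAt_log hx.ne'
  · have : boxCox γ = fun y => (y ^ γ - 1) / γ := by funext y; simp [boxCox, h]
    rw [this]
    have := ((Real.hasDerivAt_rpow_const (p := γ) (Or.inl hx.ne')).sub_const 1).div_const γ
    rwa [mul_div_cancel_left₀ _ h] at this

@[simp] theorem boxCox_one (γ : ℝ) : boxCox γ 1 = 0 := by simp [boxCox]

/-- Split the integral of v^(γ-1) over [1, xy] at x and rescale. This cocycle identity is the
threshold stability of generalized Pareto laws. -/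
theorem boxCox_mul (γ : ℝ) {x y : ℝ} (hx : 0 < x) (hy : 0 < y) :
    boxCox γ (x * y) = boxCox γ x + x ^ γ * boxCox γ y := by
  unfold boxCox
  split_ifs with h
  · subst h; rw [Real.log_mul hx.ne' hy.ne']; simp
  · rw [Real.mul_rpow hx.le hy.le]; field_simp; ring

theorem strictMonoOn_boxCox (γ : ℝ) : StrictMonoOn (boxCox γ) (Ioi 0) := by
  apply strictMonoOn_of_deriv_pos (convex_Ioi 0)
  · exact fun x hx => (hasDerivAt_boxCox γ hx).continuousAt.continuousWithinAt
  · intro x hx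
    rw [interior_Ioi] at hx
    rw [(hasDerivAt_boxCox γ hx).deriv]
    exact Real.rpow_pos_of_pos hx _

theorem boxCox_nonneg (γ : ℝ) {x : ℝ} (hx : 1 ≤ x) : 0 ≤ boxCox γ x := by
  have := (strictMonoOn_boxCox γ).monotoneOn (mem_Ioi.2 one_pos) (mem_Ioi.2 (one_pos.trans_le hx)) hx
  simpa using this

theorem boxCox_pos (γ : ℝ) {x : ℝ} (hx : 1 < x) : 0 < boxCox γ x := by
  have := (strictMonoOn_boxCox γ) (mem_Ioi.2 one_pos) (mem_Ioi.2 (one_pos.trans hx)) hx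
  simpa using this

/-- `1 + γ (x ^ γ - 1) / γ = x ^ γ`. -/
theorem one_add_mul_boxCox (γ x : ℝ) : 1 + γ * boxCox γ x = x ^ γ := by
  unfold boxCox
  split_ifs with h
  · subst h; simp
  · field_simp; ring

theorem boxCox_one_div (γ : ℝ) {s : ℝ} (hs : 0 < s) :
    boxCox γ (1 / s) = -(boxCox γ s * (1 / s) ^ γ) := by
  have h := boxCox_mul γ (x := 1 / s) (y := s) (by positivity) hs
  rw [one_div_mul_cancel hs.ne', boxCox_one] at h
  linarith

theorem boxCox_le_max_mul_log (γ : ℝ) {x : ℝ} (hx : 1 ≤ x) :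
    boxCox γ x ≤ max 1 (x ^ γ) * Real.log x := by
  have h := sub_le_sub_of_deriv_le (f := boxCox γ) (f' := fun v => v ^ (γ - 1))
    (B := fun v => max 1 (x ^ γ) * Real.log v) (B' := fun v => max 1 (x ^ γ) * v⁻¹) hx
    (fun v hv => hasDerivAt_boxCox γ (one_pos.trans_le hv.1))
    (fun v hv => (Real.hasDerivAt_log (one_pos.trans_le hv.1).ne').const_mul _)
    (fun v hv => by
      have hv0 : 0 < v := one_pos.trans_le hv.1
      rw [Real.rpow_sub_one hv0.ne', div_eq_mul_inv]
      refine mul_le_mul_of_nonneg_right ?_ (by positivity)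
      rcases le_total 0 γ with h | h
      · exact le_max_of_le_right (Real.rpow_le_rpow hv0.le hv.2 h)
      · exact le_max_of_le_left (Real.rpow_le_one_of_one_le_of_nonpos hv.1 h))
  simpa using h

theorem boxCox_neg_one (x : ℝ) : boxCox (-1) x = 1 - 1 / x := by
  rw [boxCox, if_neg (by norm_num), Real.rpow_neg_one]; ring

theorem boxCox_le_boxCox {γ γ' : ℝ} (h : γ ≤ γ') {x : ℝ} (hx : 1 ≤ x) :
    boxCox γ x ≤ boxCox γ' x := by
  have h := sub_le_sub_of_deriv_le hx
    (fun v hv => hasDerivAt_boxCox γ (one_pos.trans_le hv.1))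
    (fun v hv => hasDerivAt_boxCox γ' (one_pos.trans_le hv.1))
    (fun v hv => Real.rpow_le_rpow_of_exponent_le hv.1 (by linarith))
  simpa using h

/-- A lower bound at arguments slightly larger than one. -/
theorem half_le_boxCox_exp {γ z : ℝ} (hγ : -1 ≤ γ) (hz0 : 0 ≤ z) (hz1 : z ≤ 1) :
    z / 2 ≤ boxCox γ (Real.exp z) := by
  -- Monotonicity in the shape reduces to γ = -1, where the function is 1 - 1/x.
  refine le_trans ?_ (boxCox_le_boxCox hγ (Real.one_le_exp hz0))
  rw [boxCox_neg_one]
  have h1 : 1 + z ≤ Real.exp z := by linarith [Real.add_one_le_exp z]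
  have h2 : 1 / Real.exp z ≤ 1 / (1 + z) := one_div_le_one_div_of_le (by linarith) h1
  have h3 : 1 / (1 + z) ≤ 1 - z / 2 := by
    rw [div_le_iff₀ (by linarith)]; nlinarith
  linarith

theorem half_le_boxCox_one_add {γ z : ℝ} (hγ : -1 ≤ γ) (hz0 : 0 ≤ z) (hz1 : z ≤ 1) :
    z / 2 ≤ boxCox γ (1 + z) := by
  refine le_trans ?_ (boxCox_le_boxCox hγ (by linarith))
  rw [boxCox_neg_one]
  have h3 : 1 / (1 + z) ≤ 1 - z / 2 := by
    rw [div_le_iff₀ (by linarith)]; nlinarith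
  linarith

/-- `log v ≤ 8 v ^ (1/8)`. -/
theorem log_le_eight_mul_rpow {v : ℝ} (hv : 0 ≤ v) : Real.log v ≤ 8 * v ^ (1 / 8 : ℝ) := by
  have := Real.log_le_rpow_div hv (ε := 1 / 8) (by norm_num)
  linarith

/-! ### Bounds through the weight function. -/

theorem one_le_wBar (γ x : ℝ) : 1 ≤ wBar γ x := le_max_left _ _

/-- In the form 1 ≤ X^γ w̄, this absorbs errors that do not grow with X, such as that of the
intermediate threshold, into the scale at the extreme level. -/
theorem rpow_neg_le_wBar (γ : ℝ) {X : ℝ} (hX : 1 ≤ X) : X ^ (-γ) ≤ wBar γ X := by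
  rcases lt_trichotomy γ 0 with h | h | h
  · refine le_max_of_le_right ?_
    rw [wFun, if_neg (by linarith), if_neg h.ne]
  · subst h; simpa using one_le_wBar 0 X
  · exact (Real.rpow_le_one_of_one_le_of_nonpos hX (by linarith)).trans (one_le_wBar _ _)

/-- The logarithm is dominated by the weight function. -/
theorem exists_log_le_wBar (γ : ℝ) : ∃ K : ℝ, 0 < K ∧ ∀ X, 1 ≤ X → Real.log X ≤ K * wBar γ X := by
  rcases lt_trichotomy γ 0 with h | h | h
  · refine ⟨1 / (-γ), by have : 0 < -γ := by linarith
                         positivity, fun X hX => ?_⟩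
    have h1 := Real.log_le_rpow_div (x := X) (by linarith) (ε := -γ) (by linarith)
    refine h1.trans ?_
    rw [div_eq_inv_mul, ← one_div]
    have : 0 < -γ := by linarith
    exact mul_le_mul_of_nonneg_left (rpow_neg_le_wBar γ hX) (by positivity)
  · refine ⟨1, one_pos, fun X hX => ?_⟩
    rw [one_mul]; subst h
    rw [wBar, wFun, if_neg (lt_irrefl _), if_pos rfl]
    rcases le_total (Real.log X) 1 with h | h
    · exact le_max_of_le_left h
    · exact le_max_of_le_right (by nlinarith)
  · refine ⟨1, one_pos, fun X hX => ?_⟩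
    rw [one_mul, wBar, wFun, if_pos h]
    exact le_max_right _ _

/-- A function on `[1, X]` whose derivative is at most `κ v ^ (γ - 1) log v` is at most of order
`κ X ^ γ w_γ(X)`. -/
theorem exists_abs_le_wBar (γ : ℝ) : ∃ K : ℝ, 0 < K ∧ ∀ (X κ : ℝ) (f f' : ℝ → ℝ), 1 ≤ X → 0 ≤ κ →
    (∀ v ∈ Icc 1 X, HasDerivAt f (f' v) v) → f 1 = 0 →
    (∀ v ∈ Icc 1 X, |f' v| ≤ κ * v ^ (γ - 1) * Real.log v) →
    |f X| ≤ K * κ * X ^ γ * wBar γ X := by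
  -- For γ < 0, half of the decay of v^γ pays for the logarithm, the integral stays bounded, and 1 ≤
  -- X^γ w̄. For γ ≥ 0, log v ≤ log X comes out of the integral; what remains is log X if γ = 0,
  -- whence the squared logarithm, and at most X^γ/γ if γ > 0.
  rcases lt_or_ge γ 0 with h | h
  · have hg : 0 < -γ := by linarith
    refine ⟨(2 / (-γ)) * (2 / (-γ)), by positivity, fun X κ f f' hX hκ hf hf1 hb => ?_⟩
    have hX0 : 0 < X := by linarith
    have := abs_le_of_abs_deriv_le hX hf (B := fun v => κ * (2 / (-γ)) * boxCox (γ / 2) v)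
      (B' := fun v => κ * (2 / (-γ)) * v ^ (γ / 2 - 1))
      (fun v hv => (hasDerivAt_boxCox _ (one_pos.trans_le hv.1)).const_mul _) hf1 (by simp)
      (fun v hv => by
        have hv0 : 0 < v := one_pos.trans_le hv.1
        refine (hb v hv).trans ?_
        have h1 := Real.log_le_rpow_div hv0.le (ε := -γ / 2) (by linarith)
        have h2 : v ^ (γ - 1) * (v ^ (-γ / 2) / (-γ / 2)) = 2 / (-γ) * v ^ (γ / 2 - 1) := by
          rw [← mul_div_assoc, ← Real.rpow_add hv0, show γ - 1 + -γ / 2 = γ / 2 - 1 by ring]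
          field_simp
        rw [mul_assoc, mul_assoc]
        refine mul_le_mul_of_nonneg_left ?_ hκ
        rw [← h2]
        exact mul_le_mul_of_nonneg_left h1 (by positivity))
    refine this.trans ?_
    have h3 : boxCox (γ / 2) X ≤ 2 / (-γ) := by
      rw [boxCox, if_neg (by linarith), div_le_iff_of_neg (by linarith)]
      have : 2 / (-γ) * (γ / 2) = -1 := by have h0 := h.ne; field_simp
      rw [this]; have := Real.rpow_nonneg hX0.le (γ / 2); linarith
    have h4 : 1 ≤ X ^ γ * wBar γ X := by
      have := mul_le_mul_of_nonneg_left (rpow_neg_le_wBar γ hX) (Real.rpow_nonneg hX0.le γ)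
      rwa [← Real.rpow_add hX0, add_neg_cancel, Real.rpow_zero] at this
    calc κ * (2 / (-γ)) * boxCox (γ / 2) X ≤ κ * (2 / (-γ)) * (2 / (-γ)) := by gcongr
      _ ≤ κ * (2 / (-γ)) * (2 / (-γ)) * (X ^ γ * wBar γ X) :=
          le_mul_of_one_le_right (by positivity) h4
      _ = _ := by ring
  · refine ⟨if γ = 0 then 1 else 1 / γ, ?_, fun X κ f f' hX hκ hf hf1 hb => ?_⟩
    · split_ifs with h0
      · exact one_pos
      · exact one_div_pos.2 (lt_of_le_of_ne h (Ne.symm h0))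
    have hX0 : 0 < X := by linarith
    have hl : 0 ≤ Real.log X := Real.log_nonneg hX
    have := abs_le_of_abs_deriv_le hX hf (B := fun v => κ * Real.log X * boxCox γ v)
      (B' := fun v => κ * Real.log X * v ^ (γ - 1))
      (fun v hv => (hasDerivAt_boxCox _ (one_pos.trans_le hv.1)).const_mul _) hf1 (by simp)
      (fun v hv => by
        have hv0 : 0 < v := one_pos.trans_le hv.1
        refine (hb v hv).trans ?_
        rw [mul_right_comm]
        refine mul_le_mul_of_nonneg_right ?_ (by positivity)
        exact mul_le_mul_of_nonneg_left (Real.log_le_log hv0 hv.2) hκ)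
    refine this.trans ?_
    rcases h.eq_or_lt with h | h
    · subst h
      simp only [if_true, Real.rpow_zero, boxCox, wBar, wFun, lt_irrefl, if_false, mul_one, one_mul]
      rw [mul_assoc]
      refine mul_le_mul_of_nonneg_left ?_ hκ
      rw [← sq]; exact le_max_right _ _
    · rw [if_neg h.ne', boxCox, if_neg h.ne']
      have h5 : Real.log X ≤ wBar γ X := by
        rw [wBar, wFun, if_pos h]; exact le_max_right _ _
      have h6 : (X ^ γ - 1) / γ ≤ 1 / γ * X ^ γ := by
        rw [div_le_iff₀ h]; field_simp; linarith
      calc κ * Real.log X * ((X ^ γ - 1) / γ) ≤ κ * Real.log X * (1 / γ * X ^ γ) := by gcongr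
        _ ≤ κ * wBar γ X * (1 / γ * X ^ γ) := by gcongr
        _ = _ := by ring

/-- A relative error in the scale is multiplied by the Box-Cox function during extrapolation; this
puts the product in the common form. -/
theorem exists_boxCox_le_wBar (γ : ℝ) : ∃ K : ℝ, 0 < K ∧ ∀ X, 1 ≤ X →
    boxCox γ X ≤ K * X ^ γ * wBar γ X := by
  obtain ⟨K, hK, h⟩ := exists_log_le_wBar γ
  rcases lt_trichotomy γ 0 with hg | hg | hg
  · refine ⟨1 / (-γ), by have : 0 < -γ := by linarith
                         positivity, fun X hX => ?_⟩
    have hX0 : 0 < X := by linarith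
    have h4 : 1 ≤ X ^ γ * wBar γ X := by
      have := mul_le_mul_of_nonneg_left (rpow_neg_le_wBar γ hX) (Real.rpow_nonneg hX0.le γ)
      rwa [← Real.rpow_add hX0, add_neg_cancel, Real.rpow_zero] at this
    have hg' : 0 < -γ := by linarith
    have h3 : boxCox γ X ≤ 1 / (-γ) := by
      rw [boxCox, if_neg (by linarith), div_le_iff_of_neg (by linarith)]
      have : 1 / (-γ) * γ = -1 := by have h0 := hg.ne; field_simp
      rw [this]; have := Real.rpow_nonneg hX0.le γ; linarith
    rw [mul_assoc]
    exact h3.trans (le_mul_of_one_le_right (by positivity) h4)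
  · subst hg
    refine ⟨K, hK, fun X hX => ?_⟩
    simpa [boxCox] using h X hX
  · refine ⟨1 / γ, by positivity, fun X hX => ?_⟩
    have hX0 : 0 < X := by linarith
    have h6 : boxCox γ X ≤ 1 / γ * X ^ γ := by
      rw [boxCox, if_neg hg.ne', div_le_iff₀ hg]; field_simp; linarith
    exact h6.trans (le_mul_of_one_le_right (by positivity) (one_le_wBar γ X))

/-! ### Quantile functions and the von Mises representation of the tail. -/

theorem quantile_cdf_le_iff (ν : Measure ℝ) {p x : ℝ} (hp0 : 0 < p) (hp1 : p < 1) :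
    quantile (cdf ν) p ≤ x ↔ p ≤ cdf ν x := by
  have hne : {y | p ≤ cdf ν y}.Nonempty :=
    ((tendsto_cdf_atTop ν).eventually (eventually_ge_nhds hp1)).exists
  have hbdd : BddBelow {y | p ≤ cdf ν y} := by
    obtain ⟨z, hz⟩ := ((tendsto_cdf_atBot ν).eventually (eventually_lt_nhds hp0)).exists
    exact ⟨z, fun y hy => le_of_not_gt fun hyz =>
      (lt_of_le_of_lt (hy.trans (monotone_cdf ν hyz.le)) hz).false⟩
  refine ⟨fun h => ?_, fun h => csInf_le hbdd h⟩
  -- Right-continuity of the distribution function: the infimum that defines the quantile is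
  -- attained.
  have hq : p ≤ cdf ν (quantile (cdf ν) p) := by
    have hc : ContinuousWithinAt (cdf ν) (Ioi (quantile (cdf ν) p)) (quantile (cdf ν) p) :=
      ((cdf ν).right_continuous _).mono Ioi_subset_Ici_self
    refine ge_of_tendsto hc ?_
    filter_upwards [self_mem_nhdsWithin] with y hy
    obtain ⟨z, hz, hzy⟩ := exists_lt_of_csInf_lt hne (show sInf {y | p ≤ cdf ν y} < y from hy)
    exact le_trans hz (monotone_cdf ν hzy.le)
  exact hq.trans (monotone_cdf ν h)

theorem monotoneOn_quantile_cdf (ν : Measure ℝ) : MonotoneOn (quantile (cdf ν)) (Ioo 0 1) :=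
  fun _ hp _ hp' h => (quantile_cdf_le_iff ν hp.1 hp.2).2
    (h.trans ((quantile_cdf_le_iff ν hp'.1 hp'.2).1 le_rfl))

/-- The tail quantile function `U(t) = Q(1 - 1/t)`. -/
def tailQuantile (F : ℝ → ℝ) (t : ℝ) : ℝ := quantile F (1 - 1 / t)

/-- The von Mises scale `t U'(t)`. -/
def tailScale (F : ℝ → ℝ) (t : ℝ) : ℝ := deriv (quantile F) (1 - 1 / t) / t

/-- Differentiability of the tail quantile function `F` and of its scale beyond `t₀`. -/
structure RegularTail (F : ℝ → ℝ) (γ t₀ : ℝ) : Prop where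
  one_lt : 1 < t₀
  hasDerivAt_quantile : ∀ t, t₀ ≤ t → HasDerivAt (tailQuantile F) (tailScale F t / t) t
  hasDerivAt_scale : ∀ t, t₀ ≤ t →
    HasDerivAt (tailScale F) (tailScale F t * (γ + rateA F γ t) / t) t
  scale_pos : ∀ t, t₀ ≤ t → 0 < tailScale F t

/-- Regular variation at x = 1: the ratio |A|/|A| tends to 1, while it would be 0/0 = 0 at a zero of
A. -/
theorem SecondOrderCondition.eventually_rateA_ne_zero {F : ℝ → ℝ} {γ ρ : ℝ} {a : ℝ → ℝ}
    (h : SecondOrderCondition F γ ρ a) : ∀ᶠ t in atTop, rateA F γ t ≠ 0 := by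
  have h1 := h.regularly_varying 1 one_pos
  rw [Real.one_rpow] at h1
  filter_upwards [h1.eventually_ne one_ne_zero] with t ht h0
  simp [h0] at ht

theorem SecondOrderCondition.exists_regularTail {F : ℝ → ℝ} {γ ρ : ℝ} {a : ℝ → ℝ}
    (h : SecondOrderCondition F γ ρ a) (hF : MonotoneOn (quantile F) (Ioo 0 1)) :
    ∃ t₀, RegularTail F γ t₀ := by
  have htend : Tendsto (fun t : ℝ => 1 - 1 / t) atTop (𝓝[<] 1) := by
    refine tendsto_nhdsWithin_iff.2 ⟨?_, ?_⟩
    · simpa using (tendsto_const_nhds (x := (1 : ℝ))).sub tendsto_inv_atTop_zero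
    · filter_upwards [eventually_gt_atTop 0] with t ht
      have : 0 < 1 / t := by positivity
      simpa using this
  have hA1 : ∀ᶠ t in atTop, γ ≠ 1 → rateA F γ t ≠ 1 - γ := by
    by_cases hg : γ = 1
    · simp [hg]
    · filter_upwards [h.rate_zero.eventually_ne (sub_ne_zero.2 (Ne.symm hg)).symm] with t ht _
      exact ht
  obtain ⟨t₀, ht₀⟩ := eventually_atTop.1 ((htend.eventually h.diff_Q).and
    (h.eventually_rateA_ne_zero.and hA1))
  have hpos : ∀ t, max t₀ 2 ≤ t → 0 < deriv (quantile F) (1 - 1 / t) := by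
    intro t ht
    obtain ⟨-, h0, h1⟩ := ht₀ t ((le_max_left _ _).trans ht)
    have ht2 : 2 ≤ t := (le_max_right _ _).trans ht
    have hp : 1 - 1 / t ∈ Ioo (0 : ℝ) 1 := by
      have h2 : 0 < 1 / t := by positivity
      have h3 : 1 / t ≤ 1 / 2 := one_div_le_one_div_of_le two_pos ht2
      constructor <;> linarith
    have hnn : 0 ≤ deriv (quantile F) (1 - 1 / t) := by
      rw [← derivWithin_of_isOpen isOpen_Ioo hp]
      exact hF.derivWithin_nonneg
    refine lt_of_le_of_ne hnn fun hz => ?_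
    -- If Q' vanished, division by zero would give A(t) = 1 - γ. For γ ≠ 1 this contradicts A → 0;
    -- for γ = 1 it contradicts that A is eventually nonzero.
    have hr : rateA F γ t = 1 - γ := by rw [rateA, ← hz, div_zero, zero_add]
    by_cases hg : γ = 1
    · exact h0 (by rw [hr, hg, sub_self])
    · exact h1 hg hr
  have hinner : ∀ t, max t₀ 2 ≤ t → HasDerivAt (fun t : ℝ => 1 - 1 / t) (1 / t ^ 2) t := by
    intro t ht
    have ht2 : 2 ≤ t := (le_max_right _ _).trans ht
    have := (hasDerivAt_inv (show t ≠ 0 by linarith)).const_sub 1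
    simpa [one_div] using this
  refine ⟨max t₀ 2, by simp, fun t ht => ?_, fun t ht => ?_, fun t ht => ?_⟩
  · have h1 := (ht₀ t ((le_max_left _ _).trans ht)).1.1
    have h2 := h1.hasDerivAt.comp t (hinner t ht)
    refine h2.congr_deriv ?_
    simp only [tailScale]; ring
  · have ht2 : 2 ≤ t := (le_max_right _ _).trans ht
    have ht0 : t ≠ 0 := by linarith
    have h1 := (ht₀ t ((le_max_left _ _).trans ht)).1.2
    have h2 := (h1.hasDerivAt.comp t (hinner t ht)).div (hasDerivAt_id t) ht0
    have h3 := (hpos t ht).ne'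
    refine h2.congr_deriv ?_
    simp only [tailScale, rateA, Function.comp, id]
    generalize deriv (deriv (quantile F)) (1 - 1 / t) = q₂
    generalize deriv (quantile F) (1 - 1 / t) = q at h3 ⊢
    field_simp
    ring
  · have ht2 : 2 ≤ t := (le_max_right _ _).trans ht
    exact div_pos (hpos t ht) (by linarith)

namespace RegularTail

variable {F : ℝ → ℝ} {γ t₀ : ℝ}

/-- The logarithmic deviation of the scale from a power function. -/
def logDev (F : ℝ → ℝ) (γ t v : ℝ) : ℝ :=
  Real.log (tailScale F (t * v)) - Real.log (tailScale F t) - γ * Real.log v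

@[simp] theorem logDev_one (t : ℝ) : logDev F γ t 1 = 0 := by simp [logDev]

theorem le_mul (h : RegularTail F γ t₀) {t v : ℝ} (ht : t₀ ≤ t) (hv : 1 ≤ v) : t₀ ≤ t * v :=
  ht.trans (le_mul_of_one_le_right (by linarith [h.one_lt]) hv)

/-- The logarithmic derivative of the scale at t is (γ + A(t))/t; subtracting γ log v leaves only
the contribution of A. -/
theorem hasDerivAt_logDev (h : RegularTail F γ t₀) {t v : ℝ} (ht : t₀ ≤ t) (hv : 1 ≤ v) :
    HasDerivAt (logDev F γ t) (rateA F γ (t * v) / v) v := by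
  have htv := h.le_mul ht hv
  have hp := h.scale_pos _ htv
  have ht0 : 0 < t := by linarith [h.one_lt]
  have hv0 : 0 < v := by linarith
  have h1 : HasDerivAt (fun v => t * v) t v := by simpa using (hasDerivAt_id v).const_mul t
  have h2 := (((h.hasDerivAt_scale _ htv).comp v h1).log hp.ne').sub_const
    (Real.log (tailScale F t))
  have h3 := h2.sub ((Real.hasDerivAt_log hv0.ne').const_mul γ)
  have hp' := hp.ne'
  refine h3.congr_deriv ?_
  simp only [Function.comp]
  field_simp
  ring

theorem scale_mul (h : RegularTail F γ t₀) {t v : ℝ} (ht : t₀ ≤ t) (hv : 1 ≤ v) :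
    tailScale F (t * v) = tailScale F t * v ^ γ * Real.exp (logDev F γ t v) := by
  have hp := h.scale_pos _ (h.le_mul ht hv)
  have hp' := h.scale_pos _ ht
  have hv0 : 0 < v := by linarith
  rw [logDev, Real.exp_sub, Real.exp_sub, Real.exp_log hp, Real.exp_log hp', mul_comm γ,
    ← Real.rpow_def_of_pos hv0]
  have := (Real.rpow_pos_of_pos hv0 γ).ne'
  field_simp

/-- The normalized excess `(U(t v) - U(t)) / (t U'(t))`. -/
def excess (F : ℝ → ℝ) (t v : ℝ) : ℝ :=
  (tailQuantile F (t * v) - tailQuantile F t) / tailScale F t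

@[simp] theorem excess_one (t : ℝ) : excess F t 1 = 0 := by simp [excess]

theorem hasDerivAt_excess (h : RegularTail F γ t₀) {t v : ℝ} (ht : t₀ ≤ t) (hv : 1 ≤ v) :
    HasDerivAt (excess F t) (v ^ (γ - 1) * Real.exp (logDev F γ t v)) v := by
  have htv := h.le_mul ht hv
  have ht0 : 0 < t := by linarith [h.one_lt]
  have hv0 : 0 < v := by linarith
  have hp' := (h.scale_pos _ ht).ne'
  have h1 : HasDerivAt (fun v => t * v) t v := by simpa using (hasDerivAt_id v).const_mul t
  have h2 := (((h.hasDerivAt_quantile _ htv).comp v h1).sub_const (tailQuantile F t)).div_const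
    (tailScale F t)
  refine h2.congr_deriv ?_
  rw [h.scale_mul ht hv, Real.rpow_sub_one hv0.ne']
  field_simp

/-- For the range between the two levels, where A is bounded uniformly by its value at the
intermediate level up to a constant. -/
theorem abs_logDev_le_log (h : RegularTail F γ t₀) {t X κ : ℝ} (ht : t₀ ≤ t) (hX : 1 ≤ X)
    (hA : ∀ v ∈ Icc 1 X, |rateA F γ (t * v)| ≤ κ) : |logDev F γ t X| ≤ κ * Real.log X := by
  refine abs_le_of_abs_deriv_le hX (fun v hv => h.hasDerivAt_logDev ht hv.1)
    (B := fun v => κ * Real.log v) (B' := fun v => κ * v⁻¹)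
    (fun v hv => (Real.hasDerivAt_log (one_pos.trans_le hv.1).ne').const_mul _) (by simp)
    (by simp) fun v hv => ?_
  have hv0 : 0 < v := one_pos.trans_le hv.1
  rw [abs_div, abs_of_pos hv0, div_eq_mul_inv]
  exact mul_le_mul_of_nonneg_right (hA v hv) (by positivity)

/-- For the unbounded range beyond the extreme level. The small power 1/8 leaves room for
integrability against the Pareto density. -/
theorem abs_logDev_le_rpow (h : RegularTail F γ t₀) {t X κ : ℝ} (ht : t₀ ≤ t) (hX : 1 ≤ X)
    (hκ : 0 ≤ κ) (hA : ∀ v ∈ Icc 1 X, |rateA F γ (t * v)| ≤ κ * v ^ (1 / 8 : ℝ)) :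
    |logDev F γ t X| ≤ 8 * κ * X ^ (1 / 8 : ℝ) := by
  refine abs_le_of_abs_deriv_le hX (fun v hv => h.hasDerivAt_logDev ht hv.1)
    (B := fun v => 8 * κ * v ^ (1 / 8 : ℝ)) (B' := fun v => 8 * κ * (1 / 8 * v ^ (1 / 8 - 1 : ℝ)))
    (fun v hv => (Real.hasDerivAt_rpow_const (Or.inl (one_pos.trans_le hv.1).ne')).const_mul _)
    (by simp) (by simpa using hκ) fun v hv => ?_
  have hv0 : 0 < v := one_pos.trans_le hv.1
  rw [abs_div, abs_of_pos hv0, Real.rpow_sub_one hv0.ne', div_le_iff₀ hv0]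
  refine (hA v hv).trans (le_of_eq ?_)
  field_simp

/-- Deviation of the normalized excess from its generalized Pareto limit. -/
theorem abs_excess_sub_boxCox_le (h : RegularTail F γ t₀) {K : ℝ}
    (hK : ∀ (X κ : ℝ) (f f' : ℝ → ℝ), 1 ≤ X → 0 ≤ κ →
      (∀ v ∈ Icc 1 X, HasDerivAt f (f' v) v) → f 1 = 0 →
      (∀ v ∈ Icc 1 X, |f' v| ≤ κ * v ^ (γ - 1) * Real.log v) →
      |f X| ≤ K * κ * X ^ γ * wBar γ X) {t X κ : ℝ} (ht : t₀ ≤ t) (hX : 1 ≤ X)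
    (hκ : 0 ≤ κ) (hA : ∀ v ∈ Icc 1 X, |rateA F γ (t * v)| ≤ κ) (hsmall : κ * Real.log X ≤ 1) :
    |excess F t X - boxCox γ X| ≤ K * (2 * κ) * X ^ γ * wBar γ X := by
  refine hK X (2 * κ) (fun v => excess F t v - boxCox γ v)
    (fun v => v ^ (γ - 1) * Real.exp (logDev F γ t v) - v ^ (γ - 1)) hX (by positivity)
    (fun v hv => (h.hasDerivAt_excess ht hv.1).sub (hasDerivAt_boxCox γ (one_pos.trans_le hv.1)))
    (by simp) fun v hv => ?_
  have hv0 : 0 < v := one_pos.trans_le hv.1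
  have h1 := h.abs_logDev_le_log ht hv.1 (fun u hu => hA u ⟨hu.1, hu.2.trans hv.2⟩)
  have h2 : |logDev F γ t v| ≤ 1 :=
    h1.trans ((mul_le_mul_of_nonneg_left (Real.log_le_log hv0 hv.2) hκ).trans hsmall)
  have h3 := Real.abs_exp_sub_one_le h2
  have e1 : v ^ (γ - 1) * Real.exp (logDev F γ t v) - v ^ (γ - 1) =
    v ^ (γ - 1) * (Real.exp (logDev F γ t v) - 1) := by ring
  have hp : 0 < v ^ (γ - 1) := Real.rpow_pos_of_pos hv0 _
  rw [e1, abs_mul, abs_of_pos hp]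
  calc v ^ (γ - 1) * |Real.exp (logDev F γ t v) - 1| ≤ v ^ (γ - 1) * (2 * (κ * Real.log v)) := by
        gcongr; linarith
    _ = _ := by ring

/-- The quantile function is not negligible with respect to the scale. -/
theorem exists_scale_le_mul_abs_quantile (h : RegularTail F γ t₀)
    (hA : Tendsto (rateA F γ) atTop (𝓝 0)) :
    ∃ G : ℝ, 0 < G ∧ ∀ᶠ t in atTop, tailScale F t ≤ G * |tailQuantile F t| := by
  obtain ⟨t₁, ht₁⟩ := eventually_atTop.1 ((hA.eventually (Metric.ball_mem_nhds 0 one_pos)).and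
    (eventually_ge_atTop t₀))
  -- Eventually |γ + A| ≤ G, so |b'| ≤ G U' for the scale b. Thus b - G U is nonincreasing and b + G
  -- U is nondecreasing.
  set G := |γ| + 1
  have hG : 0 < G := by positivity
  have hb : ∀ t, t₁ ≤ t → |γ + rateA F γ t| ≤ G := by
    intro t ht
    have := (ht₁ t ht).1
    rw [Real.dist_eq, sub_zero] at this
    exact (abs_add_le _ _).trans (by simp only [G]; linarith)
  have hpos : ∀ t, t₁ ≤ t → 0 < tailScale F t / t ∧ 0 < t := by
    intro t ht
    have h0 : 0 < t := by linarith [h.one_lt, (ht₁ t ht).2]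
    exact ⟨div_pos (h.scale_pos t (ht₁ t ht).2) h0, h0⟩
  have hder : ∀ t, t₁ ≤ t → -(G * (tailScale F t / t)) ≤ tailScale F t * (γ + rateA F γ t) / t ∧
      tailScale F t * (γ + rateA F γ t) / t ≤ G * (tailScale F t / t) := by
    intro t ht
    have h1 := abs_le.1 (hb t ht)
    have h2 := (hpos t ht).1
    rw [mul_div_right_comm]
    constructor <;> nlinarith
  have hup : ∀ x y, t₁ ≤ x → x ≤ y →
      tailScale F y - tailScale F x ≤ G * tailQuantile F y - G * tailQuantile F x := by
    intro x y hx hxy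
    exact sub_le_sub_of_deriv_le hxy
      (fun v hv => h.hasDerivAt_scale v (ht₁ v (hx.trans hv.1)).2)
      (fun v hv => (h.hasDerivAt_quantile v (ht₁ v (hx.trans hv.1)).2).const_mul G)
      (fun v hv => (hder v (hx.trans hv.1)).2)
  have hlo : ∀ x y, t₁ ≤ x → x ≤ y →
      -G * tailQuantile F y - -G * tailQuantile F x ≤ tailScale F y - tailScale F x := by
    intro x y hx hxy
    exact sub_le_sub_of_deriv_le hxy
      (fun v hv => (h.hasDerivAt_quantile v (ht₁ v (hx.trans hv.1)).2).const_mul (-G))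
      (fun v hv => h.hasDerivAt_scale v (ht₁ v (hx.trans hv.1)).2)
      (fun v hv => by rw [neg_mul]; exact (hder v (hx.trans hv.1)).1)
  have hmono : ∀ x y, t₁ ≤ x → x ≤ y → tailQuantile F x ≤ tailQuantile F y := by
    intro x y hx hxy
    have := sub_le_sub_of_deriv_le hxy (f := fun _ => (0 : ℝ)) (f' := fun _ => 0)
      (fun v hv => hasDerivAt_const v 0)
      (fun v hv => h.hasDerivAt_quantile v (ht₁ v (hx.trans hv.1)).2)
      (fun v hv => (hpos v (hx.trans hv.1)).1.le)
    linarith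
  by_cases hU : ∃ t, t₁ ≤ t ∧ 0 < tailQuantile F t
  · obtain ⟨t₂, ht₂, hU⟩ := hU
    have hs2 := h.scale_pos t₂ (ht₁ t₂ ht₂).2
    refine ⟨G + tailScale F t₂ / tailQuantile F t₂, by positivity, ?_⟩
    filter_upwards [eventually_ge_atTop t₂] with t ht
    have h1 := hup t₂ t ht₂ ht
    have h2 := hmono t₂ t ht₂ ht
    rw [abs_of_pos (hU.trans_le h2), add_mul]
    have h3 : tailScale F t₂ ≤ tailScale F t₂ / tailQuantile F t₂ * tailQuantile F t := by
      rw [div_mul_eq_mul_div, le_div_iff₀ hU]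
      exact mul_le_mul_of_nonneg_left h2 hs2.le
    have h4 := mul_pos hG hU
    linarith
  · push Not at hU
    refine ⟨G, hG, ?_⟩
    filter_upwards [eventually_ge_atTop t₁] with t ht
    rw [abs_of_nonpos (hU t ht)]
    by_contra! hcon
    -- If b(t) > G |U(t)| while U stays nonpositive, then b + G U ≥ κ > 0 from t on, so b ≥ κ. Then
    -- U grows at least like κ log and becomes positive.
    set κ := tailScale F t + G * tailQuantile F t
    have hκ : 0 < κ := by simp only [κ]; linarith
    have ht0 := (hpos t ht).2
    have hge : ∀ y, t ≤ y → κ * Real.log y - κ * Real.log t ≤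
        tailQuantile F y - tailQuantile F t := by
      intro y hy
      refine sub_le_sub_of_deriv_le hy (f := fun v => κ * Real.log v) (f' := fun v => κ * v⁻¹)
        (fun v hv => (Real.hasDerivAt_log (ht0.trans_le hv.1).ne').const_mul κ)
        (fun v hv => h.hasDerivAt_quantile v (ht₁ v (ht.trans hv.1)).2) fun v hv => ?_
      have hv0 : 0 < v := ht0.trans_le hv.1
      rw [← div_eq_mul_inv]
      refine div_le_div_of_nonneg_right ?_ hv0.le
      have h1 := hlo t v ht hv.1
      have h2 := mul_nonpos_of_nonneg_of_nonpos hG.le (hU v (ht.trans hv.1))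
      simp only [κ]; linarith
    have hlog : Tendsto (fun y => κ * Real.log y) atTop atTop :=
      Real.tendsto_log_atTop.const_mul_atTop hκ
    obtain ⟨y, hy1, hy2⟩ := ((hlog.eventually_gt_atTop
      (κ * Real.log t - tailQuantile F t)).and (eventually_ge_atTop t)).exists
    have h1 := hge y hy2
    have h2 := hU y (ht.trans hy2)
    linarith

end RegularTail

/-! ### Images of the Pareto law and their total variation distance. -/

/-- `f` is the density of `Ψ(R)`, where `R` follows the unit Pareto law. -/
structure IsParetoImage (Ψ Ψ' f : ℝ → ℝ) : Prop where
  hasDerivAt : ∀ r, 1 < r → HasDerivAt Ψ (Ψ' r) r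
  deriv_pos : ∀ r, 1 < r → 0 < Ψ' r
  nonneg : ∀ y, 0 ≤ f y
  eq_rpow : ∀ r, 1 < r → Ψ' r * f (Ψ r) = r ^ (-2 : ℝ)
  eq_zero : ∀ y, y ∉ Ψ '' Ioi 1 → f y = 0

namespace IsParetoImage

variable {Ψ Ψ' f Φ Φ' g : ℝ → ℝ}

theorem strictMonoOn (h : IsParetoImage Ψ Ψ' f) : StrictMonoOn Ψ (Ioi 1) := by
  apply strictMonoOn_of_deriv_pos (convex_Ioi 1)
  · exact fun x hx => (h.hasDerivAt x hx).continuousAt.continuousWithinAt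
  · intro x hx
    rw [interior_Ioi] at hx
    rw [(h.hasDerivAt x hx).deriv]
    exact h.deriv_pos x hx

theorem integral_eq (h : IsParetoImage Ψ Ψ' f) {u : ℝ → ℝ} (hu : ∀ y, y ∉ Ψ '' Ioi 1 → u y = 0) :
    ∫ y, u y = ∫ r in Ioi 1, Ψ' r * u (Ψ r) := by
  rw [← setIntegral_eq_integral_of_forall_compl_eq_zero (s := Ψ '' Ioi 1) (fun y hy => hu y hy),
    integral_image_eq_integral_abs_deriv_smul measurableSet_Ioi
      (fun r hr => (h.hasDerivAt r hr).hasDerivWithinAt) h.strictMonoOn.injOn]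
  refine setIntegral_congr_fun measurableSet_Ioi fun r hr => ?_
  simp only [smul_eq_mul, abs_of_pos (h.deriv_pos r hr)]

theorem integrable (h : IsParetoImage Ψ Ψ' f) : Integrable f := by
  rw [← integrableOn_iff_integrable_of_support_subset (s := Ψ '' Ioi 1)
    (fun y hy => by_contra fun hc => hy (h.eq_zero y hc)),
    integrableOn_image_iff_integrableOn_abs_deriv_smul measurableSet_Ioi
      (fun r hr => (h.hasDerivAt r hr).hasDerivWithinAt) h.strictMonoOn.injOn]
  refine (integrableOn_Ioi_rpow_of_lt (a := -2) (by norm_num) one_pos).congr_fun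
    (fun r hr => ?_) measurableSet_Ioi
  simp only [smul_eq_mul, abs_of_pos (h.deriv_pos r hr), h.eq_rpow r hr]

theorem integral_indicator_eq (h : IsParetoImage Ψ Ψ' f) (B : Set ℝ) :
    ∫ y, B.indicator f y = ∫ r in Ioi 1, (Ψ ⁻¹' B).indicator (fun r => r ^ (-2 : ℝ)) r := by
  rw [h.integral_eq (u := B.indicator f) fun y hy => by
    by_cases hB : y ∈ B
    · rw [indicator_of_mem hB, h.eq_zero y hy]
    · rw [indicator_of_notMem hB]]
  refine setIntegral_congr_fun measurableSet_Ioi fun r hr => ?_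
  by_cases hB : Ψ r ∈ B
  · simp only [indicator_of_mem hB, indicator_of_mem (show r ∈ Ψ ⁻¹' B from hB), h.eq_rpow r hr]
  · simp only [indicator_of_notMem hB, indicator_of_notMem (show r ∉ Ψ ⁻¹' B from hB), mul_zero]

theorem integral_eq_one (h : IsParetoImage Ψ Ψ' f) : ∫ y, f y = 1 := by
  have := h.integral_indicator_eq univ
  simp only [indicator_univ, preimage_univ] at this
  rw [this, integral_Ioi_rpow_of_lt (by norm_num) one_pos]
  norm_num

/-- One-sided control of the density ratio bounds the `L¹` distance. -/
theorem integral_abs_sub_le (hf : IsParetoImage Ψ Ψ' f) (hg : IsParetoImage Φ Φ' g)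
    {B : ℝ → ℝ} (hB : IntegrableOn B (Ioi 1)) (hB0 : ∀ r, 1 < r → 0 ≤ B r)
    (h : ∀ r, 1 < r → r ^ (-2 : ℝ) - Ψ' r * g (Ψ r) ≤ B r) :
    ∫ y, |f y - g y| ≤ 2 * ∫ r in Ioi 1, B r := by
  have hi : Integrable fun y => f y - g y := hf.integrable.sub hg.integrable
  -- Both densities have integral one, so the negative part weighs as much as the positive part. The
  -- latter lives on the image of Ψ, and nothing is needed about g elsewhere.
  have h1 : ∫ y, |f y - g y| = 2 * ∫ y, max (f y - g y) 0 := by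
    have e : ∀ y, |f y - g y| = 2 * max (f y - g y) 0 - (f y - g y) := by
      intro y
      rcases le_total 0 (f y - g y) with h | h
      · rw [abs_of_nonneg h, max_eq_left h]; ring
      · rw [abs_of_nonpos h, max_eq_right h]; ring
    simp only [e]
    have h0 : ∫ y, (f y - g y) = 0 := by
      rw [integral_sub hf.integrable hg.integrable, hf.integral_eq_one, hg.integral_eq_one, sub_self]
    rw [integral_sub (hi.pos_part.const_mul 2) hi, h0, integral_const_mul, sub_zero]
  rw [h1, hf.integral_eq (u := fun y => max (f y - g y) 0)
    fun y hy => by simp [hf.eq_zero y hy, hg.nonneg y]]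
  refine mul_le_mul_of_nonneg_left ?_ two_pos.le
  refine integral_mono_of_nonneg ?_ hB ?_
  · filter_upwards [self_mem_ae_restrict measurableSet_Ioi] with r hr
    exact mul_nonneg (hf.deriv_pos r hr).le (le_max_right _ _)
  · filter_upwards [self_mem_ae_restrict measurableSet_Ioi] with r hr
    rw [mul_max_of_nonneg _ _ (hf.deriv_pos r hr).le, mul_zero, mul_sub, hf.eq_rpow r hr]
    exact max_le (h r hr) (hB0 r hr)

end IsParetoImage

/-! ### Stability of Pareto images under perturbation of the map. -/

theorem boxCox_le_rpow {γ r : ℝ} (hγ : -1 / 2 ≤ γ) (hr : 1 ≤ r) :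
    boxCox γ r ≤ 8 * r ^ (5 / 8 : ℝ) * r ^ γ := by
  have hr0 : 0 < r := by linarith
  have h1 := boxCox_le_max_mul_log γ hr
  have h2 := log_le_eight_mul_rpow hr0.le
  -- The bound γ ≥ -1/2 enters here. The exponent 5/8 is this 1/2 plus the 1/8 spent on the
  -- logarithm.
  have h3 : max 1 (r ^ γ) ≤ r ^ (1 / 2 : ℝ) * r ^ γ := by
    refine max_le ?_ (le_mul_of_one_le_left (by positivity) (Real.one_le_rpow hr (by norm_num)))
    rw [← Real.rpow_add hr0]
    exact Real.one_le_rpow hr (by linarith)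
  calc boxCox γ r ≤ max 1 (r ^ γ) * Real.log r := h1
    _ ≤ (r ^ (1 / 2 : ℝ) * r ^ γ) * (8 * r ^ (1 / 8 : ℝ)) :=
        mul_le_mul h3 h2 (Real.log_nonneg hr) (by positivity)
    _ = 8 * (r ^ (1 / 2 : ℝ) * r ^ (1 / 8 : ℝ)) * r ^ γ := by ring
    _ = _ := by rw [← Real.rpow_add hr0]; norm_num

section

variable {γ γ' η r : ℝ} {ψ D : ℝ → ℝ}

/-- The ratio of the derivatives is exp((γ - γ') log v + D v). The exponent is at most (8 + 1) η
r^(1/8), and |e^x - 1| ≤ 2|x| for |x| ≤ 1 doubles the 9 to 18. -/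
theorem abs_sub_boxCox_le (hr : 1 ≤ r) (hη : 0 ≤ η) (hψ1 : ψ 1 = 0)
    (hψ : ∀ v, 1 ≤ v → HasDerivAt ψ (v ^ (γ - 1) * Real.exp (D v)) v)
    (hD : ∀ v, 1 ≤ v → |D v| ≤ η * v ^ (1 / 8 : ℝ)) (hγ' : |γ' - γ| ≤ η)
    (hs : 9 * (η * r ^ (1 / 8 : ℝ)) ≤ 1) :
    |ψ r - boxCox γ' r| ≤ 18 * (η * r ^ (1 / 8 : ℝ)) * boxCox γ' r := by
  refine abs_le_of_abs_deriv_le hr (f := fun v => ψ v - boxCox γ' v)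
    (B := fun v => 18 * (η * r ^ (1 / 8 : ℝ)) * boxCox γ' v)
    (fun v hv => (hψ v hv.1).sub (hasDerivAt_boxCox γ' (one_pos.trans_le hv.1)))
    (fun v hv => (hasDerivAt_boxCox γ' (one_pos.trans_le hv.1)).const_mul _)
    (by simp [hψ1]) (by simp) fun v hv => ?_
  have hv0 : 0 < v := one_pos.trans_le hv.1
  have hle : η * v ^ (1 / 8 : ℝ) ≤ η * r ^ (1 / 8 : ℝ) := by
    have := hv.2
    gcongr
  have hl := log_le_eight_mul_rpow hv0.le
  have hl0 := Real.log_nonneg hv.1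
  have h1 : |(γ - γ') * Real.log v + D v| ≤ 9 * (η * r ^ (1 / 8 : ℝ)) := by
    refine (abs_add_le _ _).trans ?_
    rw [abs_mul, abs_sub_comm, abs_of_nonneg hl0]
    have h2 : |γ' - γ| * Real.log v ≤ η * (8 * v ^ (1 / 8 : ℝ)) := mul_le_mul hγ' hl hl0 hη
    linarith [hD v hv.1]
  have h3 := Real.abs_exp_sub_one_le (h1.trans hs)
  have e : v ^ (γ - 1) * Real.exp (D v) - v ^ (γ' - 1) =
      (Real.exp ((γ - γ') * Real.log v + D v) - 1) * v ^ (γ' - 1) := by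
    rw [Real.exp_add, mul_comm (γ - γ'), ← Real.rpow_def_of_pos hv0, sub_mul, one_mul, mul_right_comm,
      ← Real.rpow_add hv0]
    ring_nf
  have hp : 0 < v ^ (γ' - 1) := Real.rpow_pos_of_pos hv0 _
  rw [e, abs_mul, abs_of_pos hp]
  refine mul_le_mul_of_nonneg_right ?_ hp.le
  linarith

/-- Away from r = 1 the map ψ exceeds any offset x₀ of size at most η, so the matched parameter
stays above 1. The constant 10 works because ψ r is at least e^(-1) · 5η, hence 5η/3. -/
theorem lt_of_boxCox_deriv (hγ : -1 ≤ γ) (hη : 0 < η) (hη1 : 10 * η ≤ 1) (hr : 1 + 10 * η ≤ r)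
    (hψ1 : ψ 1 = 0)
    (hψ : ∀ v, 1 ≤ v → HasDerivAt ψ (v ^ (γ - 1) * Real.exp (D v)) v)
    (hD : ∀ v, 1 ≤ v → |D v| ≤ η * v ^ (1 / 8 : ℝ)) (hs : η * r ^ (1 / 8 : ℝ) ≤ 1) :
    η < ψ r := by
  have hr1 : 1 ≤ r := by linarith
  have h1 := sub_le_sub_of_deriv_le hr1 (f := fun v => Real.exp (-1) * boxCox γ v)
    (f' := fun v => Real.exp (-1) * v ^ (γ - 1))
    (fun v hv => (hasDerivAt_boxCox γ (one_pos.trans_le hv.1)).const_mul _)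
    (fun v hv => hψ v hv.1) fun v hv => by
      rw [mul_comm]
      have hv0 : 0 < v := one_pos.trans_le hv.1
      refine mul_le_mul_of_nonneg_left (Real.exp_le_exp.2 ?_) (by positivity)
      have hle : η * v ^ (1 / 8 : ℝ) ≤ η * r ^ (1 / 8 : ℝ) := by
        have := hv.2
        gcongr
      linarith [(abs_le.1 (hD v hv.1)).1]
  simp only [boxCox_one, mul_zero, hψ1, sub_zero] at h1
  have h2 := half_le_boxCox_one_add hγ (by positivity) hη1
  have h3 : boxCox γ (1 + 10 * η) ≤ boxCox γ r :=
    (strictMonoOn_boxCox γ).monotoneOn (mem_Ioi.2 (by positivity)) (mem_Ioi.2 (by linarith)) hr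
  have h4 : 1 / 3 ≤ Real.exp (-1) := by
    rw [Real.exp_neg, ← one_div]
    exact one_div_le_one_div_of_le (Real.exp_pos 1) (by linarith [Real.exp_one_lt_d9])
  have h5 : 1 / 3 * (5 * η) ≤ Real.exp (-1) * boxCox γ r :=
    mul_le_mul h4 (by linarith) (by positivity) (Real.exp_pos _).le
  linarith

/-- Matching of the two Pareto parametrizations. -/
theorem exists_param_eq {x₀ c : ℝ} (hη : 0 < η) (hη1 : 10 * η ≤ 1)
    (hηγ : η ≤ γ + 1 / 2) (hψ1 : ψ 1 = 0)
    (hψ : ∀ v, 1 ≤ v → HasDerivAt ψ (v ^ (γ - 1) * Real.exp (D v)) v)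
    (hD : ∀ v, 1 ≤ v → |D v| ≤ η * v ^ (1 / 8 : ℝ)) (hγ' : |γ' - γ| ≤ η) (hx₀ : |x₀| ≤ η)
    (hc : |c - 1| ≤ η) (hr : 1 + 10 * η ≤ r) (hs : 612 * (η * r ^ (3 / 4 : ℝ)) ≤ 1) :
    ∃ r', 1 < r' ∧ Real.log r' ≤ Real.log r + 612 * (η * r ^ (3 / 4 : ℝ)) ∧
      x₀ + c * boxCox γ' r' = ψ r := by
  -- Moving r to r e^z must compensate 144 (= 18 · 8, map error), 8 (scale c) and 1 (offset), in
  -- units of η r^(3/4) r^γ'. Since c ≥ 1/2 and the Box-Cox function at e^z is at least z/2, the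
  -- gain is z/4, and 612 = 4 · 153.
  set z := 612 * (η * r ^ (3 / 4 : ℝ))
  have hr1 : 1 ≤ r := by linarith
  have hr0 : 0 < r := by linarith
  have hz0 : 0 ≤ z := by positivity
  have hpow : r ^ (1 / 8 : ℝ) ≤ r ^ (3 / 4 : ℝ) :=
    Real.rpow_le_rpow_of_exponent_le hr1 (by norm_num)
  have hpow' : η * r ^ (1 / 8 : ℝ) ≤ η * r ^ (3 / 4 : ℝ) := mul_le_mul_of_nonneg_left hpow hη.le
  have hP0 : 0 ≤ η * r ^ (1 / 8 : ℝ) := by positivity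
  have hg' : -1 / 2 ≤ γ' := by linarith [(abs_le.1 hγ').1]
  have hc1 : 1 / 2 ≤ c := by linarith [(abs_le.1 hc).1]
  have h1 := abs_sub_boxCox_le hr1 hη.le hψ1 hψ hD hγ' (by linarith)
  have h2 := lt_of_boxCox_deriv (by linarith) hη hη1 hr hψ1 hψ hD (by linarith)
  have h3 := boxCox_le_rpow hg' hr1
  have h4 := half_le_boxCox_exp (γ := γ') (by linarith) hz0 hs
  have h5 := boxCox_mul γ' hr0 (Real.exp_pos z)
  have hb0 := boxCox_nonneg γ' hr1
  have hrg : 0 < r ^ γ' := Real.rpow_pos_of_pos hr0 _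
  have hone : 1 ≤ r ^ (3 / 4 : ℝ) * r ^ γ' := by
    rw [← Real.rpow_add hr0]
    exact Real.one_le_rpow hr1 (by linarith)
  have hup : ψ r ≤ x₀ + c * boxCox γ' (r * Real.exp z) := by
    have a1 : ψ r - boxCox γ' r ≤ 18 * (η * r ^ (1 / 8 : ℝ)) * (8 * r ^ (5 / 8 : ℝ) * r ^ γ') :=
      ((le_abs_self _).trans h1).trans (mul_le_mul_of_nonneg_left h3 (by positivity))
    have a2 : 18 * (η * r ^ (1 / 8 : ℝ)) * (8 * r ^ (5 / 8 : ℝ) * r ^ γ') =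
        144 * (η * r ^ (3 / 4 : ℝ)) * r ^ γ' := by
      have : r ^ (3 / 4 : ℝ) = r ^ (1 / 8 : ℝ) * r ^ (5 / 8 : ℝ) := by
        rw [← Real.rpow_add hr0]; norm_num
      rw [this]; ring
    have a3 : (1 - c) * boxCox γ' r ≤ 8 * (η * r ^ (3 / 4 : ℝ)) * r ^ γ' := by
      have b1 : (1 - c) * boxCox γ' r ≤ η * (8 * r ^ (5 / 8 : ℝ) * r ^ γ') :=
        mul_le_mul (by linarith [(abs_le.1 hc).1]) h3 hb0 hη.le
      have b2 : r ^ (5 / 8 : ℝ) ≤ r ^ (3 / 4 : ℝ) :=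
        Real.rpow_le_rpow_of_exponent_le hr1 (by norm_num)
      calc _ ≤ η * (8 * r ^ (5 / 8 : ℝ) * r ^ γ') := b1
        _ ≤ η * (8 * r ^ (3 / 4 : ℝ) * r ^ γ') := by gcongr
        _ = _ := by ring
    have a4 : -x₀ ≤ η * r ^ (3 / 4 : ℝ) * r ^ γ' := by
      have := mul_le_mul_of_nonneg_left hone hη.le
      linarith [(abs_le.1 hx₀).1]
    have a5 : 153 * (η * r ^ (3 / 4 : ℝ)) * r ^ γ' ≤
        c * (r ^ γ' * boxCox γ' (Real.exp z)) := by
      have b1 : 1 / 2 * (r ^ γ' * (z / 2)) ≤ c * (r ^ γ' * boxCox γ' (Real.exp z)) :=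
        mul_le_mul hc1 (mul_le_mul_of_nonneg_left h4 hrg.le) (by positivity) (by linarith)
      refine le_trans (le_of_eq ?_) b1
      simp only [z]; ring
    rw [h5]
    linarith
  have hcont : ContinuousOn (fun v => x₀ + c * boxCox γ' v) (Icc 1 (r * Real.exp z)) := by
    intro v hv
    exact (((hasDerivAt_boxCox γ' (one_pos.trans_le hv.1)).continuousAt.const_mul c).const_add
      x₀).continuousWithinAt
  have hle : 1 ≤ r * Real.exp z := one_le_mul_of_one_le_of_one_le hr1 (Real.one_le_exp hz0)
  obtain ⟨r', hr', he⟩ := intermediate_value_Ioc hle hcont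
    (show ψ r ∈ Ioc _ _ from ⟨by simp only [boxCox_one, mul_zero, add_zero]
                                 linarith [(abs_le.1 hx₀).2], hup⟩)
  refine ⟨r', hr'.1, ?_, he⟩
  have := Real.log_le_log (one_pos.trans hr'.1) hr'.2
  rwa [Real.log_mul hr0.ne' (Real.exp_pos z).ne', Real.log_exp] at this

end

/-- Total variation bound between a perturbed Pareto image and a generalized Pareto law. -/
theorem exists_integral_abs_sub_le {γ : ℝ} (hγ : -1 / 2 < γ) :
    ∃ K : ℝ, 0 < K ∧ ∃ η₀ : ℝ, 0 < η₀ ∧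
      ∀ (η y₀ κ x₀ c γ' : ℝ) (ψ D f g : ℝ → ℝ), 0 < η → η ≤ η₀ → 0 < κ → ψ 1 = 0 →
      (∀ v, 1 ≤ v → HasDerivAt ψ (v ^ (γ - 1) * Real.exp (D v)) v) →
      (∀ v, 1 ≤ v → |D v| ≤ η * v ^ (1 / 8 : ℝ)) → |γ' - γ| ≤ η → |x₀| ≤ η → |c - 1| ≤ η →
      IsParetoImage (fun r => y₀ + κ * ψ r) (fun r => κ * (r ^ (γ - 1) * Real.exp (D r))) f →
      IsParetoImage (fun r => y₀ + κ * (x₀ + c * boxCox γ' r))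
        (fun r => κ * (c * r ^ (γ' - 1))) g →
      ∫ y, |f y - g y| ≤ K * η := by
  -- The 10 collects 8 from the shape error times log r, 1 from D and 1 from log c. The other term
  -- is the shift of log r weighted by γ' + 1 ≤ γ + 2.
  set K₁ : ℝ := 10 + (γ + 2) * 612 with hK₁
  have hK₁0 : 612 ≤ K₁ := by simp only [hK₁]; linarith
  -- The density deficit is majorized by 1 on (1, 1 + 10η] plus K₁ η r^(-5/4), with integrals 10η
  -- and 4 K₁ η. The second term of the minimum keeps γ' ≥ -1/2.
  refine ⟨2 * (10 + 4 * K₁), by positivity, min (1 / 10) (γ + 1 / 2), by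
    have : 0 < γ + 1 / 2 := by linarith
    positivity, ?_⟩
  intro η y₀ κ x₀ c γ' ψ D f g hη hη₀ hκ hψ1 hψ hD hγ' hx₀ hc hf hg
  have hη1 : 10 * η ≤ 1 := by linarith [hη₀.trans (min_le_left _ _)]
  have hηγ : η ≤ γ + 1 / 2 := hη₀.trans (min_le_right _ _)
  have hc1 : 1 / 2 ≤ c := by linarith [(abs_le.1 hc).1]
  have hI1 : IntegrableOn ((Ioc (1 : ℝ) (1 + 10 * η)).indicator (fun _ => (1 : ℝ))) (Ioi 1) :=
    ((integrable_indicator_iff measurableSet_Ioc).2 (integrableOn_const measure_Ioc_lt_top.ne)).integrableOn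
  have hI2 : IntegrableOn (fun r : ℝ => K₁ * η * r ^ (-(5 / 4) : ℝ)) (Ioi 1) :=
    (integrableOn_Ioi_rpow_of_lt (by norm_num) one_pos).const_mul _
  have hmain := hf.integral_abs_sub_le hg (hI1.add hI2) (fun r hr => ?_) (fun r hr => ?_)
  · refine hmain.trans (le_of_eq ?_)
    rw [integral_add' hI1 hI2, integral_const_mul, integral_Ioi_rpow_of_lt (by norm_num) one_pos,
      setIntegral_indicator measurableSet_Ioc,
      inter_eq_self_of_subset_right (Ioc_subset_Ioi_self)]
    have : 0 ≤ 10 * η := by positivity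
    simp [this]
    ring
  · have hr0 : 0 < r := by linarith
    exact add_nonneg (indicator_nonneg (fun _ _ => zero_le_one) _) (by positivity)
  · have hr0 : 0 < r := by linarith
    have hr2 : r ^ (-2 : ℝ) ≤ 1 := Real.rpow_le_one_of_one_le_of_nonpos hr.le (by norm_num)
    have hr20 : 0 < r ^ (-2 : ℝ) := Real.rpow_pos_of_pos hr0 _
    have hq0 := hg.nonneg (y₀ + κ * ψ r)
    have hd0 := hf.deriv_pos r hr
    have hmul : 0 ≤ κ * (r ^ (γ - 1) * Real.exp (D r)) * g (y₀ + κ * ψ r) :=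
      mul_nonneg hd0.le hq0
    have hpow : r ^ (-(5 / 4) : ℝ) = r ^ (-2 : ℝ) * r ^ (3 / 4 : ℝ) := by
      rw [← Real.rpow_add hr0]; norm_num
    have hB2 : 0 ≤ K₁ * η * r ^ (-(5 / 4) : ℝ) := by positivity
    simp only [Pi.add_apply]
    rcases le_or_gt r (1 + 10 * η) with h | h
    · rw [indicator_of_mem (show r ∈ Ioc (1 : ℝ) (1 + 10 * η) from ⟨hr, h⟩)]
      linarith
    rw [indicator_of_notMem (fun hm => h.not_ge hm.2), zero_add, hpow]
    -- Far in the tail matching may fail, for instance beyond the end-point of g, but there r^(-2)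
    -- itself is below the majorant.
    rcases lt_or_ge 1 (612 * (η * r ^ (3 / 4 : ℝ))) with hs | hs
    · have hx : 612 * (η * r ^ (3 / 4 : ℝ)) ≤ K₁ * (η * r ^ (3 / 4 : ℝ)) := by gcongr
      have := mul_le_mul_of_nonneg_left (hs.le.trans hx) hr20.le
      linarith
    obtain ⟨r', hr'1, hlog, he⟩ := exists_param_eq hη hη1 hηγ hψ1 hψ hD hγ' hx₀ hc h.le hs
    have hr'0 : 0 < r' := by linarith
    have hgr := hg.eq_rpow r' hr'1
    simp only [he] at hgr
    -- The logarithm of the density ratio g/f at the common point. As 1 - e^θ ≤ -θ, only an upper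
    -- bound for log r' is needed.
    set θ := (γ + 1) * Real.log r + D r - (γ' + 1) * Real.log r' - Real.log c with hθ
    have hc0 : 0 < c := by linarith
    have key : κ * (r ^ (γ - 1) * Real.exp (D r)) * g (y₀ + κ * ψ r) =
        r ^ (-2 : ℝ) * Real.exp θ := by
      have e1 : g (y₀ + κ * ψ r) = r' ^ (-2 : ℝ) / (κ * (c * r' ^ (γ' - 1))) := by
        rw [eq_div_iff (by positivity), mul_comm]; exact hgr
      have e2 : Real.exp θ = r ^ (γ + 1) * Real.exp (D r) / r' ^ (γ' + 1) / c := by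
        rw [hθ, Real.exp_sub, Real.exp_sub, Real.exp_add, Real.exp_log hc0,
          Real.rpow_def_of_pos hr0, Real.rpow_def_of_pos hr'0, mul_comm (γ + 1), mul_comm (γ' + 1)]
      have e3 : r ^ (γ - 1) = r ^ (-2 : ℝ) * r ^ (γ + 1) := by
        rw [← Real.rpow_add hr0]; ring_nf
      have e4 : r' ^ (γ' - 1) = r' ^ (-2 : ℝ) * r' ^ (γ' + 1) := by
        rw [← Real.rpow_add hr'0]; ring_nf
      have e5 : r' ^ (-2 : ℝ) ≠ 0 := (Real.rpow_pos_of_pos hr'0 _).ne'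
      have e6 : r' ^ (γ' + 1) ≠ 0 := (Real.rpow_pos_of_pos hr'0 _).ne'
      rw [e1, e2, e3, e4]
      field_simp
    rw [key]
    have hl8 := log_le_eight_mul_rpow hr0.le
    have hl0 := Real.log_nonneg hr.le
    have hp8 : r ^ (1 / 8 : ℝ) ≤ r ^ (3 / 4 : ℝ) :=
      Real.rpow_le_rpow_of_exponent_le hr.le (by norm_num)
    have hone : 1 ≤ r ^ (3 / 4 : ℝ) := Real.one_le_rpow hr.le (by norm_num)
    have b1 : -θ ≤ K₁ * (η * r ^ (3 / 4 : ℝ)) := by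
      have c1 : (γ' - γ) * Real.log r ≤ η * (8 * r ^ (3 / 4 : ℝ)) :=
        mul_le_mul ((le_abs_self _).trans hγ') (by linarith) hl0 hη.le
      have c2 : (γ' + 1) * (Real.log r' - Real.log r) ≤
          (γ + 2) * (612 * (η * r ^ (3 / 4 : ℝ))) := by
        have d1 : 0 ≤ γ' + 1 := by linarith [(abs_le.1 hγ').1]
        have d2 : γ' + 1 ≤ γ + 2 := by linarith [(abs_le.1 hγ').2]
        calc _ ≤ (γ' + 1) * (612 * (η * r ^ (3 / 4 : ℝ))) :=
              mul_le_mul_of_nonneg_left (by linarith) d1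
          _ ≤ _ := mul_le_mul_of_nonneg_right d2 (by positivity)
      have c3 : -D r ≤ η * r ^ (3 / 4 : ℝ) := by
        have := mul_le_mul_of_nonneg_left hp8 hη.le
        linarith [(abs_le.1 (hD r hr.le)).1]
      have c4 : Real.log c ≤ η * r ^ (3 / 4 : ℝ) := by
        have := mul_le_mul_of_nonneg_left hone hη.le
        linarith [Real.log_le_sub_one_of_pos hc0, (abs_le.1 hc).2]
      have e : -θ = (γ' - γ) * Real.log r + (γ' + 1) * (Real.log r' - Real.log r) + -D r +
          Real.log c := by rw [hθ]; ring
      rw [e, hK₁]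
      linarith
    have b2 : 1 - Real.exp θ ≤ K₁ * (η * r ^ (3 / 4 : ℝ)) := by
      linarith [Real.add_one_le_exp θ]
    have := mul_le_mul_of_nonneg_left b2 hr20.le
    linarith

/-! ### Generalized Pareto laws as Pareto images; Hellinger distance. -/

theorem exists_pos_boxCox_eq {γ w : ℝ} (hγw : 0 < 1 + γ * w) : ∃ r, 0 < r ∧ boxCox γ r = w := by
  rcases eq_or_ne γ 0 with rfl | h
  · exact ⟨Real.exp w, Real.exp_pos w, by simp [boxCox]⟩
  · refine ⟨(1 + γ * w) ^ (1 / γ), Real.rpow_pos_of_pos hγw _, ?_⟩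
    rw [boxCox, if_neg h, ← Real.rpow_mul hγw.le, one_div_mul_cancel h, Real.rpow_one]
    field_simp; ring

theorem exists_boxCox_eq {γ w : ℝ} (hw : 0 < w) (hγw : 0 < 1 + γ * w) :
    ∃ r, 1 < r ∧ boxCox γ r = w := by
  obtain ⟨r, hr0, hr⟩ := exists_pos_boxCox_eq hγw
  refine ⟨r, ?_, hr⟩
  by_contra! hle
  have := (strictMonoOn_boxCox γ).monotoneOn (mem_Ioi.2 hr0) (mem_Ioi.2 one_pos) hle
  rw [hr, boxCox_one] at this
  linarith

/-- Change of variables: r^(-2) divided by the derivative σ r^(γ-1) of the Box-Cox parametrization.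
-/
theorem gpDensity_boxCox {γ σ r : ℝ} (hσ : 0 < σ) (hr : 1 < r) :
    gpDensity γ σ (σ * boxCox γ r) = r ^ (-(1 + γ)) / σ := by
  have hr0 : 0 < r := by linarith
  have hb := boxCox_pos γ hr
  have e : σ * boxCox γ r / σ = boxCox γ r := by field_simp
  rw [gpDensity, e, one_add_mul_boxCox, if_pos ⟨by positivity, Real.rpow_pos_of_pos hr0 _⟩]
  congr 1
  split_ifs with h
  · subst h
    simp only [boxCox, if_true, add_zero]
    rw [Real.exp_neg, Real.exp_log hr0, Real.rpow_neg_one]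
  · rw [← Real.rpow_mul hr0.le]
    congr 1
    field_simp

theorem one_sub_gpCdf_boxCox {γ σ r : ℝ} (hσ : 0 < σ) (hr : 1 < r) :
    1 - gpCdf γ σ (σ * boxCox γ r) = 1 / r := by
  have hr0 : 0 < r := by linarith
  have hb := boxCox_pos γ hr
  have e : σ * boxCox γ r / σ = boxCox γ r := by field_simp
  rw [gpCdf, e, one_add_mul_boxCox, if_neg (not_le.2 (mul_pos hσ hb)),
    max_eq_right (Real.rpow_nonneg hr0.le _)]
  split_ifs with h
  · subst h
    simp only [boxCox, if_true]
    rw [Real.exp_neg, Real.exp_log hr0]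
    simp
  · rw [← Real.rpow_mul hr0.le, show γ * (-1 / γ) = -1 by field_simp, Real.rpow_neg_one]
    simp

/-- The predictive density is the density of an affine Box-Cox transform of a Pareto variable. -/
theorem isParetoImage_gpPredDensity {γ σ u s m x : ℝ} (hσ : 0 < σ) (hs : 0 < s) (hx : 0 < x) :
    IsParetoImage
      (fun r => m + x * (u + σ * boxCox γ (1 / s)) + x * σ * (1 / s) ^ γ * boxCox γ r)
      (fun r => x * σ * (1 / s) ^ γ * r ^ (γ - 1))
      (fun y => gpPredDensity γ σ u s ((y - m) / x) / x) := by
  have hsg : 0 < s ^ γ := Real.rpow_pos_of_pos hs γ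
  have hinv : (1 / s) ^ γ = 1 / s ^ γ := by rw [Real.div_rpow zero_le_one hs.le, Real.one_rpow]
  have hbc : boxCox γ (1 / s) = -(boxCox γ s / s ^ γ) := by
    rw [boxCox_one_div γ hs, hinv, mul_one_div]
  refine ⟨fun r hr => ?_, fun r hr => ?_, fun y => ?_, fun r hr => ?_, fun y hy => ?_⟩
  · exact ((hasDerivAt_boxCox γ (by linarith)).const_mul _).const_add _
  · have : 0 < r := by linarith
    positivity
  · refine div_nonneg (mul_nonneg ?_ hsg.le) hx.le
    rw [gpDensity]
    split_ifs with h1 h2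
    · positivity
    · exact div_nonneg (Real.rpow_nonneg h1.2.le _) hσ.le
    · exact le_rfl
  · have hr0 : 0 < r := by linarith
    have e : ((m + x * (u + σ * boxCox γ (1 / s)) + x * σ * (1 / s) ^ γ * boxCox γ r - m) / x - u) *
        s ^ γ + σ * boxCox γ s = σ * boxCox γ r := by
      rw [hbc, hinv]; field_simp; ring
    simp only [gpPredDensity]
    rw [e, gpDensity_boxCox hσ hr, hinv]
    have e2 : r ^ (-2 : ℝ) = r ^ (γ - 1) * r ^ (-(1 + γ)) := by
      rw [← Real.rpow_add hr0]; ring_nf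
    rw [e2]; field_simp
  · simp only [gpPredDensity]
    rw [gpDensity, if_neg, zero_mul, zero_div]
    rintro ⟨h1, h2⟩
    obtain ⟨r, hr, he⟩ := exists_boxCox_eq (div_pos h1 hσ) h2
    refine hy ⟨r, hr, ?_⟩
    simp only [he]
    rw [hbc, hinv]; field_simp; ring

/-- Pointwise, (√p - √q)² ≤ |√p - √q| (√p + √q) = |p - q|. -/
theorem hellinger_le_sqrt {f g : ℝ → ℝ} (hf : Integrable f) (hg : Integrable g)
    (hf0 : ∀ y, 0 ≤ f y) (hg0 : ∀ y, 0 ≤ g y) :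
    hellinger f g ≤ Real.sqrt (∫ y, |f y - g y|) := by
  refine Real.sqrt_le_sqrt (integral_mono_of_nonneg (Eventually.of_forall fun y => sq_nonneg _)
    (hf.sub hg).abs (Eventually.of_forall fun y => ?_))
  simp only
  have h1 := Real.sq_sqrt (hf0 y)
  have h2 := Real.sq_sqrt (hg0 y)
  have n1 := Real.sqrt_nonneg (f y)
  have n2 := Real.sqrt_nonneg (g y)
  set p := Real.sqrt (f y)
  set q := Real.sqrt (g y)
  show (p - q) ^ 2 ≤ |f y - g y|
  rw [← h1, ← h2]
  rcases le_total p q with h | h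
  · rw [abs_of_nonpos (by nlinarith)]; nlinarith
  · rw [abs_of_nonneg (by nlinarith)]; nlinarith

theorem hellinger_congr_ae_left {f f' g : ℝ → ℝ} (h : f =ᵐ[volume] f') :
    hellinger f g = hellinger f' g := by
  unfold hellinger
  congr 1
  refine integral_congr_ae ?_
  filter_upwards [h] with y hy
  rw [hy]

/-- The density of the image of the unit Pareto law. -/
def paretoDensity (Ψ Ψ' : ℝ → ℝ) (y : ℝ) : ℝ :=
  open Classical in
  if y ∈ Ψ '' Ioi 1 then
    (Function.invFunOn Ψ (Ioi 1) y) ^ (-2 : ℝ) / Ψ' (Function.invFunOn Ψ (Ioi 1) y)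
  else 0

theorem isParetoImage_paretoDensity {Ψ Ψ' : ℝ → ℝ} (hd : ∀ r, 1 < r → HasDerivAt Ψ (Ψ' r) r)
    (hp : ∀ r, 1 < r → 0 < Ψ' r) : IsParetoImage Ψ Ψ' (paretoDensity Ψ Ψ') := by
  have hm : StrictMonoOn Ψ (Ioi 1) := by
    apply strictMonoOn_of_deriv_pos (convex_Ioi 1)
    · exact fun x hx => (hd x hx).continuousAt.continuousWithinAt
    · intro x hx
      rw [interior_Ioi] at hx
      rw [(hd x hx).deriv]
      exact hp x hx
  refine ⟨hd, hp, fun y => ?_, fun r hr => ?_, fun y hy => if_neg hy⟩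
  · unfold paretoDensity
    split_ifs with h
    · have h1 : 1 < Function.invFunOn Ψ (Ioi 1) y := Function.invFunOn_mem h
      have h2 := hp _ h1
      have h3 : 0 < Function.invFunOn Ψ (Ioi 1) y := one_pos.trans h1
      positivity
    · exact le_rfl
  · have h1 : Ψ r ∈ Ψ '' Ioi 1 := ⟨r, hr, rfl⟩
    have h2 : Function.invFunOn Ψ (Ioi 1) (Ψ r) = r :=
      hm.injOn (Function.invFunOn_mem h1) hr (Function.invFunOn_eq h1)
    rw [paretoDensity, if_pos h1, h2, mul_div_cancel₀ _ (hp r hr).ne']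

/-! ### Conditional law of the peaks above a tail quantile. -/

namespace RegularTail

variable {ν : Measure ℝ} {γ t₀ : ℝ}

theorem strictMonoOn_tailQuantile {F : ℝ → ℝ} (h : RegularTail F γ t₀) :
    StrictMonoOn (tailQuantile F) (Ici t₀) := by
  apply strictMonoOn_of_deriv_pos (convex_Ici t₀)
  · exact fun x hx => (h.hasDerivAt_quantile x hx).continuousAt.continuousWithinAt
  · intro x hx
    rw [interior_Ici] at hx
    rw [(h.hasDerivAt_quantile x (le_of_lt hx)).deriv]
    exact div_pos (h.scale_pos x (le_of_lt hx)) (by have := h.one_lt; have : t₀ < x := hx; linarith)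

theorem one_sub_mem (h : RegularTail (cdf ν) γ t₀) {t : ℝ} (ht : t₀ ≤ t) :
    1 - 1 / t ∈ Ioo (0 : ℝ) 1 := by
  have h1 := h.one_lt.trans_le ht
  have h2 : 0 < 1 / t := by positivity
  have h3 : 1 / t < 1 := by rw [div_lt_one (by linarith)]; exact h1
  constructor <;> linarith

/-- A jump of the distribution function at U(t) would make U constant on an interval to the right of
t, against strict monotonicity. The contradiction uses a level halfway up the jump, which is below 1
even if the jump reaches 1. -/
theorem cdf_tailQuantile (h : RegularTail (cdf ν) γ t₀) {t : ℝ} (ht : t₀ ≤ t) :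
    cdf ν (tailQuantile (cdf ν) t) = 1 - 1 / t := by
  have hm := h.one_sub_mem ht
  have ht1 := h.one_lt.trans_le ht
  refine le_antisymm ?_ ((quantile_cdf_le_iff ν hm.1 hm.2).1 le_rfl)
  by_contra! hlt
  set p := cdf ν (tailQuantile (cdf ν) t)
  have hp1 : p ≤ 1 := cdf_le_one _ _
  set p' := (p + (1 - 1 / t)) / 2
  have h1 : 1 - 1 / t < p' := by simp only [p']; linarith
  have h2 : p' < 1 := by simp only [p']; linarith [hm.2]
  have h3 : p' ≤ p := by simp only [p']; linarith
  have h4 : t < 1 / (1 - p') := by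
    rw [lt_one_div (by linarith) (by linarith)]; linarith
  have h5 : 1 - 1 / (1 / (1 - p')) = p' := by rw [one_div_one_div]; ring
  have h6 := h.strictMonoOn_tailQuantile (mem_Ici.2 ht) (mem_Ici.2 (ht.trans h4.le)) h4
  rw [tailQuantile.eq_1 _ (1 / (1 - p')), h5] at h6
  exact h6.not_ge ((quantile_cdf_le_iff ν (hm.1.trans h1) h2).2 h3)

theorem measure_Ioi_tailQuantile [IsProbabilityMeasure ν] (h : RegularTail (cdf ν) γ t₀) {t : ℝ}
    (ht : t₀ ≤ t) : ν (Ioi (tailQuantile (cdf ν) t)) = ENNReal.ofReal (1 / t) := by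
  have := (cdf ν).measure_Ioi (tendsto_cdf_atTop ν) (tailQuantile (cdf ν) t)
  rw [measure_cdf, h.cdf_tailQuantile ht] at this
  rw [this]; congr 1; ring

theorem measure_Ioc_tailQuantile [IsProbabilityMeasure ν] (h : RegularTail (cdf ν) γ t₀) {t : ℝ}
    (ht : t₀ ≤ t) (x : ℝ) :
    ν (Ioc (tailQuantile (cdf ν) t) x) = ENNReal.ofReal (1 / t - (1 - cdf ν x)) := by
  have := (cdf ν).measure_Ioc (tailQuantile (cdf ν) t) x
  rw [measure_cdf, h.cdf_tailQuantile ht] at this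
  rw [this]; congr 1; ring

end RegularTail

/-- The probability that c R ≤ 1 for a unit Pareto variable R. -/
theorem integral_indicator_rpow_neg_two {c : ℝ} (hc : 0 ≤ c) :
    ∫ r in Ioi (1 : ℝ), {r | c * r ≤ 1}.indicator (fun r => r ^ (-2 : ℝ)) r = max 0 (1 - c) := by
  rcases hc.eq_or_lt with rfl | hc
  · simp only [zero_mul, zero_le_one, ofPred_true, indicator_univ]
    rw [integral_Ioi_rpow_of_lt (by norm_num) one_pos]; norm_num
  · have hm : MeasurableSet {r : ℝ | c * r ≤ 1} :=
      measurableSet_le (measurable_const.mul measurable_id) measurable_const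
    have hset : Ioi 1 ∩ {r : ℝ | c * r ≤ 1} = Ioc 1 (1 / c) := by
      ext r
      simp only [mem_inter_iff, mem_Ioi, mem_ofPred_eq, mem_Ioc, le_div_iff₀ hc, mul_comm c]
    rw [setIntegral_indicator hm, hset]
    rcases le_or_gt 1 c with h1 | h1
    · rw [Ioc_eq_empty (by rw [not_lt, div_le_one hc]; exact h1), max_eq_left (by linarith)]
      simp
    · have h2 : 1 ≤ 1 / c := by rw [le_div_iff₀ hc]; linarith
      rw [← intervalIntegral.integral_of_le h2, integral_rpow (Or.inr ⟨by norm_num, fun h => by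
        rw [uIcc_of_le h2] at h; linarith [h.1]⟩), max_eq_right (by linarith)]
      norm_num [Real.rpow_neg_one]
      ring

/-- The affine tail map `r ↦ m + x U(t r)`, written through the normalized excess. -/
theorem affine_excess_eq {F : ℝ → ℝ} {γ t₀ : ℝ} (h : RegularTail F γ t₀) {t : ℝ} (ht : t₀ ≤ t)
    (m x r : ℝ) : m + x * tailQuantile F t + x * tailScale F t * RegularTail.excess F t r =
      m + x * tailQuantile F (t * r) := by
  have := (h.scale_pos t ht).ne'
  simp only [RegularTail.excess]
  field_simp; ring

/-- Conditional law of the peaks of a location-scale family above a tail quantile. -/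
theorem cond_map_apply_Iic {ν : Measure ℝ} [IsProbabilityMeasure ν] {γ t₀ t m x : ℝ}
    (h : RegularTail (cdf ν) γ t₀) (ht : t₀ ≤ t) (hx : 0 < x) (y : ℝ) :
    ProbabilityTheory.cond (ν.map (fun e => m + x * e)) (Ioi (m + x * tailQuantile (cdf ν) t))
      (Iic y) = ENNReal.ofReal (1 - t * (1 - cdf ν ((y - m) / x))) := by
  have hmeas : Measurable fun e : ℝ => m + x * e := by fun_prop
  have ht0 : 0 < t := by linarith [h.one_lt]
  rw [cond_apply measurableSet_Ioi, Measure.map_apply hmeas measurableSet_Ioi,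
    Measure.map_apply hmeas (measurableSet_Ioi.inter measurableSet_Iic)]
  have e1 : (fun e : ℝ => m + x * e) ⁻¹' Ioi (m + x * tailQuantile (cdf ν) t) =
      Ioi (tailQuantile (cdf ν) t) := by
    ext e; simp [mul_lt_mul_iff_right₀ hx]
  have e2 : (fun e : ℝ => m + x * e) ⁻¹' Iic y = Iic ((y - m) / x) := by
    ext e
    simp only [mem_preimage, mem_Iic]
    rw [le_div_iff₀ hx]
    constructor <;> intro <;> linarith
  rw [preimage_inter, e1, e2, Ioi_inter_Iic, h.measure_Ioi_tailQuantile ht,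
    h.measure_Ioc_tailQuantile ht, ← ENNReal.ofReal_inv_of_pos (by positivity),
    ← ENNReal.ofReal_mul (by positivity)]
  congr 1
  field_simp

/-- Both measures agree on half-lines: U(tr) ≤ e holds exactly when t (1 - F(e)) r ≤ 1, so the peaks
above U(t) are distributed as m + x U(tR) with R unit Pareto. -/
theorem cond_map_eq_withDensity {ν : Measure ℝ} [IsProbabilityMeasure ν] {γ t₀ t m x : ℝ}
    (h : RegularTail (cdf ν) γ t₀) (ht : t₀ ≤ t) (hx : 0 < x) {Ψ' f : ℝ → ℝ}
    (hf : IsParetoImage (fun r => m + x * tailQuantile (cdf ν) t +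
      x * tailScale (cdf ν) t * RegularTail.excess (cdf ν) t r) Ψ' f) :
    ProbabilityTheory.cond (ν.map (fun e => m + x * e)) (Ioi (m + x * tailQuantile (cdf ν) t)) =
      volume.withDensity (fun y => ENNReal.ofReal (f y)) := by
  have hmeas : Measurable fun e : ℝ => m + x * e := by fun_prop
  have := Measure.isProbabilityMeasure_map (μ := ν) hmeas.aemeasurable
  refine Measure.ext_of_Iic _ _ fun y => ?_
  have ht0 : 0 < t := by linarith [h.one_lt]
  have hc : 0 ≤ t * (1 - cdf ν ((y - m) / x)) :=
    mul_nonneg ht0.le (by linarith [cdf_le_one ν ((y - m) / x)])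
  rw [cond_map_apply_Iic h ht hx, withDensity_apply _ measurableSet_Iic,
    ← ofReal_integral_eq_lintegral_ofReal hf.integrable.integrableOn
      (Eventually.of_forall fun y => hf.nonneg y),
    ← integral_indicator measurableSet_Iic, hf.integral_indicator_eq]
  have e : ∫ r in Ioi (1 : ℝ), ((fun r => m + x * tailQuantile (cdf ν) t +
      x * tailScale (cdf ν) t * RegularTail.excess (cdf ν) t r) ⁻¹' Iic y).indicator
        (fun r => r ^ (-2 : ℝ)) r =
      ∫ r in Ioi (1 : ℝ), {r | t * (1 - cdf ν ((y - m) / x)) * r ≤ 1}.indicator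
        (fun r => r ^ (-2 : ℝ)) r := by
    refine setIntegral_congr_fun measurableSet_Ioi fun r hr => ?_
    have hr1 : (1 : ℝ) < r := hr
    have hr0 : 0 < r := by linarith
    have hm := h.one_sub_mem (h.le_mul ht hr1.le)
    have hiff : (r ∈ (fun r => m + x * tailQuantile (cdf ν) t +
        x * tailScale (cdf ν) t * RegularTail.excess (cdf ν) t r) ⁻¹' Iic y) ↔
        r ∈ {r | t * (1 - cdf ν ((y - m) / x)) * r ≤ 1} := by
      rw [mem_preimage, mem_Iic, affine_excess_eq h ht, mem_ofPred_eq]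
      have e3 : m + x * tailQuantile (cdf ν) (t * r) ≤ y ↔
          tailQuantile (cdf ν) (t * r) ≤ (y - m) / x := by
        rw [le_div_iff₀ hx]
        constructor <;> intro <;> linarith
      rw [e3, tailQuantile, quantile_cdf_le_iff ν hm.1 hm.2, sub_le_comm,
        le_div_iff₀ (by positivity)]
      constructor <;> intro <;> linarith
    by_cases hb : r ∈ {r | t * (1 - cdf ν ((y - m) / x)) * r ≤ 1}
    · simp only [indicator_of_mem hb, indicator_of_mem (hiff.2 hb)]
    · simp only [indicator_of_notMem hb, indicator_of_notMem (fun hh => hb (hiff.1 hh))]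
  rw [e, integral_indicator_rpow_neg_two hc, ENNReal.ofReal_max, ENNReal.ofReal_zero,
    max_eq_right zero_le]

namespace LocationScaleSeries

variable {Ω : Type*} [MeasurableSpace Ω] {P : Measure Ω}

theorem measurable_past (S : LocationScaleSeries P) (i : ℤ) : Measurable (S.past i) :=
  measurable_pi_lambda _ fun _ => S.measurable_Y _

/-- The conditional distribution of an observation given the past on which it depends. -/
theorem condDistrib_ae_eq [IsProbabilityMeasure P] (S : LocationScaleSeries P) (i : ℤ) :
    ∀ᵐ ω ∂P, condDistrib (S.Y i) (S.past i) P (S.past i ω) =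
      (P.map (S.innov 0)).map (fun e => S.loc i ω + S.scale i ω * e) := by
  set ν := P.map (S.innov 0) with hν
  have : IsProbabilityMeasure ν :=
    Measure.isProbabilityMeasure_map (S.measurable_innov 0).aemeasurable
  set G : (S.pastIdx i → ℝ) × ℝ → ℝ := fun p => S.locFun i p.1 + S.scaleFun i p.1 * p.2
  have hG : Measurable G :=
    ((S.measurable_locFun i).comp measurable_fst).add
      (((S.measurable_scaleFun i).comp measurable_fst).mul measurable_snd)
  -- The kernel that freezes the past s and draws the innovation from ν. Independence makes it
  -- disintegrate the law of past and observation, and disintegrations are almost everywhere unique.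
  set κ : Kernel (S.pastIdx i → ℝ) ℝ := (Kernel.id ×ₖ Kernel.const _ ν).map G
  have hκ : ∀ s, κ s = ν.map (fun e => G (s, e)) := by
    intro s
    rw [Kernel.map_apply _ hG, Kernel.prod_apply, Kernel.id_apply, Kernel.const_apply,
      Measure.dirac_prod, Measure.map_map hG (by fun_prop)]
    rfl
  have hind : IndepFun (S.past i) (S.innov i) P := by
    have h1 := (S.indep_past i).symm
    have h2 : Measurable fun (y : Set.Iio i → ℝ) (j : S.pastIdx i) =>
        y ⟨j, S.pastIdx_lt i j j.2⟩ := measurable_pi_lambda _ fun _ => measurable_pi_apply _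
    exact h1.comp h2 measurable_id
  have hjoint : P.map (fun ω => (S.past i ω, S.innov i ω)) = (P.map (S.past i)).prod ν := by
    rw [(indepFun_iff_map_prod_eq_prod_map_map (S.measurable_past i).aemeasurable
      (S.measurable_innov i).aemeasurable).1 hind, (S.ident_innov i).map_eq]
  have hY : (fun ω => (S.past i ω, S.Y i ω)) =ᵐ[P]
      (fun p : (S.pastIdx i → ℝ) × ℝ => (p.1, G p)) ∘ (fun ω => (S.past i ω, S.innov i ω)) := by
    filter_upwards [S.model_eq i] with ω hω
    simp only [Function.comp, G]
    rw [hω]; rfl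
  have hmG : Measurable fun p : (S.pastIdx i → ℝ) × ℝ => (p.1, G p) := measurable_fst.prodMk hG
  have hPP : IsProbabilityMeasure (P.map (S.past i)) :=
    Measure.isProbabilityMeasure_map (S.measurable_past i).aemeasurable
  have hcomp : P.map (fun ω => (S.past i ω, S.Y i ω)) = P.map (S.past i) ⊗ₘ κ := by
    rw [Measure.map_congr hY, ← Measure.map_map hmG ((S.measurable_past i).prodMk
      (S.measurable_innov i)), hjoint]
    ext s hs
    rw [Measure.map_apply hmG hs, Measure.prod_apply (hmG hs), Measure.compProd_apply hs]
    refine lintegral_congr fun p => ?_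
    rw [hκ, Measure.map_apply (by fun_prop) (measurable_prodMk_left hs)]
    rfl
  have := condDistrib_ae_eq_of_measure_eq_compProd (S.past i)
    (S.measurable_Y i).aemeasurable hcomp
  filter_upwards [ae_of_ae_map (S.measurable_past i).aemeasurable this] with ω hω
  rw [hω, hκ]
  rfl

end LocationScaleSeries

/-! ### Bias of the generalized Pareto approximation. -/

namespace SecondOrderCondition

variable {F : ℝ → ℝ} {γ ρ t₀ τ₀ : ℝ} {a : ℝ → ℝ}

/-- The scaling function is equivalent to the von Mises scale, with rate `A`. -/
theorem exists_abs_scale_div_sub_one_le (h : SecondOrderCondition F γ ρ a)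
    (hr : RegularTail F γ t₀) :
    ∃ C : ℝ, 0 < C ∧ ∀ᶠ t in atTop, |tailScale F t / a t - 1| ≤ C * |rateA F γ t| := by
  obtain ⟨K, hK, hK'⟩ := exists_abs_le_wBar γ
  obtain ⟨C₀, hC₀, hpot⟩ := potter_bound (measurable_rateA F γ) h.regularly_varying one_pos
  -- The single point x = 1/2 suffices. It gives (U(2t) - U(t))/a(t) = β + O(A) with β the Box-Cox
  -- function at 2; the von Mises representation gives the same with b(t) in place of a(t), and β >
  -- 0.
  have hso := (h.second_order (1 / 2) (by norm_num)).comp tendsto_inv_atTop_nhdsGT_zero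
  set L := ∫ v in (1 : ℝ)..(1 / (1 / 2)), v ^ (γ - 1) * ∫ r in (1 : ℝ)..v, r ^ (ρ - 1)
  have hbd := (hso.abs).eventually (eventually_le_nhds (show |L| < |L| + 1 by linarith))
  set β := boxCox γ 2
  have hβ : 0 < β := boxCox_pos γ one_lt_two
  set C₁ := |L| + 1
  have hC₁ : 0 < C₁ := by positivity
  set C₃ := K * (2 * (C₀ * 2)) * 2 ^ γ * wBar γ 2
  have hw : 0 < wBar γ 2 := one_pos.trans_le (one_le_wBar γ 2)
  have hC₃ : 0 < C₃ := by positivity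
  have hA0 : Tendsto (fun t => |rateA F γ t|) atTop (𝓝 0) := by simpa using h.rate_zero.abs
  have hs1 : ∀ᶠ t in atTop, C₀ * 2 * |rateA F γ t| < 1 := by
    have := hA0.const_mul (C₀ * 2)
    rw [mul_zero] at this
    exact this.eventually_lt_const one_pos
  have hs2 : ∀ᶠ t in atTop, C₃ * |rateA F γ t| < β / 2 := by
    have := hA0.const_mul C₃
    rw [mul_zero] at this
    exact this.eventually_lt_const (by positivity)
  refine ⟨2 * (C₁ + C₃) / β, by positivity, ?_⟩
  filter_upwards [hbd, hpot, hs1, hs2, h.a_pos, eventually_ge_atTop t₀,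
    h.eventually_rateA_ne_zero] with t hbd hpot hs1 hs2 ha ht hA
  have hA' : 0 < |rateA F γ t| := abs_pos.2 hA
  have hb := hr.scale_pos t ht
  have e1 : |tailScale F t / a t * RegularTail.excess F t 2 - β| ≤ C₁ * |rateA F γ t| := by
    simp only [Function.comp, one_div, inv_inv, abs_mul, abs_inv] at hbd
    rw [inv_mul_le_iff₀ hA'] at hbd
    rw [mul_comm C₁]
    refine le_trans (le_of_eq ?_) hbd
    congr 2
    simp only [RegularTail.excess, tailQuantile]
    rw [show 1 / (t * 2) = t⁻¹ * 2⁻¹ by rw [one_div, mul_inv], one_div]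
    field_simp
  have e2 : |RegularTail.excess F t 2 - β| ≤ C₃ * |rateA F γ t| := by
    have := hr.abs_excess_sub_boxCox_le hK' ht one_le_two (κ := C₀ * 2 * |rateA F γ t|)
      (by positivity) (fun v hv => ?_) ?_
    · refine this.trans (le_of_eq ?_)
      simp only [C₃]; ring
    · refine (hpot v hv.1).trans ?_
      have h1 : v ^ (ρ + 1) ≤ 2 := by
        calc v ^ (ρ + 1) ≤ v ^ (1 : ℝ) :=
              Real.rpow_le_rpow_of_exponent_le hv.1 (by linarith [h.rho_nonpos])
          _ ≤ 2 := by rw [Real.rpow_one]; exact hv.2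
      calc C₀ * |rateA F γ t| * v ^ (ρ + 1) ≤ C₀ * |rateA F γ t| * 2 := by gcongr
        _ = _ := by ring
    · have : Real.log 2 ≤ 1 := by linarith [Real.log_two_lt_d9]
      exact (mul_le_of_le_one_right (by positivity) this).trans hs1.le
  have e3 : β / 2 ≤ RegularTail.excess F t 2 := by linarith [(abs_le.1 e2).1]
  have e4 : |tailScale F t / a t - 1| * RegularTail.excess F t 2 ≤
      (C₁ + C₃) * |rateA F γ t| := by
    have : (tailScale F t / a t - 1) * RegularTail.excess F t 2 =
      (tailScale F t / a t * RegularTail.excess F t 2 - β) -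
        (RegularTail.excess F t 2 - β) := by ring
    have habs : |tailScale F t / a t - 1| * RegularTail.excess F t 2 =
        |(tailScale F t / a t - 1) * RegularTail.excess F t 2| := by
      rw [abs_mul, abs_of_pos (show 0 < RegularTail.excess F t 2 by linarith)]
    rw [habs, this]
    refine (abs_sub _ _).trans ?_
    linarith
  have e5 : |tailScale F t / a t - 1| * (β / 2) ≤ (C₁ + C₃) * |rateA F γ t| :=
    (mul_le_mul_of_nonneg_left e3 (abs_nonneg _)).trans e4
  rw [div_mul_eq_mul_div, le_div_iff₀ hβ]
  linarith

/-- Uniform bounds for the rate function beyond a sequence of levels. -/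
theorem exists_abs_rateA_le (h : SecondOrderCondition F γ ρ a)
    (hmono : ρ = 0 → τ₀ = 0 → ∃ t₀, AntitoneOn (fun t => |rateA F γ t|) (Set.Ici t₀))
    {T X : ℕ → ℝ} (hT : Tendsto T atTop atTop) (hX : ∀ᶠ n in atTop, 1 ≤ X n)
    (hτ : Tendsto (fun n => 1 / X n) atTop (𝓝 τ₀)) :
    ∃ C : ℝ, 0 < C ∧ ∀ᶠ n in atTop,
      (∀ v ∈ Icc 1 (X n), |rateA F γ (T n * v)| ≤ C * |rateA F γ (T n)|) ∧
      ∀ v, 1 ≤ v → |rateA F γ (T n * X n * v)| ≤ C * |rateA F γ (T n)| * v ^ (1 / 8 : ℝ) := by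
  -- If ρ < 0, a Potter bound with d = -ρ has exponent zero. If ρ = 0 and τ₀ = 0, monotonicity of
  -- |A| replaces it. If ρ = 0 and τ₀ > 0, the ratio X is at most 2/τ₀, and the loss v^(1/8) is
  -- harmless on a bounded range.
  rcases h.rho_nonpos.lt_or_eq with hρ | hρ
  · obtain ⟨C, hC, hpot⟩ := potter_bound (measurable_rateA F γ) h.regularly_varying
      (d := -ρ) (by linarith)
    refine ⟨C, hC, ?_⟩
    filter_upwards [hT.eventually hpot, hX] with n hn hX
    simp only [add_neg_cancel, Real.rpow_zero, mul_one] at hn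
    refine ⟨fun v hv => hn v hv.1, fun v hv => ?_⟩
    rw [mul_assoc]
    refine (hn _ (one_le_mul_of_one_le_of_one_le hX hv)).trans ?_
    exact le_mul_of_one_le_right (by positivity) (Real.one_le_rpow hv (by norm_num))
  · rcases eq_or_ne τ₀ 0 with h0 | h0
    · obtain ⟨t₁, ht₁⟩ := hmono hρ h0
      refine ⟨1, one_pos, ?_⟩
      filter_upwards [hT.eventually_ge_atTop t₁, hT.eventually_ge_atTop 0, hX] with n hn hn0 hX
      have key : ∀ v, 1 ≤ v → |rateA F γ (T n * v)| ≤ |rateA F γ (T n)| := by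
        intro v hv
        have hle : T n ≤ T n * v := le_mul_of_one_le_right hn0 hv
        exact ht₁ (mem_Ici.2 hn) (mem_Ici.2 (hn.trans hle)) hle
      refine ⟨fun v hv => by rw [one_mul]; exact key v hv.1, fun v hv => ?_⟩
      rw [mul_assoc, one_mul]
      refine (key _ (one_le_mul_of_one_le_of_one_le hX hv)).trans ?_
      exact le_mul_of_one_le_right (by positivity) (Real.one_le_rpow hv (by norm_num))
    · have hτpos : 0 < τ₀ := lt_of_le_of_ne (ge_of_tendsto hτ (by
        filter_upwards [hX] with n hn
        positivity)) (Ne.symm h0)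
      obtain ⟨C, hC, hpot⟩ := potter_bound (measurable_rateA F γ) h.regularly_varying
        (d := 1 / 8) (by norm_num)
      rw [hρ, zero_add] at hpot
      refine ⟨C * (2 / τ₀) ^ (1 / 8 : ℝ), by positivity, ?_⟩
      filter_upwards [hT.eventually hpot, hX, hτ.eventually (eventually_gt_nhds
        (show τ₀ / 2 < τ₀ by linarith))] with n hn hX hXτ
      have hX0 : 0 < X n := by linarith
      have hXle : X n ≤ 2 / τ₀ := by
        rw [lt_div_iff₀ hX0] at hXτ
        rw [le_div_iff₀ hτpos]; linarith
      refine ⟨fun v hv => ?_, fun v hv => ?_⟩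
      · refine (hn v hv.1).trans ?_
        have hv0 : 0 < v := by linarith [hv.1]
        have : v ^ (1 / 8 : ℝ) ≤ (2 / τ₀) ^ (1 / 8 : ℝ) :=
          Real.rpow_le_rpow hv0.le (hv.2.trans hXle) (by norm_num)
        calc C * |rateA F γ (T n)| * v ^ (1 / 8 : ℝ)
            ≤ C * |rateA F γ (T n)| * (2 / τ₀) ^ (1 / 8 : ℝ) := by gcongr
          _ = _ := by ring
      · have hv0 : 0 < v := by linarith
        rw [mul_assoc]
        refine (hn _ (one_le_mul_of_one_le_of_one_le hX hv)).trans ?_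
        rw [Real.mul_rpow hX0.le hv0.le]
        have : (X n) ^ (1 / 8 : ℝ) ≤ (2 / τ₀) ^ (1 / 8 : ℝ) :=
          Real.rpow_le_rpow hX0.le hXle (by norm_num)
        calc C * |rateA F γ (T n)| * ((X n) ^ (1 / 8 : ℝ) * v ^ (1 / 8 : ℝ))
            ≤ C * |rateA F γ (T n)| * ((2 / τ₀) ^ (1 / 8 : ℝ) * v ^ (1 / 8 : ℝ)) := by gcongr
          _ = _ := by ring

/-- Generalized Pareto approximation of scale and quantile at an extreme level. -/
theorem exists_extreme_bounds (h : SecondOrderCondition F γ ρ a) (hr : RegularTail F γ t₀)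
    (hmono : ρ = 0 → τ₀ = 0 → ∃ t₀, AntitoneOn (fun t => |rateA F γ t|) (Set.Ici t₀))
    {T X : ℕ → ℝ} (hT : Tendsto T atTop atTop) (hX : ∀ᶠ n in atTop, 1 ≤ X n)
    (hτ : Tendsto (fun n => 1 / X n) atTop (𝓝 τ₀))
    (hAw : Tendsto (fun n => |rateA F γ (T n)| * wBar γ (X n)) atTop (𝓝 0)) :
    ∃ C : ℝ, 0 < C ∧ ∀ᶠ n in atTop,
      |tailScale F (T n * X n) / (a (T n) * X n ^ γ) - 1| ≤
        C * (|rateA F γ (T n)| * wBar γ (X n)) ∧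
      |tailQuantile F (T n * X n) - (tailQuantile F (T n) + a (T n) * boxCox γ (X n))| ≤
        C * (|rateA F γ (T n)| * wBar γ (X n)) * (a (T n) * X n ^ γ) ∧
      ∀ v, 1 ≤ v → |RegularTail.logDev F γ (T n * X n) v| ≤
        C * |rateA F γ (T n)| * v ^ (1 / 8 : ℝ) := by
  obtain ⟨K, hK, hK'⟩ := exists_abs_le_wBar γ
  obtain ⟨K₁, hK₁, hlog⟩ := exists_log_le_wBar γ
  obtain ⟨K₂, hK₂, hbox⟩ := exists_boxCox_le_wBar γ
  obtain ⟨C₁, hC₁, hscale⟩ := h.exists_abs_scale_div_sub_one_le hr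
  obtain ⟨C₂, hC₂, hA⟩ := h.exists_abs_rateA_le hmono hT hX hτ
  set C := (3 * C₁ + 2 * (C₂ * K₁)) + (2 * (K * (2 * C₂)) + C₁ * K₂) + 8 * C₂
  have hC : 0 < C := by positivity
  have hs : ∀ D : ℝ, ∀ᶠ n in atTop, D * (|rateA F γ (T n)| * wBar γ (X n)) < 1 := by
    intro D
    have := hAw.const_mul D
    rw [mul_zero] at this
    exact this.eventually_lt_const one_pos
  refine ⟨C, hC, ?_⟩
  filter_upwards [hT.eventually hscale, hA, hX, hT.eventually_ge_atTop t₀,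
    hT.eventually h.a_pos, hs (C₂ * K₁), hs C₁] with n hscale hA hX ht ha hs1 hs2
  set α := |rateA F γ (T n)|
  set w := wBar γ (X n)
  have hα : 0 ≤ α := abs_nonneg _
  have hw : 1 ≤ w := one_le_wBar _ _
  have hw0 : 0 < w := by linarith
  have hX0 : 0 < X n := by linarith
  have hXg : 0 < X n ^ γ := Real.rpow_pos_of_pos hX0 γ
  have hαw : α ≤ α * w := le_mul_of_one_le_right hα hw
  have hb := hr.scale_pos _ ht
  have hlogX := hlog (X n) hX
  have hlog0 := Real.log_nonneg hX
  have hl1 : C₂ * α * Real.log (X n) ≤ C₂ * K₁ * (α * w) := by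
    calc C₂ * α * Real.log (X n) ≤ C₂ * α * (K₁ * w) := by gcongr
      _ = _ := by ring
  have hab : |tailScale F (T n) / a (T n) - 1| ≤ C₁ * (α * w) :=
    hscale.trans (by gcongr)
  have hαw0 : 0 ≤ α * w := by positivity
  refine ⟨?_, ?_, fun v hv => ?_⟩
  · have hdev := hr.abs_logDev_le_log ht hX hA.1
    have hdev1 : |RegularTail.logDev F γ (T n) (X n)| ≤ C₂ * K₁ * (α * w) := hdev.trans hl1
    have hexp := Real.abs_exp_sub_one_le (hdev1.trans hs1.le)
    rw [hr.scale_mul ht hX]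
    set E := Real.exp (RegularTail.logDev F γ (T n) (X n))
    have e1 : tailScale F (T n) * X n ^ γ * E / (a (T n) * X n ^ γ) - 1 =
        (tailScale F (T n) / a (T n) - 1) * E + (E - 1) := by
      field_simp; ring
    have hE : |E| ≤ 3 := by
      have := abs_le.1 hexp
      rw [abs_le]; constructor <;> linarith
    rw [e1]
    refine (abs_add_le _ _).trans ?_
    rw [abs_mul]
    have e2 : |tailScale F (T n) / a (T n) - 1| * |E| ≤ C₁ * (α * w) * 3 :=
      mul_le_mul hab hE (abs_nonneg _) (by positivity)
    have e3 : |E - 1| ≤ 2 * (C₂ * K₁ * (α * w)) := by linarith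
    have e4 : 0 ≤ (2 * (K * (2 * C₂)) + C₁ * K₂) * (α * w) := by positivity
    have e5 : 0 ≤ 8 * C₂ * (α * w) := by positivity
    simp only [C]
    linarith
  · have hexc := hr.abs_excess_sub_boxCox_le hK' ht hX (by positivity) hA.1 (hl1.trans hs1.le)
    have hbx := hbox (X n) hX
    have hbx0 := boxCox_nonneg γ hX
    have e0 : tailQuantile F (T n * X n) - tailQuantile F (T n) =
        tailScale F (T n) * RegularTail.excess F (T n) (X n) := by
      simp only [RegularTail.excess]; field_simp
    have e1 : tailQuantile F (T n * X n) - (tailQuantile F (T n) + a (T n) * boxCox γ (X n)) =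
        a (T n) * ((tailScale F (T n) / a (T n)) *
          (RegularTail.excess F (T n) (X n) - boxCox γ (X n)) +
          (tailScale F (T n) / a (T n) - 1) * boxCox γ (X n)) := by
      rw [← sub_sub, e0]; field_simp; ring
    have hR : |tailScale F (T n) / a (T n)| ≤ 2 := by
      have := abs_le.1 (hab.trans hs2.le)
      rw [abs_le]; constructor <;> linarith
    rw [e1, abs_mul, abs_of_pos ha]
    have e2 : |(tailScale F (T n) / a (T n)) *
        (RegularTail.excess F (T n) (X n) - boxCox γ (X n))| ≤
        2 * (K * (2 * (C₂ * α)) * X n ^ γ * w) := by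
      rw [abs_mul]
      exact mul_le_mul hR hexc (abs_nonneg _) two_pos.le
    have e3 : |(tailScale F (T n) / a (T n) - 1) * boxCox γ (X n)| ≤
        C₁ * α * (K₂ * X n ^ γ * w) := by
      rw [abs_mul, abs_of_nonneg hbx0]
      exact mul_le_mul hscale hbx hbx0 (by positivity)
    have e4 : (2 * (K * (2 * C₂)) + C₁ * K₂) * (α * w * X n ^ γ) ≤ C * (α * w * X n ^ γ) := by
      refine mul_le_mul_of_nonneg_right ?_ (by positivity)
      have : 0 ≤ 3 * C₁ + 2 * (C₂ * K₁) + 8 * C₂ := by positivity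
      simp only [C]; linarith
    calc a (T n) * |_| ≤ a (T n) * (C * (α * w * X n ^ γ)) := by
          refine mul_le_mul_of_nonneg_left ?_ ha.le
          refine (abs_add_le _ _).trans ?_
          linarith
      _ = _ := by ring
  · have := hr.abs_logDev_le_rpow (hr.le_mul ht hX) hv (κ := C₂ * α) (by positivity)
      (fun u hu => hA.2 u hu.1)
    refine this.trans (mul_le_mul_of_nonneg_right ?_ (by positivity))
    have : 0 ≤ ((3 * C₁ + 2 * (C₂ * K₁)) + (2 * (K * (2 * C₂)) + C₁ * K₂)) * α := by positivity
    simp only [C]; linarith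

end SecondOrderCondition

/-! ### Effect of estimation errors on quantile, scale and tail probability. -/

theorem boxCox_neg (γ : ℝ) {x : ℝ} (hx : 0 < x) : boxCox (-γ) x = -boxCox γ (1 / x) := by
  unfold boxCox
  rcases eq_or_ne γ 0 with rfl | h
  · simp
  · rw [if_neg (neg_ne_zero.2 h), if_neg h, Real.div_rpow zero_le_one hx.le, Real.one_rpow,
      Real.rpow_neg hx.le]
    field_simp

/-- On [1, 2] the derivative v^(γ-1) is at least 2^(-(G+1)), uniformly over |γ| ≤ G; the shape here
is estimated, so uniformity matters. -/
theorem mul_le_boxCox_one_add {γ G z : ℝ} (hγ : |γ| ≤ G) (hz0 : 0 ≤ z) (hz1 : z ≤ 1) :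
    (2 : ℝ) ^ (-(G + 1)) * z ≤ boxCox γ (1 + z) := by
  have h := sub_le_sub_of_deriv_le (f := fun v => (2 : ℝ) ^ (-(G + 1)) * v)
    (f' := fun _ => (2 : ℝ) ^ (-(G + 1))) (show (1 : ℝ) ≤ 1 + z by linarith)
    (fun v _ => by simpa using (hasDerivAt_id v).const_mul ((2 : ℝ) ^ (-(G + 1))))
    (fun v hv => hasDerivAt_boxCox γ (one_pos.trans_le hv.1)) fun v hv => by
      have hv0 : 0 < v := one_pos.trans_le hv.1
      have hG : 0 ≤ G := (abs_nonneg γ).trans hγ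
      calc (2 : ℝ) ^ (-(G + 1)) ≤ v ^ (-(G + 1)) :=
            Real.rpow_le_rpow_of_nonpos hv0 (by linarith [hv.2]) (by linarith)
        _ ≤ v ^ (γ - 1) := Real.rpow_le_rpow_of_exponent_le hv.1 (by linarith [(abs_le.1 hγ).1])
  simp only [boxCox_one, sub_zero] at h
  linarith

/-- Relative error of the generalized Pareto tail probability at a perturbed quantile. -/
theorem abs_one_sub_gpCdf_mul_sub_one_le {G g σ X d : ℝ} (hg : |g| ≤ G) (hσ : 0 < σ) (hX : 1 ≤ X)
    (hd : |d| ≤ (2 : ℝ) ^ (-(G + 1))) (hGd : G * |d| < 1) :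
    |(1 - gpCdf g σ (σ * (boxCox g X + X ^ g * d))) * X - 1| ≤ |d| / (2 : ℝ) ^ (-(G + 1)) := by
  have hX0 : 0 < X := by linarith
  have hgd : |g * d| < 1 := by
    rw [abs_mul]
    exact (mul_le_mul_of_nonneg_right hg (abs_nonneg d)).trans_lt hGd
  -- With d the Box-Cox function of r, the cocycle identity turns the point into the one of
  -- parameter X r, whose tail probability is 1/(Xr) when Xr > 1. The relative error is then 1/r -
  -- 1.
  obtain ⟨r, hr0, hr⟩ := exists_pos_boxCox_eq (γ := g) (w := d) (by linarith [(abs_lt.1 hgd).1])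
  set c := (2 : ℝ) ^ (-(G + 1)) with hc
  have hc0 : 0 < c := by positivity
  set z := |d| / c with hz
  have hz0 : 0 ≤ z := by positivity
  have hz1 : z ≤ 1 := by rw [hz, div_le_one hc0]; exact hd
  have hcz : c * z = |d| := by rw [hz]; field_simp
  have hup : r ≤ 1 + z := by
    by_contra! hlt
    have h1 := strictMonoOn_boxCox g (mem_Ioi.2 (by linarith)) (mem_Ioi.2 hr0) hlt
    have h2 := mul_le_boxCox_one_add hg hz0 hz1
    rw [hr] at h1
    linarith [le_abs_self d]
  -- The same argument for shape -g, under which 1/r corresponds to -d.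
  have hlo : 1 / r ≤ 1 + z := by
    by_contra! hlt
    have h1 := strictMonoOn_boxCox (-g) (mem_Ioi.2 (by linarith)) (mem_Ioi.2 (one_div_pos.2 hr0)) hlt
    have h2 := mul_le_boxCox_one_add (γ := -g) (G := G) (by rwa [abs_neg]) hz0 hz1
    rw [boxCox_neg g (x := 1 / r) (by positivity), one_div_one_div, hr] at h1
    linarith [neg_le_abs d]
  have hlo2 : 1 - z ≤ 1 / r := by
    have : 1 / (1 + z) ≤ 1 / r := one_div_le_one_div_of_le hr0 hup
    have : 1 - z ≤ 1 / (1 + z) := by rw [le_div_iff₀ (by linarith)]; nlinarith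
    linarith
  rw [← hr, ← boxCox_mul g hX0 hr0]
  -- If Xr ≤ 1 the point is at or below the threshold, where the tail probability is 1; the ratio is
  -- then X itself, and 1 ≤ X ≤ 1/r ≤ 1 + z.
  rcases lt_or_ge 1 (X * r) with h | h
  · rw [one_sub_gpCdf_boxCox hσ h, show 1 / (X * r) * X = 1 / r by field_simp, abs_le]
    constructor <;> linarith
  · have h1 : boxCox g (X * r) ≤ 0 := by
      have := (strictMonoOn_boxCox g).monotoneOn (mem_Ioi.2 (mul_pos hX0 hr0)) (mem_Ioi.2 one_pos) h
      rwa [boxCox_one] at this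
    rw [gpCdf, if_pos (mul_nonpos_of_nonneg_of_nonpos hσ.le h1), sub_zero, one_mul,
      abs_of_nonneg (by linarith)]
    have : X ≤ 1 / r := by rw [le_div_iff₀ hr0]; exact h
    linarith

/-- Errors of the estimated extreme quantile and scale. -/
theorem exists_estimated_extreme_bounds (γ : ℝ) : ∃ C : ℝ, 1 ≤ C ∧
    ∀ q X a u t σ g : ℝ, 0 ≤ q → 1 ≤ X → 0 < a → |u - t| ≤ q * a → |σ / a - 1| ≤ q →
      |g - γ| ≤ q → C * (q * wBar γ X) ≤ 1 →
      |u + σ * boxCox g X - (t + a * boxCox γ X)| ≤ C * (q * wBar γ X) * (a * X ^ γ) ∧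
      |σ * X ^ g / (a * X ^ γ) - 1| ≤ C * (q * wBar γ X) := by
  obtain ⟨K, hK, hK'⟩ := exists_abs_le_wBar γ
  obtain ⟨K₁, hK₁, hlog⟩ := exists_log_le_wBar γ
  obtain ⟨K₂, hK₂, hbox⟩ := exists_boxCox_le_wBar γ
  refine ⟨4 + 4 * K₁ + K₂ + 4 * K, by linarith, ?_⟩
  intro q X a u t σ g hq hX ha hu hσ hg hsmall
  set w := wBar γ X
  have hw : 1 ≤ w := one_le_wBar _ _
  have hX0 : 0 < X := by linarith
  have hXg : 0 < X ^ γ := Real.rpow_pos_of_pos hX0 γ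
  have hqw : q ≤ q * w := le_mul_of_one_le_right hq hw
  have hqw0 : 0 ≤ q * w := hq.trans hqw
  have hlog0 := Real.log_nonneg hX
  have hql : q * Real.log X ≤ K₁ * (q * w) := by
    calc q * Real.log X ≤ q * (K₁ * w) := mul_le_mul_of_nonneg_left (hlog X hX) hq
      _ = _ := by ring
  have p1 : 0 ≤ K₁ * (q * w) := by positivity
  have p2 : 0 ≤ K₂ * (q * w) := by positivity
  have p3 : 0 ≤ K * (q * w) := by positivity
  have hql1 : q * Real.log X ≤ 1 := by linarith
  have hq1 : q ≤ 1 := by linarith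
  have hσ2 : |σ / a| ≤ 2 := by
    have := abs_le.1 hσ
    rw [abs_le]; constructor <;> linarith
  constructor
  · have hdiff : |boxCox g X - boxCox γ X| ≤ K * (2 * q) * X ^ γ * w := by
      refine hK' X (2 * q) (fun v => boxCox g v - boxCox γ v)
        (fun v => v ^ (g - 1) - v ^ (γ - 1)) hX (by positivity)
        (fun v hv => (hasDerivAt_boxCox g (one_pos.trans_le hv.1)).sub
          (hasDerivAt_boxCox γ (one_pos.trans_le hv.1))) (by simp) fun v hv => ?_
      have hv0 : 0 < v := one_pos.trans_le hv.1
      have hl0 := Real.log_nonneg hv.1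
      have h1 : |(g - γ) * Real.log v| ≤ q * Real.log v := by
        rw [abs_mul, abs_of_nonneg hl0]
        exact mul_le_mul_of_nonneg_right hg hl0
      have h2 : q * Real.log v ≤ 1 :=
        (mul_le_mul_of_nonneg_left (Real.log_le_log hv0 hv.2) hq).trans hql1
      have h3 := Real.abs_exp_sub_one_le (h1.trans h2)
      have e : v ^ (g - 1) - v ^ (γ - 1) =
          v ^ (γ - 1) * (Real.exp ((g - γ) * Real.log v) - 1) := by
        rw [mul_comm (g - γ), ← Real.rpow_def_of_pos hv0, mul_sub, mul_one, ← Real.rpow_add hv0]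
        ring_nf
      have hp : 0 < v ^ (γ - 1) := Real.rpow_pos_of_pos hv0 _
      rw [e, abs_mul, abs_of_pos hp]
      calc v ^ (γ - 1) * _ ≤ v ^ (γ - 1) * (2 * (q * Real.log v)) :=
            mul_le_mul_of_nonneg_left (by linarith) hp.le
        _ = _ := by ring
    have hone : 1 ≤ X ^ γ * w := by
      have := mul_le_mul_of_nonneg_left (rpow_neg_le_wBar γ hX) hXg.le
      rwa [← Real.rpow_add hX0, add_neg_cancel, Real.rpow_zero] at this
    have e : u + σ * boxCox g X - (t + a * boxCox γ X) =
        (u - t) + a * ((σ / a - 1) * boxCox γ X) + a * (σ / a * (boxCox g X - boxCox γ X)) := by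
      field_simp; ring
    have a1 : |u - t| ≤ q * (X ^ γ * w) * a :=
      hu.trans (mul_le_mul_of_nonneg_right (le_mul_of_one_le_right hq hone) ha.le)
    have a2 : |a * ((σ / a - 1) * boxCox γ X)| ≤ a * (q * (K₂ * X ^ γ * w)) := by
      rw [abs_mul, abs_mul, abs_of_pos ha, abs_of_nonneg (boxCox_nonneg γ hX)]
      exact mul_le_mul_of_nonneg_left
        (mul_le_mul hσ (hbox X hX) (boxCox_nonneg γ hX) hq) ha.le
    have a3 : |a * (σ / a * (boxCox g X - boxCox γ X))| ≤ a * (2 * (K * (2 * q) * X ^ γ * w)) := by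
      rw [abs_mul, abs_mul, abs_of_pos ha]
      exact mul_le_mul_of_nonneg_left (mul_le_mul hσ2 hdiff (abs_nonneg _) two_pos.le) ha.le
    rw [e]
    have hP : 0 ≤ (3 + 4 * K₁) * (q * w * (a * X ^ γ)) := by positivity
    calc _ ≤ |u - t| + |a * ((σ / a - 1) * boxCox γ X)| +
          |a * (σ / a * (boxCox g X - boxCox γ X))| := abs_add_three _ _ _
      _ ≤ (1 + K₂ + 4 * K) * (q * w * (a * X ^ γ)) := by linarith
      _ ≤ _ := by linarith
  · have h1 : |(g - γ) * Real.log X| ≤ q * Real.log X := by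
      rw [abs_mul, abs_of_nonneg hlog0]
      exact mul_le_mul_of_nonneg_right hg hlog0
    have h3 := Real.abs_exp_sub_one_le (h1.trans hql1)
    have e : σ * X ^ g / (a * X ^ γ) - 1 =
        σ / a * (Real.exp ((g - γ) * Real.log X) - 1) + (σ / a - 1) := by
      rw [mul_comm (g - γ), ← Real.rpow_def_of_pos hX0, Real.rpow_sub hX0]
      field_simp; ring
    rw [e]
    refine (abs_add_le _ _).trans ?_
    rw [abs_mul]
    have a1 : |σ / a| * |Real.exp ((g - γ) * Real.log X) - 1| ≤ 2 * |Real.exp ((g - γ) * Real.log X) - 1| :=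
      mul_le_mul_of_nonneg_right hσ2 (abs_nonneg _)
    have a2 := mul_nonneg hK₂.le hqw0
    have h4 : |Real.exp ((g - γ) * Real.log X) - 1| ≤ 2 * (q * Real.log X) := by linarith
    linarith

/-- Matching of two location-scale pairs. -/
theorem affine_match {aE bE uE uH tE sE R dm p : ℝ} (haE : 0 < aE) (hp : p ≤ 1 / 4)
    (hb : |bE / aE - 1| ≤ p) (ht : |tE - uE| ≤ p * aE) (hu : |uH - uE| ≤ p * aE)
    (hs : |sE / aE - 1| ≤ p) (hR : |R - 1| ≤ p) (hRu : |(R - 1) * uE| ≤ p * aE)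
    (hdm : |dm| ≤ p * aE) :
    |(uH - dm - R * tE) / (R * bE)| ≤ 10 * p ∧ |sE / (R * bE) - 1| ≤ 10 * p := by
  have hp0 : 0 ≤ p := (abs_nonneg _).trans hb
  have hb' : |bE - aE| ≤ p * aE := by
    have : bE - aE = (bE / aE - 1) * aE := by field_simp
    rw [this, abs_mul, abs_of_pos haE]
    exact mul_le_mul_of_nonneg_right hb haE.le
  have hs' : |sE - aE| ≤ p * aE := by
    have : sE - aE = (sE / aE - 1) * aE := by field_simp
    rw [this, abs_mul, abs_of_pos haE]
    exact mul_le_mul_of_nonneg_right hs haE.le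
  have hpa : p * aE ≤ 1 / 4 * aE := mul_le_mul_of_nonneg_right hp haE.le
  have hpa0 : 0 ≤ p * aE := by positivity
  have hb1 : 3 / 4 * aE ≤ bE := by linarith [(abs_le.1 hb').1]
  have hb2 : bE ≤ 5 / 4 * aE := by linarith [(abs_le.1 hb').2]
  have hR1 : 3 / 4 ≤ R := by linarith [(abs_le.1 hR).1]
  -- The common denominator. The numerators below are at most 5 p aE and 4 p aE, and 10 · 9/16
  -- exceeds 5.
  have hRb : 9 / 16 * aE ≤ R * bE := by
    have := mul_le_mul hR1 hb1 (by positivity) (by linarith)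
    linarith
  have hRb0 : 0 < R * bE := by linarith
  have hbE0 : 0 ≤ bE := by linarith
  constructor
  · rw [abs_div, abs_of_pos hRb0, div_le_iff₀ hRb0]
    have e : uH - dm - R * tE = (uH - uE) + (-(tE - uE) + (-((R - 1) * uE) +
        (-((R - 1) * (tE - uE)) + -dm))) := by ring
    have h1 : |(R - 1) * (tE - uE)| ≤ 1 / 4 * (p * aE) := by
      rw [abs_mul]
      exact mul_le_mul (hR.trans hp) ht (abs_nonneg _) (by norm_num)
    have h2 : |uH - dm - R * tE| ≤ 5 * (p * aE) := by
      rw [e]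
      refine (abs_add_le _ _).trans ?_
      have g1 := abs_add_le (-(tE - uE)) (-((R - 1) * uE) + (-((R - 1) * (tE - uE)) + -dm))
      have g2 := abs_add_le (-((R - 1) * uE)) (-((R - 1) * (tE - uE)) + -dm)
      have g3 := abs_add_le (-((R - 1) * (tE - uE))) (-dm)
      simp only [abs_neg] at g1 g2 g3
      linarith
    have h3 := mul_le_mul_of_nonneg_left hRb (show 0 ≤ 10 * p by positivity)
    linarith
  · have e : sE / (R * bE) - 1 = ((sE - aE) + (-((R - 1) * bE) + -(bE - aE))) / (R * bE) := by
      have := hRb0.ne'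
      rw [div_sub_one this]; congr 1; ring
    rw [e, abs_div, abs_of_pos hRb0, div_le_iff₀ hRb0]
    have h1 : |(R - 1) * bE| ≤ 5 / 4 * (p * aE) := by
      rw [abs_mul, abs_of_nonneg hbE0]
      have := mul_le_mul hR hb2 hbE0 hp0
      linarith
    have h2 : |(sE - aE) + (-((R - 1) * bE) + -(bE - aE))| ≤ 4 * (p * aE) := by
      refine (abs_add_le _ _).trans ?_
      have g1 := abs_add_le (-((R - 1) * bE)) (-(bE - aE))
      simp only [abs_neg] at g1
      linarith
    have h3 := mul_le_mul_of_nonneg_left hRb (show 0 ≤ 10 * p by positivity)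
    linarith

theorem eventually_const_mul_le_of_tendsto_zero {f : ℕ → ℝ} (hf : Tendsto f atTop (𝓝 0)) (D : ℝ)
    {c : ℝ} (hc : 0 < c) : ∀ᶠ n in atTop, D * f n ≤ c := by
  have := hf.const_mul D
  rw [mul_zero] at this
  exact this.eventually_le_const hc

/-! ### Deterministic accuracy where the estimators are accurate. -/

/-- The levels of a forecasting problem: intermediate level `T`, level ratio `s`, rate `e`. -/
structure LevelRegime (ν : Measure ℝ) (γ ρ τ₀ t₀ : ℝ) (a : ℝ → ℝ) (T s e r : ℕ → ℝ) : Prop where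
  second_order : SecondOrderCondition (cdf ν) γ ρ a
  regular : RegularTail (cdf ν) γ t₀
  mono : ρ = 0 → τ₀ = 0 → ∃ t₁, AntitoneOn (fun t => |rateA (cdf ν) γ t|) (Set.Ici t₁)
  tendsto_level : Tendsto T atTop atTop
  ratio_mem : ∀ᶠ n in atTop, 0 < s n ∧ s n ≤ 1
  tendsto_ratio : Tendsto s atTop (𝓝 τ₀)
  rate_le : ∀ᶠ n in atTop, |rateA (cdf ν) γ (T n)| ≤ e n
  tendsto_rate : Tendsto (fun n => e n * wBar γ (1 / s n)) atTop (𝓝 0)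
  one_le_rate : ∀ᶠ n in atTop, 0 ≤ r n ∧ 1 ≤ r n * e n

namespace LevelRegime

variable {ν : Measure ℝ} {γ ρ τ₀ t₀ : ℝ} {a : ℝ → ℝ} {T s e r : ℕ → ℝ}

/-- All deterministic errors on the event where the estimators are accurate. -/
theorem exists_match_bounds (h : LevelRegime ν γ ρ τ₀ t₀ a T s e r) {M : ℝ} (hM : 0 < M) :
    ∃ K : ℝ, 0 < K ∧ ∀ᶠ n in atTop, 0 < e n ∧ 0 < a (T n) ∧ t₀ ≤ T n * (1 / s n) ∧
      |tailScale (cdf ν) (T n * (1 / s n)) / (a (T n) * (1 / s n) ^ γ) - 1| ≤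
        K * (e n * wBar γ (1 / s n)) ∧
      |tailQuantile (cdf ν) (T n * (1 / s n)) -
        (tailQuantile (cdf ν) (T n) + a (T n) * boxCox γ (1 / s n))| ≤
        K * (e n * wBar γ (1 / s n)) * (a (T n) * (1 / s n) ^ γ) ∧
      (∀ v, 1 ≤ v → |RegularTail.logDev (cdf ν) γ (T n * (1 / s n)) v| ≤
        K * (e n * wBar γ (1 / s n)) * v ^ (1 / 8 : ℝ)) ∧
      ∀ g σ u : ℝ, |g - γ| ≤ M * e n → |σ / a (T n) - 1| ≤ M * e n →
        |r n * (u - tailQuantile (cdf ν) (T n))| ≤ M * a (T n) →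
        0 < σ ∧ |g - γ| ≤ K * (e n * wBar γ (1 / s n)) ∧
        |u + σ * boxCox g (1 / s n) -
          (tailQuantile (cdf ν) (T n) + a (T n) * boxCox γ (1 / s n))| ≤
          K * (e n * wBar γ (1 / s n)) * (a (T n) * (1 / s n) ^ γ) ∧
        |σ * (1 / s n) ^ g / (a (T n) * (1 / s n) ^ γ) - 1| ≤
          K * (e n * wBar γ (1 / s n)) := by
  have hX : ∀ᶠ n in atTop, 1 ≤ 1 / s n := by
    filter_upwards [h.ratio_mem] with n hn
    rw [le_div_iff₀ hn.1]; linarith [hn.2]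
  have hAw : Tendsto (fun n => |rateA (cdf ν) γ (T n)| * wBar γ (1 / s n)) atTop (𝓝 0) := by
    refine squeeze_zero' (Eventually.of_forall fun n => mul_nonneg (abs_nonneg _)
      (zero_le_one.trans (one_le_wBar _ _))) ?_ h.tendsto_rate
    filter_upwards [h.rate_le] with n hn
    exact mul_le_mul_of_nonneg_right hn (zero_le_one.trans (one_le_wBar _ _))
  obtain ⟨C₁, hC₁, h1⟩ := h.second_order.exists_extreme_bounds h.regular h.mono h.tendsto_level hX
    (by simpa using h.tendsto_ratio) hAw
  obtain ⟨C₂, hC₂, h2⟩ := exists_estimated_extreme_bounds γ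
  refine ⟨C₁ + C₂ * M + M, by positivity, ?_⟩
  have hq := eventually_const_mul_le_of_tendsto_zero h.tendsto_rate (C₂ * M) (c := 1 / 2)
    (by norm_num)
  filter_upwards [h1, hX, h.rate_le, h.one_le_rate, hq,
    h.tendsto_level.eventually h.second_order.a_pos, h.tendsto_level.eventually_ge_atTop t₀]
    with n h1 hX hrate hr hq ha ht
  have he : 0 < e n := by
    by_contra! hcon
    have := mul_nonpos_of_nonneg_of_nonpos hr.1 hcon
    linarith [hr.2]
  set w := wBar γ (1 / s n)
  have hw : 1 ≤ w := one_le_wBar _ _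
  have hw0 : 0 < w := by linarith
  have hX0 : 0 < 1 / s n := by linarith
  have hXg : 0 < (1 / s n) ^ γ := Real.rpow_pos_of_pos hX0 γ
  have hew : e n ≤ e n * w := le_mul_of_one_le_right he.le hw
  have hew0 : 0 < e n * w := by positivity
  have hαw : C₁ * (|rateA (cdf ν) γ (T n)| * w) ≤ (C₁ + C₂ * M + M) * (e n * w) :=
    mul_le_mul (by linarith [show 0 ≤ C₂ * M + M by positivity])
      (mul_le_mul_of_nonneg_right hrate hw0.le) (by positivity) (by positivity)
  have hα : C₁ * |rateA (cdf ν) γ (T n)| ≤ (C₁ + C₂ * M + M) * (e n * w) :=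
    mul_le_mul (by linarith [show 0 ≤ C₂ * M + M by positivity])
      (hrate.trans hew) (by positivity) (by positivity)
  refine ⟨he, ha, h.regular.le_mul ht hX, h1.1.trans hαw, h1.2.1.trans ?_, fun v hv =>
    (h1.2.2 v hv).trans ?_, ?_⟩
  · exact mul_le_mul_of_nonneg_right hαw (by positivity)
  · exact mul_le_mul_of_nonneg_right hα (by positivity)
  intro g σ u hg hσ hu
  have hMe : M * e n ≤ 1 / 2 := by
    have a1 : M * e n ≤ M * (e n * w) := mul_le_mul_of_nonneg_left hew hM.le
    have a2 : M * (e n * w) ≤ C₂ * (M * (e n * w)) := le_mul_of_one_le_left (by positivity) hC₂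
    linarith
  have hu' : |u - tailQuantile (cdf ν) (T n)| ≤ M * e n * a (T n) := by
    rw [abs_mul, abs_of_nonneg hr.1] at hu
    have a1 : |u - tailQuantile (cdf ν) (T n)| ≤
        r n * e n * |u - tailQuantile (cdf ν) (T n)| := le_mul_of_one_le_left (abs_nonneg _) hr.2
    have a2 := mul_le_mul_of_nonneg_left hu he.le
    linarith
  obtain ⟨h3, h4⟩ := h2 (M * e n) (1 / s n) (a (T n)) u (tailQuantile (cdf ν) (T n)) σ g
    (by positivity) hX ha hu' hσ hg (by linarith)
  have hK : C₂ * (M * e n * w) ≤ (C₁ + C₂ * M + M) * (e n * w) := by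
    have : 0 ≤ (C₁ + M) * (e n * w) := by positivity
    linarith
  refine ⟨?_, ?_, h3.trans ?_, h4.trans hK⟩
  · have : 0 < σ / a (T n) := by linarith [(abs_le.1 hσ).1]
    exact (div_pos_iff_of_pos_right ha).1 this
  · have : 0 ≤ (C₁ + C₂ * M) * (e n * w) := by positivity
    have a1 : M * e n ≤ M * (e n * w) := mul_le_mul_of_nonneg_left hew hM.le
    linarith
  · exact mul_le_mul_of_nonneg_right hK (by positivity)

/-- Total variation accuracy of the predictive density on the event where the estimators are
accurate. -/
theorem exists_integral_abs_sub_le (h : LevelRegime ν γ ρ τ₀ t₀ a T s e r) (hγ : -1 / 2 < γ)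
    {m l δ : ℕ → ℝ} (hm : ∀ n, 0 ≤ m n) (hl : ∀ n, 0 ≤ l n)
    (hδ : ∀ n, δ n = l n * (|tailQuantile (cdf ν) (T n) + a (T n) * boxCox γ (1 / s n)| /
      (a (T n) * (1 / s n) ^ γ)) + m n / (a (T n) * (1 / s n) ^ γ))
    (hδ0 : Tendsto δ atTop (𝓝 0)) {M : ℝ} (hM : 0 < M) :
    ∃ K : ℝ, 0 < K ∧ ∀ᶠ n in atTop, t₀ ≤ T n * (1 / s n) ∧ ∀ g σ u μ' x' μ x : ℝ, 0 < x →
      |g - γ| ≤ M * e n → |σ / a (T n) - 1| ≤ M * e n →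
      |r n * (u - tailQuantile (cdf ν) (T n))| ≤ M * a (T n) →
      |(μ - μ') / x'| ≤ M * m n → |x / x' - 1| ≤ M * l n →
      0 < σ ∧ 0 < x' ∧ ∃ Ψ' f : ℝ → ℝ,
        IsParetoImage (fun v => μ + x * tailQuantile (cdf ν) (T n * (1 / s n)) +
          x * tailScale (cdf ν) (T n * (1 / s n)) *
            RegularTail.excess (cdf ν) (T n * (1 / s n)) v) Ψ' f ∧
        ∫ y, |f y - gpPredDensity g σ u (s n) ((y - μ') / x') / x'| ≤
          K * (e n * wBar γ (1 / s n) + δ n) := by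
  obtain ⟨K, hK, hb⟩ := h.exists_match_bounds hM
  obtain ⟨K₂, hK₂, η₀, hη₀, hcore⟩ := _root_.exists_integral_abs_sub_le hγ
  obtain ⟨G, hG, hGU⟩ := h.regular.exists_scale_le_mul_abs_quantile h.second_order.rate_zero
  set K' := K + M + 4 * G * M with hK'
  have hK'0 : 0 < K' := by positivity
  have hTX : Tendsto (fun n => T n * (1 / s n)) atTop atTop := by
    refine tendsto_atTop_mono' atTop ?_ h.tendsto_level
    filter_upwards [h.ratio_mem, h.tendsto_level.eventually_ge_atTop 0] with n hn hT
    refine le_mul_of_one_le_right hT ?_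
    rw [le_div_iff₀ hn.1]; linarith [hn.2]
  have hsum : Tendsto (fun n => e n * wBar γ (1 / s n) + δ n) atTop (𝓝 0) := by
    simpa using h.tendsto_rate.add hδ0
  refine ⟨K₂ * (10 * K'), by positivity, ?_⟩
  filter_upwards [hb, hTX.eventually hGU, h.ratio_mem,
    eventually_const_mul_le_of_tendsto_zero hsum (10 * K') hη₀,
    eventually_const_mul_le_of_tendsto_zero hsum K' (c := 1 / 4) (by norm_num),
    eventually_const_mul_le_of_tendsto_zero h.tendsto_rate K (c := 1 / (2 * G)) (by positivity)]
    with n hb hGU hs hsm1 hsm2 hsm3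
  obtain ⟨he, ha, ht, hb1, hb2, hb3, hb4⟩ := hb
  refine ⟨ht, fun g σ u μ' x' μ x hx hg hσ hu hμ hξ => ?_⟩
  obtain ⟨hσ0, hg', hu', hs'⟩ := hb4 g σ u hg hσ hu
  set X := 1 / s n with hXdef
  have hX0 : 0 < X := one_div_pos.2 hs.1
  set w := wBar γ X
  have hw : 1 ≤ w := one_le_wBar _ _
  set tE := tailQuantile (cdf ν) (T n * X)
  set bE := tailScale (cdf ν) (T n * X)
  set uE := tailQuantile (cdf ν) (T n) + a (T n) * boxCox γ X
  set aE := a (T n) * X ^ γ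
  have haE : 0 < aE := mul_pos ha (Real.rpow_pos_of_pos hX0 γ)
  have hew : 0 < e n * w := by positivity
  have hd1 : 0 ≤ l n * (|uE| / aE) := mul_nonneg (hl n) (by positivity)
  have hd2 : 0 ≤ m n / aE := div_nonneg (hm n) haE.le
  have hδn : δ n = l n * (|uE| / aE) + m n / aE := hδ n
  have hδ0 : 0 ≤ δ n := by rw [hδn]; linarith
  set p := K' * (e n * w + δ n) with hp
  have hp0 : 0 < p := by positivity
  have hKp : K * (e n * w) ≤ p := by
    have a1 : 0 ≤ (M + 4 * G * M) * (e n * w) := by positivity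
    have a2 : 0 ≤ K' * δ n := by positivity
    rw [hp, mul_add, hK', add_assoc, add_mul]
    linarith
  have hMp : M * δ n ≤ p := by
    have a1 : 0 ≤ (K + 4 * G * M) * δ n := by positivity
    have a2 : 0 ≤ K' * (e n * w) := by positivity
    rw [hp, mul_add]
    have : K' * δ n = M * δ n + (K + 4 * G * M) * δ n := by rw [hK']; ring
    linarith
  have hKe := hKp.trans hsm2
  have hbE : 3 / 4 * aE ≤ bE := by
    have := (abs_le.1 (hb1.trans hKe)).1
    have : 3 / 4 ≤ bE / aE := by linarith
    rwa [le_div_iff₀ haE] at this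
  have hbE0 : 0 < bE := by linarith
  -- The scale at the extreme level is at most G times the quantile there. As these are close to aE
  -- and uE, |uE|/aE is at least 1/(4G), so δ dominates the relative scale error l.
  have hll : l n ≤ 4 * G * δ n := by
    have a1 : 3 / 4 * aE ≤ G * |tE| := hbE.trans hGU
    have a2 : |tE| ≤ |uE| + 1 / (2 * G) * aE := by
      have := hb2.trans (mul_le_mul_of_nonneg_right hsm3 haE.le)
      have h3 := abs_add_le uE (tE - uE)
      rw [add_sub_cancel] at h3
      linarith
    have a3 : 1 / 4 * aE ≤ G * |uE| := by
      have := mul_le_mul_of_nonneg_left a2 hG.le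
      have e1 : G * (|uE| + 1 / (2 * G) * aE) = G * |uE| + 1 / 2 * aE := by field_simp
      linarith
    have a4 : 1 ≤ 4 * G * (|uE| / aE) := by
      rw [← mul_div_assoc, le_div_iff₀ haE]; linarith
    have a5 := mul_le_mul_of_nonneg_left a4 (hl n)
    have a6 : l n * (|uE| / aE) ≤ δ n := by rw [hδn]; linarith
    have a7 := mul_le_mul_of_nonneg_left a6 (show 0 ≤ 4 * G by positivity)
    linarith
  have hR : |x / x' - 1| ≤ p := by
    refine hξ.trans ?_
    have a1 := mul_le_mul_of_nonneg_left hll hM.le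
    have a2 : 0 ≤ K' * (e n * w) := by positivity
    have a3 : 0 ≤ (K + M) * δ n := by positivity
    have : K' * δ n = 4 * G * M * δ n + (K + M) * δ n := by rw [hK']; ring
    rw [hp, mul_add]
    linarith
  have hx' : 0 < x' := by
    have : 0 < x / x' := by linarith [(abs_le.1 (hR.trans hsm2)).1]
    exact (div_pos_iff_of_pos_left hx).1 this
  have hRu : |(x / x' - 1) * uE| ≤ p * aE := by
    rw [abs_mul]
    have a1 := mul_le_mul_of_nonneg_right hξ (abs_nonneg uE)
    have a2 : M * l n * |uE| = M * (l n * (|uE| / aE)) * aE := by field_simp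
    have a3 : M * (l n * (|uE| / aE)) ≤ M * δ n :=
      mul_le_mul_of_nonneg_left (by rw [hδn]; linarith) hM.le
    have a4 := mul_le_mul_of_nonneg_right (a3.trans hMp) haE.le
    linarith
  have hdm : |(μ - μ') / x'| ≤ p * aE := by
    have a2 : M * m n = M * (m n / aE) * aE := by field_simp
    have a3 : M * (m n / aE) ≤ M * δ n :=
      mul_le_mul_of_nonneg_left (by rw [hδn]; linarith) hM.le
    have a4 := mul_le_mul_of_nonneg_right (a3.trans hMp) haE.le
    linarith
  obtain ⟨hx₀, hc⟩ := affine_match haE hsm2 (hb1.trans hKp)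
    (hb2.trans (mul_le_mul_of_nonneg_right hKp haE.le))
    (hu'.trans (mul_le_mul_of_nonneg_right hKp haE.le)) (hs'.trans hKp) hR hRu hdm
  set x₀ := (u + σ * boxCox g X - (μ - μ') / x' - x / x' * tE) / (x / x' * bE)
  set c := σ * X ^ g / (x / x' * bE)
  set Ψ : ℝ → ℝ := fun v => μ + x * tE + x * bE * RegularTail.excess (cdf ν) (T n * X) v
  set Ψ' : ℝ → ℝ := fun v => x * bE * (v ^ (γ - 1) *
    Real.exp (RegularTail.logDev (cdf ν) γ (T n * X) v))
  have hf : IsParetoImage Ψ Ψ' (paretoDensity Ψ Ψ') := by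
    refine isParetoImage_paretoDensity (fun v hv => ?_) (fun v hv => ?_)
    · exact ((h.regular.hasDerivAt_excess ht hv.le).const_mul _).const_add _
    · have : 0 < v := by linarith
      have := Real.exp_pos (RegularTail.logDev (cdf ν) γ (T n * X) v)
      positivity
  refine ⟨hσ0, hx', Ψ', paretoDensity Ψ Ψ', hf, ?_⟩
  have hgp := isParetoImage_gpPredDensity (γ := g) (u := u) (m := μ') hσ0 hs.1 hx'
  -- The predictive map is rewritten in the location and scale of the true peaks, with residual
  -- offset x₀ and scale ratio c.
  have e1 : (fun v => μ' + x' * (u + σ * boxCox g (1 / s n)) +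
      x' * σ * (1 / s n) ^ g * boxCox g v) =
      fun v => (μ + x * tE) + x * bE * (x₀ + c * boxCox g v) := by
    funext v
    simp only [x₀, c, ← hXdef]
    field_simp; ring
  have e2 : (fun v : ℝ => x' * σ * (1 / s n) ^ g * v ^ (g - 1)) =
      fun v => x * bE * (c * v ^ (g - 1)) := by
    funext v
    simp only [c, ← hXdef]
    field_simp
  rw [e1, e2] at hgp
  have hfin := hcore (10 * p) (μ + x * tE) (x * bE) x₀ c g (RegularTail.excess (cdf ν) (T n * X))
    (RegularTail.logDev (cdf ν) γ (T n * X)) (paretoDensity Ψ Ψ') _ (by positivity)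
    (by rw [hp]; linarith) (by positivity) (by simp)
    (fun v hv => h.regular.hasDerivAt_excess ht hv) (fun v hv => (hb3 v hv).trans ?_)
    (by linarith) hx₀ hc hf hgp
  · refine hfin.trans (le_of_eq ?_)
    rw [hp]; ring
  · exact mul_le_mul_of_nonneg_right (by linarith) (by have : 0 < v := by linarith
                                                       positivity)

/-- Relative accuracy of the predictive tail probability at the true extreme quantile. -/
theorem exists_abs_tail_ratio_le (h : LevelRegime ν γ ρ τ₀ t₀ a T s e r)
    {m l : ℕ → ℝ} (hl0 : Tendsto l atTop (𝓝 0)) {B : ℝ} (hB : 0 < B)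
    (hmB : ∀ᶠ n in atTop, r n * m n ≤ B * (a (T n) * (1 / s n) ^ γ * wBar γ (1 / s n)))
    (hlB : ∀ᶠ n in atTop, r n * l n * |tailQuantile (cdf ν) (T n * (1 / s n))| ≤
      B * (a (T n) * (1 / s n) ^ γ * wBar γ (1 / s n)))
    {M : ℝ} (hM : 0 < M) :
    ∃ K : ℝ, 0 < K ∧ ∀ᶠ n in atTop, ∀ g σ u μ' x' μ x : ℝ, 0 < x →
      |g - γ| ≤ M * e n → |σ / a (T n) - 1| ≤ M * e n →
      |r n * (u - tailQuantile (cdf ν) (T n))| ≤ M * a (T n) →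
      |(μ - μ') / x'| ≤ M * m n → |x / x' - 1| ≤ M * l n →
      |(1 - gpCdf g σ ((μ + x * tailQuantile (cdf ν) (T n * (1 / s n)) - μ') / x' - u)) / s n - 1|
        ≤ K * (e n * wBar γ (1 / s n)) := by
  obtain ⟨K, hK, hb⟩ := h.exists_match_bounds hM
  set G := |γ| + 1
  have hG : 0 < G := by positivity
  set c := (2 : ℝ) ^ (-(G + 1)) with hc
  have hc0 : 0 < c := by positivity
  set K' := 4 * K + 4 * M * B
  have hK' : 0 < K' := by positivity
  refine ⟨K' / c, by positivity, ?_⟩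
  filter_upwards [hb, h.ratio_mem, h.one_le_rate, hmB, hlB,
    eventually_const_mul_le_of_tendsto_zero hl0 M (c := 1 / 2) (by norm_num),
    eventually_const_mul_le_of_tendsto_zero h.tendsto_rate K (c := 1 / 4) (by norm_num),
    eventually_const_mul_le_of_tendsto_zero h.tendsto_rate K' hc0,
    eventually_const_mul_le_of_tendsto_zero h.tendsto_rate K' (c := 1 / (2 * G)) (by positivity)]
    with n hb hs hr hmB hlB hl hsm1 hsm2 hsm3
  obtain ⟨he, ha, ht, -, hb2, -, hb4⟩ := hb
  intro g σ u μ' x' μ x hx hg hσ hu hμ hξ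
  obtain ⟨hσ0, hg', hu', hs'⟩ := hb4 g σ u hg hσ hu
  set X := 1 / s n with hXdef
  have hX0 : 0 < X := one_div_pos.2 hs.1
  have hX1 : 1 ≤ X := by rw [hXdef, le_div_iff₀ hs.1]; linarith [hs.2]
  set w := wBar γ X
  have hw : 1 ≤ w := one_le_wBar _ _
  set tE := tailQuantile (cdf ν) (T n * X)
  set uE := tailQuantile (cdf ν) (T n) + a (T n) * boxCox γ X
  set aE := a (T n) * X ^ γ
  have haE : 0 < aE := mul_pos ha (Real.rpow_pos_of_pos hX0 γ)
  have hew : 0 < e n * w := by positivity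
  have hx' : 0 < x' := by
    have : 0 < x / x' := by linarith [(abs_le.1 (hξ.trans hl)).1]
    exact (div_pos_iff_of_pos_left hx).1 this
  have hXg : 0 < X ^ g := Real.rpow_pos_of_pos hX0 g
  have hsE : 3 / 4 * aE ≤ σ * X ^ g := by
    have := (abs_le.1 (hs'.trans hsm1)).1
    have : 3 / 4 ≤ σ * X ^ g / aE := by linarith
    rwa [le_div_iff₀ haE] at this
  have hsE0 : 0 < σ * X ^ g := by positivity
  -- Since r e ≥ 1, a bound at rate 1/r becomes one at rate e.
  have habs : ∀ y, 0 ≤ y → r n * y ≤ B * (aE * w) → y ≤ B * (e n * w) * aE := by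
    intro y hy hry
    have a1 : y ≤ r n * e n * y := le_mul_of_one_le_left hy hr.2
    have a2 := mul_le_mul_of_nonneg_left hry he.le
    linarith
  set z := (μ + x * tE - μ') / x'
  set uH := u + σ * boxCox g X
  have hz : z - uH = (tE - uE) - (uH - uE) + ((x / x' - 1) * tE + (μ - μ') / x') := by
    simp only [z]; field_simp; ring
  have hzb : |z - uH| ≤ (2 * K + 2 * M * B) * (e n * w) * aE := by
    have b1 : |(x / x' - 1) * tE| ≤ M * (B * (e n * w) * aE) := by
      rw [abs_mul]
      have hMl : 0 ≤ M * l n := (abs_nonneg _).trans hξ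
      have hl0 : 0 ≤ l n := (mul_nonneg_iff_of_pos_left hM).1 hMl
      have := mul_le_mul_of_nonneg_right hξ (abs_nonneg tE)
      have h2 := habs (l n * |tE|) (by positivity) (by rw [← mul_assoc]; exact hlB)
      have h3 := mul_le_mul_of_nonneg_left h2 hM.le
      linarith
    have b2 : |(μ - μ') / x'| ≤ M * (B * (e n * w) * aE) := by
      have hMm : 0 ≤ M * m n := (abs_nonneg _).trans hμ
      have h2 := habs (m n) ((mul_nonneg_iff_of_pos_left hM).1 hMm) hmB
      exact hμ.trans (mul_le_mul_of_nonneg_left h2 hM.le)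
    rw [hz]
    have g1 := abs_add_le (tE - uE - (uH - uE)) ((x / x' - 1) * tE + (μ - μ') / x')
    have g2 := abs_sub (tE - uE) (uH - uE)
    have g3 := abs_add_le ((x / x' - 1) * tE) ((μ - μ') / x')
    linarith
  set d := (z - uH) / (σ * X ^ g) with hd
  -- Dividing 2K + 2MB by 3/4, the lower bound for the estimated scale relative to aE, stays below
  -- K' = 4K + 4MB.
  have hdb : |d| ≤ K' * (e n * w) := by
    rw [hd, abs_div, abs_of_pos hsE0, div_le_iff₀ hsE0]
    have a1 : K' * (e n * w) * (3 / 4 * aE) ≤ K' * (e n * w) * (σ * X ^ g) :=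
      mul_le_mul_of_nonneg_left hsE (by positivity)
    have a2 : 0 ≤ (K + M * B) * (e n * w) * aE := by positivity
    simp only [K'] at a1 ⊢
    linarith
  have hgG : |g| ≤ G := by
    have h1 := hg'.trans hsm1
    have h2 := abs_add_le γ (g - γ)
    rw [add_sub_cancel] at h2
    simp only [G]; linarith
  have hGd : G * |d| < 1 := by
    have := mul_le_mul_of_nonneg_left (hdb.trans hsm3) hG.le
    have e1 : G * (1 / (2 * G)) = 1 / 2 := by field_simp
    linarith
  have hmain := abs_one_sub_gpCdf_mul_sub_one_le hgG hσ0 hX1 (hdb.trans hsm2) hGd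
  have e1 : σ * (boxCox g X + X ^ g * d) = z - u := by
    rw [hd]; simp only [uH]; field_simp; ring
  rw [e1] at hmain
  rw [div_eq_mul_one_div _ (s n), ← hXdef]
  refine hmain.trans ?_
  rw [div_mul_eq_mul_div]
  exact div_le_div_of_nonneg_right hdb hc0.le

end LevelRegime

/-! ### Stochastic boundedness and proof of the main theorem. -/

theorem IsBigOP.congr_rate {Ω : Type*} [MeasurableSpace Ω] {P : Measure Ω} {X : ℕ → Ω → ℝ}
    {r r' : ℕ → ℝ} (h : IsBigOP P X r) (hr : ∀ᶠ n in atTop, r n = r' n) : IsBigOP P X r' := by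
  intro η hη
  obtain ⟨M, hM, h⟩ := h η hη
  refine ⟨M, hM, ?_⟩
  filter_upwards [h, hr] with n h hr
  rwa [← hr]

/-- A quantity that is controlled on events where finitely many others are stochastically bounded
is itself stochastically bounded. -/
theorem IsBigOP.of_eventually {Ω ι : Type*} [MeasurableSpace Ω] [Fintype ι] {P : Measure Ω}
    {X : ι → ℕ → Ω → ℝ} {r : ι → ℕ → ℝ} (hX : ∀ i, IsBigOP P (X i) (r i))
    (hr : ∀ i, ∀ᶠ n in atTop, 0 ≤ r i n) {E : ℕ → Set Ω}
    (hE : Tendsto (fun n => P (E n)) atTop (𝓝 0)) {Z : ℕ → Ω → ℝ} {q : ℕ → ℝ}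
    (hZ : ∀ M : ℝ, 0 < M → ∃ K : ℝ, 0 < K ∧ ∀ᶠ n in atTop, ∀ᵐ ω ∂P,
      (∀ i, |X i n ω| ≤ M * r i n) → ω ∉ E n → |Z n ω| ≤ K * q n) : IsBigOP P Z q := by
  intro η hη
  -- One share of η for each controlled variable and one for the exceptional event.
  set η' := η / (Fintype.card ι + 1) with hη'
  have hη'0 : 0 < η' := by positivity
  choose M hM hMb using fun i => hX i η' hη'0
  obtain ⟨K, hK, hKb⟩ := hZ (1 + ∑ i, M i)
    (by have := Finset.sum_nonneg (fun i (_ : i ∈ Finset.univ) => (hM i).le); linarith)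
  refine ⟨K, hK, ?_⟩
  filter_upwards [eventually_all.2 hMb, eventually_all.2 hr, hKb,
    hE.eventually (eventually_le_nhds (ENNReal.ofReal_pos.2 hη'0))] with n h1 h2 h3 h4
  have hsub : {ω | K * q n < |Z n ω|} ≤ᵐ[P] (E n ∪ ⋃ i, {ω | M i * r i n < |X i n ω|} : Set Ω) := by
    filter_upwards [h3] with ω hω hlt
    by_contra hcon
    have hcon' : ω ∉ E n ∪ ⋃ i, {ω | M i * r i n < |X i n ω|} := hcon
    simp only [mem_union, mem_iUnion, mem_ofPred_eq, not_or, not_exists, not_lt] at hcon'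
    refine (hω (fun i => (hcon'.2 i).trans (mul_le_mul_of_nonneg_right ?_ (h2 i)))
      hcon'.1).not_gt hlt
    have := Finset.single_le_sum (f := M) (fun i _ => (hM i).le) (Finset.mem_univ i)
    linarith
  calc P {ω | K * q n < |Z n ω|} ≤ P (E n ∪ ⋃ i, {ω | M i * r i n < |X i n ω|}) :=
        measure_mono_ae hsub
    _ ≤ P (E n) + ∑ i, P {ω | M i * r i n < |X i n ω|} :=
        (measure_union_le _ _).trans (add_le_add le_rfl (measure_iUnion_fintype_le _ _))
    _ ≤ ENNReal.ofReal η' + ∑ _i : ι, ENNReal.ofReal η' :=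
        add_le_add h4 (Finset.sum_le_sum fun i _ => h1 i)
    _ = ENNReal.ofReal η := by
        rw [Finset.sum_const, Finset.card_univ, nsmul_eq_mul, ← ENNReal.ofReal_natCast,
          ← ENNReal.ofReal_mul (by positivity), ← ENNReal.ofReal_add hη'0.le (by positivity)]
        congr 1
        rw [hη']; field_simp; ring

theorem sInf_cond_map_eq {ν : Measure ℝ} [IsProbabilityMeasure ν] {γ t₀ t s m x : ℝ}
    (h : RegularTail (cdf ν) γ t₀) (ht : t₀ ≤ t) (hx : 0 < x) (hs0 : 0 < s) (hs1 : s ≤ 1) :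
    sInf {y | m + x * tailQuantile (cdf ν) t ≤ y ∧ 1 - s ≤ (ProbabilityTheory.cond
      (ν.map (fun e => m + x * e)) (Ioi (m + x * tailQuantile (cdf ν) t))).real (Iic y)} =
      m + x * tailQuantile (cdf ν) (t * (1 / s)) := by
  have ht0 : 0 < t := by linarith [h.one_lt]
  have hX : 1 ≤ 1 / s := by rw [le_div_iff₀ hs0]; linarith
  have hle : t ≤ t * (1 / s) := le_mul_of_one_le_right ht0.le hX
  have hm := h.one_sub_mem (ht.trans hle)
  have hmono := h.strictMonoOn_tailQuantile.monotoneOn (mem_Ici.2 ht) (mem_Ici.2 (ht.trans hle)) hle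
  have hmono' := mul_le_mul_of_nonneg_left hmono hx.le
  rw [← csInf_Ici (a := m + x * tailQuantile (cdf ν) (t * (1 / s)))]
  congr 1
  ext y
  simp only [mem_ofPred_eq, mem_Ici, Measure.real, cond_map_apply_Iic h ht hx,
    ENNReal.toReal_ofReal']
  -- For s = 1 the level is 0 and its constraint is void; the restriction to the half-line above the
  -- threshold alone yields the value.
  rcases hs1.lt_or_eq with hs | rfl
  · have hiff : 1 - s ≤ max (1 - t * (1 - cdf ν ((y - m) / x))) 0 ↔
        m + x * tailQuantile (cdf ν) (t * (1 / s)) ≤ y := by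
      have e3 : m + x * tailQuantile (cdf ν) (t * (1 / s)) ≤ y ↔
          tailQuantile (cdf ν) (t * (1 / s)) ≤ (y - m) / x := by
        rw [le_div_iff₀ hx]
        constructor <;> intro <;> linarith
      rw [e3, tailQuantile, quantile_cdf_le_iff ν hm.1 hm.2, le_max_iff,
        or_iff_left (by linarith), show 1 / (t * (1 / s)) = s / t by field_simp,
        (sub_le_comm : 1 - s / t ≤ cdf ν ((y - m) / x) ↔ _), le_div_iff₀ ht0]
      constructor <;> intro <;> linarith
    rw [hiff]
    exact ⟨fun hh => hh.2, fun hh => ⟨by linarith, hh⟩⟩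
  · simp

theorem setIntegral_affine_image {g : ℝ → ℝ} {m x : ℝ} (hx : 0 < x) {B : Set ℝ}
    (hB : MeasurableSet B) : MeasurableSet ((fun z => m + x * z) '' B) ∧
      ∫ y in (fun z => m + x * z) '' B, g ((y - m) / x) / x = ∫ z in B, g z := by
  have himg : (fun z => m + x * z) '' B = (fun y => (y - m) / x) ⁻¹' B := by
    ext y
    constructor
    · rintro ⟨z, hz, rfl⟩
      simp only [mem_preimage]
      rwa [add_sub_cancel_left, mul_div_cancel_left₀ _ hx.ne']
    · intro hy
      exact ⟨_, hy, by field_simp; ring⟩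
  have hm : MeasurableSet ((fun z => m + x * z) '' B) := by
    rw [himg]
    exact (by fun_prop : Measurable fun y : ℝ => (y - m) / x) hB
  refine ⟨hm, ?_⟩
  rw [← integral_indicator hm, ← integral_indicator hB]
  have e : ∀ y, ((fun z => m + x * z) '' B).indicator (fun y => g ((y - m) / x) / x) y =
      (fun y => B.indicator g (y / x) / x) (y - m) := by
    intro y
    rw [himg]
    by_cases hy : (y - m) / x ∈ B
    · rw [indicator_of_mem (by exact hy)]; simp only [indicator_of_mem hy]
    · rw [indicator_of_notMem (by exact hy)]; simp only [indicator_of_notMem hy, zero_div]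
  simp only [e]
  rw [integral_sub_right_eq_self (fun y => B.indicator g (y / x) / x) m, integral_div,
    Measure.integral_comp_div (B.indicator g) x, abs_of_pos hx, smul_eq_mul]
  field_simp

theorem withDensity_real_eq {f : ℝ → ℝ} (hf : Integrable f) (hf0 : ∀ y, 0 ≤ f y) {R : Set ℝ}
    (hR : MeasurableSet R) :
    (volume.withDensity (fun y => ENNReal.ofReal (f y))).real R = ∫ y in R, f y := by
  rw [Measure.real, withDensity_apply _ hR,
    ← ofReal_integral_eq_lintegral_ofReal hf.integrableOn (Eventually.of_forall hf0),
    ENNReal.toReal_ofReal (integral_nonneg hf0)]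

theorem abs_setIntegral_sub_le {f g : ℝ → ℝ} (hf : Integrable f) (hg : Integrable g) (R : Set ℝ) :
    |(∫ y in R, f y) - ∫ y in R, g y| ≤ ∫ y, |f y - g y| := by
  rw [← integral_sub hf.integrableOn hg.integrableOn]
  refine (abs_integral_le_integral_abs).trans ?_
  exact setIntegral_le_integral (hf.sub hg).abs (Eventually.of_forall fun y => abs_nonneg _)

theorem mainTheorem12
    {Ω : Type*} [MeasurableSpace Ω] (P : Measure Ω) [IsProbabilityMeasure P]
    (S : LocationScaleSeries P) (M : Forecaster)
    (γ ρ lam τ₀ : ℝ) (a : ℝ → ℝ) (m l : ℕ → ℝ)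
    -- effective sample size and extreme level
    (hk : Tendsto M.k atTop atTop)
    (hkn : Tendsto (fun n : ℕ => (M.k n : ℝ) / n) atTop (𝓝 0))
    (hν : ∀ᶠ n in atTop, 0 < M.ν n ∧ M.ν n ≤ M.k n)
    (hτ : Tendsto M.tauStar atTop (𝓝 τ₀))
    -- tail of the innovations
    (hγ : -1 / 2 < γ)
    (hSO : SecondOrderCondition S.F γ ρ a)
    (hmono : ρ = 0 → τ₀ = 0 → ∃ t₀, AntitoneOn (fun t => |rateA S.F γ t|) (Set.Ici t₀))
    (hAw : Tendsto (fun n : ℕ => rateA S.F γ ((n : ℝ) / M.k n) * M.wSeq γ n) atTop (𝓝 0))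
    (hlam : 0 < lam)
    (hbal : Tendsto (fun n : ℕ => Real.sqrt (M.k n) * |rateA S.F γ ((n : ℝ) / M.k n)|)
      atTop (𝓝 lam))
    -- one-step-ahead estimation of location and scale
    (hm_nonneg : ∀ n, 0 ≤ m n) (hl_nonneg : ∀ n, 0 ≤ l n)
    (hm : Tendsto m atTop (𝓝 0)) (hl : Tendsto l atTop (𝓝 0))
    (hμ : IsBigOP P (fun n ω => (S.loc (n + 1) ω - M.muNext n (S.sample n ω))
      / M.xiNext n (S.sample n ω)) m)
    (hξ : IsBigOP P (fun n ω => S.scale (n + 1) ω / M.xiNext n (S.sample n ω) - 1) l)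
    (hδ : Tendsto (M.delta S.Q γ a m l) atTop (𝓝 0))
    -- estimation of the generalized Pareto parameters and of the intermediate threshold
    (hest : ∀ C : ℕ → ℝ, Tendsto C atTop atTop →
      (C =o[atTop] fun n => Real.sqrt (M.k n)) →
      IsBigOP P (fun n ω => M.gammaHat n (S.sample n ω) - γ)
        (fun n => C n / Real.sqrt (M.k n)) ∧
      IsBigOP P (fun n ω => M.sigmaHat n (S.sample n ω) / a ((n : ℝ) / M.k n) - 1)
        (fun n => C n / Real.sqrt (M.k n)))
    (hthr : IsBigOP P
      (fun n ω => Real.sqrt (M.k n) * (M.threshold n (S.sample n ω) - S.Q (M.tauI n)))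
      (fun n => a ((n : ℝ) / M.k n)))
    (ε : ℕ → ℝ) (hε : Tendsto ε atTop (𝓝 0))
    (hkε : Tendsto (fun n => Real.sqrt (M.k n) * ε n) atTop atTop)
    (hεw : Tendsto (fun n => ε n * M.wSeq γ n) atTop (𝓝 0)) :
    -- Hellinger accuracy of the predictive density
    IsBigOP P
      (fun n ω => hellinger (S.peakDensity n (S.condQuantile n (M.tauE n)) ω)
        (M.nextDensity n (S.sample n ω)))
      (fun n => Real.sqrt (ε n * M.wSeq γ n + M.delta S.Q γ a m l n) + l n) ∧
    -- coverage of the transformed predictive regions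
    (∀ α : ℝ, 0 < α → α < 1 → ∀ region : (n : ℕ) → (Fin n → ℝ) → Set ℝ,
      (∀ n y, MeasurableSet (region n y)) →
      Tendsto (fun n => P {ω | (∫ z in region n (S.sample n ω),
        M.innovDensity n (M.tauStar n) (S.sample n ω) z) ≠ 1 - α}) atTop (𝓝 0) →
      IsBigOP P
        (fun n ω => (S.peakLaw n (S.condQuantile n (M.tauE n)) ω).real
          (M.nextRegion n (S.sample n ω) (region n (S.sample n ω))) - (1 - α))
        (fun n => Real.sqrt (ε n * M.wSeq γ n + M.delta S.Q γ a m l n) + l n)) ∧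
    -- tail equivalence
    (((fun n => Real.sqrt (M.k n) * m n) =O[atTop]
        fun n => M.peakScale γ a n * M.wSeq γ n) →
      ((fun n => Real.sqrt (M.k n) * l n * S.Q (M.tauE n)) =O[atTop]
        fun n => M.peakScale γ a n * M.wSeq γ n) →
      IsBigOP P
        (fun n ω => (1 - M.nextCdfI n (S.sample n ω)
          (S.peakQuantile n (S.condQuantile n (M.tauI n)) (1 - M.tauStar n) ω))
            / M.tauStar n - 1)
        (fun n => ε n * M.wSeq γ n) ∧
      IsBigOP P
        (fun n ω => (1 - M.tailForecaster n (S.sample n ω) (S.condQuantile n (M.tauE n) ω))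
          / (1 - M.tauE n) - 1)
        (fun n => ε n * M.wSeq γ n)) := by
  have hFprob : IsProbabilityMeasure (P.map (S.innov 0)) :=
    Measure.isProbabilityMeasure_map (S.measurable_innov 0).aemeasurable
  set ν := P.map (S.innov 0) with hνdef
  have hSO' : SecondOrderCondition (cdf ν) γ ρ a := hSO
  obtain ⟨t₀, hreg⟩ := hSO'.exists_regularTail (monotoneOn_quantile_cdf ν)
  have hQ : ∀ p, S.Q p = quantile (cdf ν) p := fun p => rfl
  set T : ℕ → ℝ := fun n => (n : ℝ) / M.k n with hTdef
  have hk0 : ∀ᶠ n in atTop, 0 < (M.k n : ℝ) := by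
    filter_upwards [hk.eventually_gt_atTop 0] with n hn
    exact_mod_cast hn
  have hn0 : ∀ᶠ n : ℕ in atTop, 0 < (n : ℝ) := by
    filter_upwards [eventually_gt_atTop 0] with n hn
    exact_mod_cast hn
  have hT : Tendsto T atTop atTop := by
    have h1 : Tendsto (fun n : ℕ => (M.k n : ℝ) / n) atTop (𝓝[>] 0) := by
      refine tendsto_nhdsWithin_iff.2 ⟨hkn, ?_⟩
      filter_upwards [hk0, hn0] with n h1 h2
      exact div_pos h1 h2
    refine h1.inv_tendsto_nhdsGT_zero.congr fun n => ?_
    simp [hTdef]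
  have hstar : ∀ᶠ n in atTop, M.tauStar n = M.ν n / M.k n := by
    filter_upwards [hk0, hn0] with n h1 h2
    simp only [Forecaster.tauStar, Forecaster.tauE, Forecaster.tauI]
    rw [sub_sub_cancel, sub_sub_cancel]
    field_simp
  have hratio : ∀ᶠ n in atTop, 0 < M.tauStar n ∧ M.tauStar n ≤ 1 := by
    filter_upwards [hk0, hν, hstar] with n h1 h2 h3
    rw [h3, div_le_one h1]
    exact ⟨div_pos h2.1 h1, h2.2⟩
  have hQI : ∀ n, S.Q (M.tauI n) = tailQuantile (cdf ν) (T n) := by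
    intro n
    simp only [hQ, tailQuantile, Forecaster.tauI, hTdef, one_div_div]
  have hQE : ∀ᶠ n in atTop, S.Q (M.tauE n) =
      tailQuantile (cdf ν) (T n * (1 / M.tauStar n)) := by
    filter_upwards [hk0, hn0, hstar, hν] with n h1 h2 h3 h4
    have := h4.1
    rw [hQ, tailQuantile, Forecaster.tauE, h3, hTdef]
    congr 2
    field_simp
  have hsq : ∀ᶠ n in atTop, 0 < Real.sqrt (M.k n) := by
    filter_upwards [hk0] with n hn
    exact Real.sqrt_pos.2 hn
  have hregime : LevelRegime ν γ ρ τ₀ t₀ a T M.tauStar ε (fun n => Real.sqrt (M.k n)) := by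
    refine ⟨hSO', hreg, hmono, hT, hratio, hτ, ?_, hεw, ?_⟩
    -- √k |A(n/k)| is eventually at most λ + 1, whereas √k ε_n tends to infinity.
    · filter_upwards [hbal.eventually (eventually_le_nhds (show lam < lam + 1 by linarith)),
        hkε.eventually_ge_atTop (lam + 1), hsq] with n h1 h2 h3
      exact le_of_mul_le_mul_left (h1.trans h2) h3
    · filter_upwards [hkε.eventually_ge_atTop 1] with n h1
      exact ⟨Real.sqrt_nonneg _, h1⟩
  have hεpos : ∀ᶠ n in atTop, 0 < ε n := by
    filter_upwards [hkε.eventually_ge_atTop 1, hsq] with n h1 h2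
    exact (mul_pos_iff_of_pos_left h2).1 (by linarith)
  have hapos : ∀ᶠ n in atTop, 0 < a (T n) := hT.eventually hSO'.a_pos
  -- The choice C_n = √k ε_n is admissible and makes C_n/√k equal to ε_n.
  have hC : (fun n => Real.sqrt (M.k n) * ε n) =o[atTop] fun n => Real.sqrt (M.k n) := by
    have := (isBigO_refl (fun n => Real.sqrt (M.k n)) atTop).mul_isLittleO
      ((isLittleO_one_iff ℝ).2 hε)
    simpa using this
  have hrate : ∀ᶠ n in atTop, Real.sqrt (M.k n) * ε n / Real.sqrt (M.k n) = ε n := by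
    filter_upwards [hsq] with n h1
    field_simp
  obtain ⟨hestγ, hestσ⟩ := hest _ hkε hC
  have hestγ' := hestγ.congr_rate hrate
  have hestσ' := hestσ.congr_rate hrate
  -- reduction of the stochastic statements to deterministic ones
  have hcomb : ∀ (E : ℕ → Set Ω) (Z : ℕ → Ω → ℝ) (q : ℕ → ℝ),
      Tendsto (fun n => P (E n)) atTop (𝓝 0) →
      (∀ D : ℝ, 0 < D → ∃ K : ℝ, 0 < K ∧ ∀ᶠ n in atTop, ∀ᵐ ω ∂P,
        |M.gammaHat n (S.sample n ω) - γ| ≤ D * ε n →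
        |M.sigmaHat n (S.sample n ω) / a (T n) - 1| ≤ D * ε n →
        |Real.sqrt (M.k n) * (M.threshold n (S.sample n ω) - tailQuantile (cdf ν) (T n))| ≤
          D * a (T n) →
        |(S.loc (n + 1) ω - M.muNext n (S.sample n ω)) / M.xiNext n (S.sample n ω)| ≤ D * m n →
        |S.scale (n + 1) ω / M.xiNext n (S.sample n ω) - 1| ≤ D * l n → ω ∉ E n →
        |Z n ω| ≤ K * q n) → IsBigOP P Z q := by
    intro E Z q hE hZ
    refine IsBigOP.of_eventually (ι := Fin 5)
      (X := ![fun n ω => M.gammaHat n (S.sample n ω) - γ,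
        fun n ω => M.sigmaHat n (S.sample n ω) / a ((n : ℝ) / M.k n) - 1,
        fun n ω => Real.sqrt (M.k n) * (M.threshold n (S.sample n ω) - S.Q (M.tauI n)),
        fun n ω => (S.loc (n + 1) ω - M.muNext n (S.sample n ω)) / M.xiNext n (S.sample n ω),
        fun n ω => S.scale (n + 1) ω / M.xiNext n (S.sample n ω) - 1])
      (r := ![ε, ε, fun n => a (T n), m, l]) ?_ ?_ hE ?_
    · intro i
      fin_cases i
      · exact hestγ'
      · exact hestσ'
      · exact hthr
      · exact hμ
      · exact hξ
    · intro i
      fin_cases i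
      · exact hεpos.mono fun n hn => hn.le
      · exact hεpos.mono fun n hn => hn.le
      · exact hapos.mono fun n hn => hn.le
      · exact Eventually.of_forall hm_nonneg
      · exact Eventually.of_forall hl_nonneg
    · intro D hD
      obtain ⟨K, hK, h⟩ := hZ D hD
      refine ⟨K, hK, ?_⟩
      filter_upwards [h] with n hn
      filter_upwards [hn] with ω hω h5 hωE
      refine hω (h5 0) (h5 1) ?_ (h5 3) (h5 4) hωE
      rw [← hQI]
      exact h5 2
  have hδeq : ∀ n, M.delta S.Q γ a m l n =
      l n * (|tailQuantile (cdf ν) (T n) + a (T n) * boxCox γ (1 / M.tauStar n)| /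
        (a (T n) * (1 / M.tauStar n) ^ γ)) + m n / (a (T n) * (1 / M.tauStar n) ^ γ) := by
    intro n
    simp only [Forecaster.delta, Forecaster.peakScale, hQI]
    rfl
  have hδnonneg : ∀ᶠ n in atTop, 0 ≤ M.delta S.Q γ a m l n := by
    filter_upwards [hapos, hratio] with n h1 h2
    have h3 : 0 < a (T n) * (1 / M.tauStar n) ^ γ :=
      mul_pos h1 (Real.rpow_pos_of_pos (one_div_pos.2 h2.1) γ)
    rw [hδeq]
    exact add_nonneg (mul_nonneg (hl_nonneg n) (by positivity)) (div_nonneg (hm_nonneg n) h3.le)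
  have hscale : ∀ n ω, 0 < S.scale (n + 1) ω := fun n ω => S.scale_pos _ _
  -- total variation accuracy on the good event
  have hTV : ∀ D : ℝ, 0 < D → ∃ K : ℝ, 0 < K ∧ ∀ᶠ n in atTop, ∀ᵐ ω ∂P,
      |M.gammaHat n (S.sample n ω) - γ| ≤ D * ε n →
      |M.sigmaHat n (S.sample n ω) / a (T n) - 1| ≤ D * ε n →
      |Real.sqrt (M.k n) * (M.threshold n (S.sample n ω) - tailQuantile (cdf ν) (T n))| ≤
        D * a (T n) →
      |(S.loc (n + 1) ω - M.muNext n (S.sample n ω)) / M.xiNext n (S.sample n ω)| ≤ D * m n →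
      |S.scale (n + 1) ω / M.xiNext n (S.sample n ω) - 1| ≤ D * l n →
      0 < M.xiNext n (S.sample n ω) ∧ Integrable (M.nextDensity n (S.sample n ω)) ∧
      (∀ y, 0 ≤ M.nextDensity n (S.sample n ω) y) ∧
      ∃ f : ℝ → ℝ, Integrable f ∧ (∀ y, 0 ≤ f y) ∧
        S.peakLaw n (S.condQuantile n (M.tauE n)) ω =
          volume.withDensity (fun y => ENNReal.ofReal (f y)) ∧
        ∫ y, |f y - M.nextDensity n (S.sample n ω) y| ≤
          K * (ε n * M.wSeq γ n + M.delta S.Q γ a m l n) := by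
    intro D hD
    obtain ⟨K, hK, h⟩ := hregime.exists_integral_abs_sub_le hγ hm_nonneg hl_nonneg hδeq hδ hD
    refine ⟨K, hK, ?_⟩
    filter_upwards [h, hQE, hratio] with n hn hQE hs
    filter_upwards [S.condDistrib_ae_eq (n + 1)] with ω hω h1 h2 h3 h4 h5
    obtain ⟨ht, hn⟩ := hn
    obtain ⟨hσ, hx', Ψ', f, hf, hle⟩ := hn _ _ _ _ _ _ _ (hscale n ω) h1 h2 h3 h4 h5
    have hgp := isParetoImage_gpPredDensity (γ := M.gammaHat n (S.sample n ω))
      (u := M.threshold n (S.sample n ω)) (m := M.muNext n (S.sample n ω)) hσ hs.1 hx'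
    refine ⟨hx', hgp.integrable, hgp.nonneg, f, hf.integrable, hf.nonneg, ?_, hle⟩
    rw [LocationScaleSeries.peakLaw, hω, LocationScaleSeries.condQuantile, hQE]
    exact cond_map_eq_withDensity hreg ht (hscale n ω) hf
  have hw1 : ∀ n, 1 ≤ M.wSeq γ n := fun n => one_le_wBar _ _
  have hempty : Tendsto (fun _ : ℕ => P (∅ : Set Ω)) atTop (𝓝 0) := by simp
  refine ⟨?_, ?_, ?_⟩
  · refine hcomb (fun _ => ∅) _ _ hempty fun D hD => ?_
    obtain ⟨K, hK, h⟩ := hTV D hD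
    refine ⟨max 1 K, by positivity, ?_⟩
    filter_upwards [h, hεpos, hδnonneg] with n hn hε0 hδ0
    filter_upwards [hn] with ω hω h1 h2 h3 h4 h5 _
    obtain ⟨hx', hgi, hg0, f, hfi, hf0, hlaw, hle⟩ := hω h1 h2 h3 h4 h5
    have hη : 0 ≤ ε n * M.wSeq γ n + M.delta S.Q γ a m l n := by
      have := hw1 n
      positivity
    have hae : S.peakDensity n (S.condQuantile n (M.tauE n)) ω =ᵐ[volume] f := by
      have h6 := Measure.rnDeriv_withDensity₀ (volume : Measure ℝ)
        (f := fun y => ENNReal.ofReal (f y)) hfi.aestronglyMeasurable.aemeasurable.ennreal_ofReal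
      filter_upwards [h6] with y hy
      rw [LocationScaleSeries.peakDensity, hlaw, hy, ENNReal.toReal_ofReal (hf0 y)]
    rw [hellinger_congr_ae_left hae,
      abs_of_nonneg (show 0 ≤ hellinger f (M.nextDensity n (S.sample n ω)) from Real.sqrt_nonneg _)]
    refine (hellinger_le_sqrt hfi hgi hf0 hg0).trans ((Real.sqrt_le_sqrt hle).trans ?_)
    rw [Real.sqrt_mul hK.le]
    have h7 : Real.sqrt K ≤ max 1 K := by
      rw [Real.sqrt_le_left (by positivity)]
      nlinarith [le_max_left 1 K, le_max_right 1 K]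
    exact mul_le_mul h7 (le_add_of_nonneg_right (hl_nonneg n)) (Real.sqrt_nonneg _) (by positivity)
  · intro α _ _ region hregion hprob
    refine hcomb _ _ _ hprob fun D hD => ?_
    obtain ⟨K, hK, h⟩ := hTV D hD
    refine ⟨K, hK, ?_⟩
    have hsmall : Tendsto (fun n => ε n * M.wSeq γ n + M.delta S.Q γ a m l n) atTop (𝓝 0) := by
      simpa using hεw.add hδ
    filter_upwards [h, hεpos, hδnonneg, hsmall.eventually_le_const one_pos] with n hn hε0 hδ0 hle1
    filter_upwards [hn] with ω hω h1 h2 h3 h4 h5 h6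
    obtain ⟨hx', hgi, hg0, f, hfi, hf0, hlaw, hle⟩ := hω h1 h2 h3 h4 h5
    have hη : 0 ≤ ε n * M.wSeq γ n + M.delta S.Q γ a m l n := by
      have := hw1 n
      positivity
    simp only [ne_eq, not_not] at h6
    obtain ⟨hRm, hRi⟩ := setIntegral_affine_image
      (g := M.innovDensity n (M.tauStar n) (S.sample n ω)) (m := M.muNext n (S.sample n ω)) hx'
      (hregion n (S.sample n ω))
    rw [hlaw, Forecaster.nextRegion, withDensity_real_eq hfi hf0 hRm, ← h6, ← hRi]
    refine (abs_setIntegral_sub_le hfi hgi _).trans (hle.trans ?_)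
    refine mul_le_mul_of_nonneg_left ?_ hK.le
    refine le_trans ?_ (le_add_of_nonneg_right (hl_nonneg n))
    -- The coverage error is bounded by the total variation bound, and x ≤ √x for 0 ≤ x ≤ 1.
    exact Real.le_sqrt_of_sq_le (by nlinarith)
  · intro hmO hlO
    obtain ⟨B₁, hB₁, hmO⟩ := hmO.exists_pos
    obtain ⟨B₂, hB₂, hlO⟩ := hlO.exists_pos
    have hpeak : ∀ᶠ n in atTop, 0 ≤ M.peakScale γ a n * M.wSeq γ n := by
      filter_upwards [hapos, hratio] with n h1 h2
      have h3 : 0 < M.peakScale γ a n :=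
        mul_pos h1 (Real.rpow_pos_of_pos (one_div_pos.2 h2.1) γ)
      have := hw1 n
      positivity
    have hmB : ∀ᶠ n in atTop, Real.sqrt (M.k n) * m n ≤ (B₁ + B₂) *
        (a (T n) * (1 / M.tauStar n) ^ γ * wBar γ (1 / M.tauStar n)) := by
      filter_upwards [hmO.bound, hpeak] with n h1 h2
      rw [Real.norm_of_nonneg h2] at h1
      refine (le_abs_self _).trans (h1.trans ?_)
      exact mul_le_mul_of_nonneg_right (by linarith) h2
    have hlB : ∀ᶠ n in atTop, Real.sqrt (M.k n) * l n *
        |tailQuantile (cdf ν) (T n * (1 / M.tauStar n))| ≤ (B₁ + B₂) *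
        (a (T n) * (1 / M.tauStar n) ^ γ * wBar γ (1 / M.tauStar n)) := by
      filter_upwards [hlO.bound, hpeak, hQE] with n h1 h2 h3
      rw [Real.norm_of_nonneg h2, Real.norm_eq_abs, abs_mul, h3,
        abs_of_nonneg (mul_nonneg (Real.sqrt_nonneg _) (hl_nonneg n))] at h1
      refine h1.trans ?_
      exact mul_le_mul_of_nonneg_right (by linarith) h2
    have htail : ∀ D : ℝ, 0 < D → ∃ K : ℝ, 0 < K ∧ ∀ᶠ n in atTop, ∀ᵐ ω ∂P,
        |M.gammaHat n (S.sample n ω) - γ| ≤ D * ε n →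
        |M.sigmaHat n (S.sample n ω) / a (T n) - 1| ≤ D * ε n →
        |Real.sqrt (M.k n) * (M.threshold n (S.sample n ω) - tailQuantile (cdf ν) (T n))| ≤
          D * a (T n) →
        |(S.loc (n + 1) ω - M.muNext n (S.sample n ω)) / M.xiNext n (S.sample n ω)| ≤ D * m n →
        |S.scale (n + 1) ω / M.xiNext n (S.sample n ω) - 1| ≤ D * l n →
        |(1 - M.nextCdfI n (S.sample n ω) (S.condQuantile n (M.tauE n) ω)) / M.tauStar n - 1| ≤
          K * (ε n * M.wSeq γ n) := by
      intro D hD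
      obtain ⟨K, hK, h⟩ := hregime.exists_abs_tail_ratio_le hl (add_pos hB₁ hB₂) hmB hlB hD
      refine ⟨K, hK, ?_⟩
      filter_upwards [h, hQE] with n hn hQE
      refine Eventually.of_forall fun ω h1 h2 h3 h4 h5 => ?_
      have h6 := hn _ _ _ _ _ _ _ (hscale n ω) h1 h2 h3 h4 h5
      rw [← hQE] at h6
      simpa [Forecaster.wSeq, Forecaster.nextCdfI, Forecaster.innovCdf, gpPredCdf,
        LocationScaleSeries.condQuantile] using h6
    constructor
    · refine hcomb (fun _ => ∅) _ _ hempty fun D hD => ?_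
      obtain ⟨K, hK, h⟩ := htail D hD
      refine ⟨K, hK, ?_⟩
      filter_upwards [h, hQE, hratio, hT.eventually_ge_atTop t₀] with n hn hQE hs ht
      filter_upwards [hn, S.condDistrib_ae_eq (n + 1)] with ω hω hcd h1 h2 h3 h4 h5 _
      -- The quantile of level 1 - τ* above the intermediate threshold leaves unconditional tail
      -- mass τ* (1 - τ_I) = 1 - τ_E, so it is the extreme quantile.
      have hpq : S.peakQuantile n (S.condQuantile n (M.tauI n)) (1 - M.tauStar n) ω =
          S.condQuantile n (M.tauE n) ω := by
        rw [LocationScaleSeries.peakQuantile, LocationScaleSeries.peakLaw, hcd,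
          LocationScaleSeries.condQuantile, LocationScaleSeries.condQuantile, hQE, hQI]
        exact sInf_cond_map_eq hreg ht (hscale n ω) hs.1 hs.2
      rw [hpq]
      exact hω h1 h2 h3 h4 h5
    · refine hcomb (fun _ => ∅) _ _ hempty fun D hD => ?_
      obtain ⟨K, hK, h⟩ := htail D hD
      refine ⟨K, hK, ?_⟩
      filter_upwards [h] with n hn
      filter_upwards [hn] with ω hω h1 h2 h3 h4 h5 _
      refine le_trans (le_of_eq ?_) (hω h1 h2 h3 h4 h5)
      -- The forecaster has tail (1 - τ_I)(1 - F̂), so dividing by 1 - τ_E gives the ratio already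
      -- bounded.
      rw [Forecaster.tailForecaster, Forecaster.tauStar, div_div_eq_mul_div]
      congr 3
      ring

end
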